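/- **Setting.** For even $L$ let $\Gamma=\mathbb Z_L^2$ be the discrete torus, with coordinates $x_1,x_2$ taken in $(-L/2,L/2]$ and Euclidean torus distance. Fermions with internal label $\sigma\in\{1,\dots,n\}$ live on $\Gamma$, with annihilation and creation operators $c_{x,\sigma},c^*_{x,\sigma}$ on Fock space, $n_x=\sum_\sigma c^*_{x,\sigma}c_{x,\sigma}$ and $n_X=\sum_{x\in X}n_x$. For a one-form $A$ (a real function on oriented edges) let $$H_A=\sum_{x\sim x'}\sum_{\sigma,\sigma'}\alpha(x,\sigma;x',\sigma')\,e^{iA(x,x')}\,c^*_{x,\sigma}c_{x',\sigma'}+\sum_{X\subset\Gamma}B_X,\qquad H=H_0,$$ the first sum being over ordered pairs of nearest neighbours. Assume $\alpha(x,\sigma;x',\sigma')=\overline{\alpha(x',\sigma';x,\sigma)}$ and $|\alpha|\le m$; each $B_X$ is Hermitian, supported in $X$, commutes with every $n_x$, satisfies $\|B_X\|\le m$, and vanishes unless $\mathrm{diam}(X)\le R$; and $H$ has a non-degenerate ground state separated from the rest of the spectrum by at least $g>0$. Let $P(H_A)$ be the projection onto the lowest eigenspace of $H_A$, $P=P(H)$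 and $\omega(O)=\mathrm{Tr}(PO)$. *Adiabatic curvature.* $\kappa=i\,\mathrm{Tr}(P[\partial_1P,\partial_2P])$, where $\partial_jP$ is the $\phi_j$-derivative at $\phi=0$ of $P(H_{\phi_1\xi_1+\phi_2\xi_2})$ and $\xi_j=dx_j/L$. *Kubo response.* $\chi_{J,V}=i\lim_{\epsilon\to0^+}\int_0^\infty\omega([V(-t),J])\,e^{-\epsilon t}\,dt$, with $V(t)=e^{itH}Ve^{-itH}$. *Current.* For $d\ge1$ let $\gamma_d$ be the path in the dual lattice in the positive $x_1$-direction from $(-d+\frac12,\frac12)$ to $(d+\frac12,\frac12)$. For a dual edge $e$ let $e_L,e_R$ be the sites just to its left and right. Put $$J_{\gamma_d}=-i\sum_{e\in\gamma_d}\sum_{\sigma,\sigma'}\Big(\alpha(e_R,\sigma;e_L,\sigma')\,c^*_{e_R,\sigma}c_{e_L,\sigma'}-\alpha(e_L,\sigma';e_R,\sigma)\,c^*_{e_L,\sigma'}c_{e_R,\sigma}\Big),$$ the contribution of the bonds crossed by $\gamma_d$ to $i[H,n_X]$, where $X$ lies to the right of $\gamma_d$. **Theorem.** Fix $n,R,m$,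 $g>0$, $E\neq0$ and $C$. For every $k\in\mathbb N$ there is a constant $K$, depending only on $n,R,m,g,E,C,k$, such that the following holds for every even $L$, every $H$ as above, and all integers $\ell,r\ge1$ with $\ell+2r<L/2$. Let $v:\Gamma\to\mathbb R$ satisfy $|dv|\le C$ on all edges, $dv=E\,dx_1$ on all edges with both endpoints in $\{|x_1|\le\ell\}$, and $dv=0$ on all edges with both endpoints in $\{\ell\le|x_1|\le\ell+2r\}$. Put $V=\sum_xv(x)n_x$, $J=J_{\gamma_d}$ with $d=\ell+r$, and $\Delta v=v(\ell,0)-v(-\ell,0)$. Then the derivatives defining $\kappa$, the integrals and the limit defining $\chi_{J,V}$ exist, and $$\Big|\kappa-\frac{\chi_{J,V}}{\Delta v}\Big|\le K\,r^{-k}.$$ -/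

import Mathlib

open scoped Matrix.Norms.L2Operator

noncomputable section

namespace HallTorus

/-! ### The discrete torus -/

/-- The sites of the discrete torus `ℤ_L × ℤ_L`. -/
abbrev Site (L : ℕ) : Type := ZMod L × ZMod L

/-- Nearest neighbours on the torus. -/
def Adj {L : ℕ} (x y : Site L) : Prop :=
  (x.1 = y.1 ∧ (y.2 = x.2 + 1 ∨ x.2 = y.2 + 1)) ∨
    (x.2 = y.2 ∧ (y.1 = x.1 + 1 ∨ x.1 = y.1 + 1))

/-- Euclidean distance on the torus; `ZMod.valMinAbs` is the representative in `(-L/2, L/2]`. -/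
def torusDist {L : ℕ} (x y : Site L) : ℝ :=
  Real.sqrt (((x.1 - y.1).valMinAbs : ℝ) ^ 2 + ((x.2 - y.2).valMinAbs : ℝ) ^ 2)

/-- The vertical strip `{a ≤ |x₁| ≤ b}`, where `x₁ ∈ (-L/2, L/2]`. -/
def strip (L a b : ℕ) : Set (Site L) :=
  {x | (a : ℤ) ≤ |x.1.valMinAbs| ∧ |x.1.valMinAbs| ≤ (b : ℤ)}

/-- A one-form assigns a real number to every oriented edge `(x, y)`; only its values on pairs of
adjacent sites matter. -/
abbrev OneForm (L : ℕ) : Type := Site L → Site L → ℝ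

/-- The exterior derivative of a function on the sites. -/
def extDeriv {L : ℕ} (θ : Site L → ℝ) : OneForm L := fun x y => θ y - θ x

/-- The form `dx₁`: it is `±1` on edges pointing in the `±1`-direction, `0` on vertical edges. -/
def dx₁ (L : ℕ) : OneForm L := fun x y => ((y.1 - x.1).valMinAbs : ℝ)

/-- The form `dx₂`. -/
def dx₂ (L : ℕ) : OneForm L := fun x y => ((y.2 - x.2).valMinAbs : ℝ)

/-- `φ₁ ξ₁ + φ₂ ξ₂`, with `ξᵢ = dxᵢ / L`: the vector potential threading the fluxes `φ₁`, `φ₂`. -/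
def fluxForm (L : ℕ) (φ₁ φ₂ : ℝ) : OneForm L :=
  fun x y => φ₁ * (dx₁ L x y / L) + φ₂ * (dx₂ L x y / L)

/-! ### Fermions on the torus -/

/-- Fermionic modes `(x, σ)`: a site and an internal label. -/
abbrev Mode (L n : ℕ) : Type := Site L × Fin n

/-- An injective numbering of the modes, used to order them. -/
def modeIndex {L n : ℕ} (i : Mode L n) : ℕ := (i.1.1.val * L + i.1.2.val) * n + i.2.val

/-- Operators on the fermionic Fock space over `ℓ²(Γ, ℂⁿ)`, as matrices in the occupation number
basis, which is indexed by the finite sets of occupied modes. The norm is the operator norm. -/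
abbrev Op (L n : ℕ) : Type := Matrix (Finset (Mode L n)) (Finset (Mode L n)) ℂ

/-- The annihilation operator `c_i`: it sends the basis vector `T` with `i ∈ T` to
`(-1) ^ #{j ∈ T | j < i}` times the basis vector `T \ {i}`, and all others to `0`. -/
def annih {L n : ℕ} (i : Mode L n) : Op L n := fun S T =>
  if i ∈ T ∧ S = T.erase i then
    (-1) ^ (T.filter fun j => modeIndex j < modeIndex i).card
  else 0

/-- The creation operator `c_i^*`. -/
def creat {L n : ℕ} (i : Mode L n) : Op L n := (annih i).conjTranspose

variable {L n : ℕ} [NeZero L]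

/-- The particle number at the site `x`. -/
def number (n : ℕ) (x : Site L) : Op L n := ∑ σ : Fin n, creat (x, σ) * annih (x, σ)

/-- `⟨v, n⟩ = ∑ₓ v(x) nₓ`. -/
def potential (n : ℕ) (v : Site L → ℝ) : Op L n := ∑ x : Site L, (v x : ℂ) • number n x

/-- The algebra of operators with spatial support in `X`: it is generated by the creation and
annihilation operators at the sites of `X`. -/
def supportedOn (n : ℕ) (X : Set (Site L)) : Subalgebra ℂ (Op L n) :=
  Algebra.adjoin ℂ {O | ∃ i : Mode L n, i.1 ∈ X ∧ (O = annih i ∨ O = creat i)}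

/-! ### Hamiltonians and currents -/

/-- The data of a Hamiltonian: hopping amplitudes `α(x,σ,x',σ')` and interaction terms `B_X`. -/
structure Model (L n : ℕ) where
  hop : Mode L n → Mode L n → ℂ
  inter : Finset (Site L) → Op L n

open Classical in
/-- The Hamiltonian `H_A` with vector potential `A`: the hopping amplitude `α(x,σ,x',σ')` is
replaced by `α(x,σ,x',σ') exp(i A(x,x'))`. -/
def Model.hamiltonianWith (M : Model L n) (A : OneForm L) : Op L n :=
  (∑ x : Site L, ∑ x' : Site L, if Adj x x' then
      ∑ σ : Fin n, ∑ σ' : Fin n,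
        (M.hop (x, σ) (x', σ') * Complex.exp (Complex.I * (A x x' : ℂ))) •
          (creat (x, σ) * annih (x', σ'))
    else 0) + ∑ X : Finset (Site L), M.inter X

/-- The Hamiltonian `H`. -/
def Model.hamiltonian (M : Model L n) : Op L n := M.hamiltonianWith 0

/-- The lowest point of the spectrum. -/
def groundEnergy (H : Op L n) : ℝ := sInf (spectrum ℝ H)

/-- The orthogonal projection onto the eigenspace of the lowest eigenvalue (of a Hermitian
operator), through functional calculus. -/
def groundProj (H : Op L n) : Op L n :=
  cfc (fun t : ℝ => if t = groundEnergy H then (1 : ℝ) else 0) H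

/-- The lowest eigenvalue is non-degenerate, and separated from the rest of the spectrum by a
distance of at least `g`. -/
def HasGap (H : Op L n) (g : ℝ) : Prop :=
  Module.finrank ℂ (Module.End.eigenspace (Matrix.toLin' H) (groundEnergy H : ℂ)) = 1 ∧
    ∀ E ∈ spectrum ℝ H, E ≠ groundEnergy H → groundEnergy H + g ≤ E

/-- The assumptions on the Hamiltonian: Hermitian bounded nearest neighbour hopping, interaction
terms of range `R` that are bounded by `m`, Hermitian and commute with all local particle
numbers, and a non-degenerate ground state with spectral gap `g`. -/
structure Model.IsAdmissible (M : Model L n) (R m g : ℝ) : Prop where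
  hop_herm : ∀ x x' : Site L, Adj x x' → ∀ σ σ' : Fin n,
    M.hop (x, σ) (x', σ') = star (M.hop (x', σ') (x, σ))
  hop_bound : ∀ x x' : Site L, Adj x x' → ∀ σ σ' : Fin n, ‖M.hop (x, σ) (x', σ')‖ ≤ m
  inter_support : ∀ X : Finset (Site L), M.inter X ∈ supportedOn n (X : Set (Site L))
  inter_range : ∀ X : Finset (Site L), M.inter X ≠ 0 → ∀ x ∈ X, ∀ y ∈ X, torusDist x y ≤ R
  inter_bound : ∀ X : Finset (Site L), ‖M.inter X‖ ≤ m
  inter_herm : ∀ X : Finset (Site L), (M.inter X).IsHermitian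
  inter_number : ∀ (X : Finset (Site L)) (x : Site L), Commute (M.inter X) (number n x)
  gap : HasGap M.hamiltonian g

/-- The current through the oriented dual edge that has the site `l` just to its left and the site
`r` just to its right: the contribution of the bond `{l, r}` to `i [H, n_X]`, where the region `X`
lies to the right of the dual edge (`r ∈ X`, `l ∉ X`). -/
def Model.edgeCurrent (M : Model L n) (l r : Site L) : Op L n :=
  (-Complex.I) • ∑ σ : Fin n, ∑ σ' : Fin n,
    (M.hop (r, σ) (l, σ') • (creat (r, σ) * annih (l, σ')) -
      M.hop (l, σ') (r, σ) • (creat (l, σ') * annih (r, σ)))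

/-- The current `J_{γ_d}` through the dual path `γ_d` that runs in the positive 1-direction from
`x₁ = -d + 1/2` to `x₁ = d + 1/2` at `x₂ = 1/2`. Its `2 d` edges cross the vertical bonds between
`(a, 0)` (to the right of the path) and `(a, 1)` (to the left), with `-d < a ≤ d`. -/
def Model.pathCurrent (M : Model L n) (d : ℕ) : Op L n :=
  ∑ a ∈ Finset.Ioc (-(d : ℤ)) (d : ℤ), M.edgeCurrent ((a : ZMod L), 1) ((a : ZMod L), 0)

/-! ### Response coefficients -/

/-- The ground state expectation `ω(O) = Tr(P O)`. -/
def groundExp (H O : Op L n) : ℂ := Matrix.trace (groundProj H * O)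

/-- Heisenberg evolution `e^{itH} O e^{-itH}`. -/
def evolve (H : Op L n) (t : ℝ) (O : Op L n) : Op L n :=
  NormedSpace.exp ((Complex.I * (t : ℂ)) • H) * O * NormedSpace.exp (-(Complex.I * (t : ℂ)) • H)

/-- The integrand `ω([V(-t), J]) e^{iνt - εt}` of the Kubo formula. -/
def kuboIntegrand (H J V : Op L n) (ν ε t : ℝ) : ℂ :=
  groundExp H (evolve H (-t) V * J - J * evolve H (-t) V) *
    Complex.exp (Complex.I * (ν : ℂ) * (t : ℂ) - (ε : ℂ) * (t : ℂ))

/-- `χ` is the Kubo response coefficient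
`χ_{J,V}(ν) = i lim_{ε → 0⁺} ∫₀^∞ ω([V(-t), J]) e^{iνt - εt} dt`
(that is, the integrals converge and the limit exists and equals `χ`). -/
def IsKuboResponse (H J V : Op L n) (ν : ℝ) (χ : ℂ) : Prop :=
  (∀ ε : ℝ, 0 < ε →
    MeasureTheory.IntegrableOn (kuboIntegrand H J V ν ε) (Set.Ioi 0) MeasureTheory.volume) ∧
  Filter.Tendsto (fun ε : ℝ => Complex.I * ∫ t in Set.Ioi (0 : ℝ), kuboIntegrand H J V ν ε t)
    (nhdsWithin 0 (Set.Ioi 0)) (nhds χ)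

/-- The twist Hamiltonian `H(φ₁, φ₂)`. -/
def Model.twist (M : Model L n) (φ₁ φ₂ : ℝ) : Op L n := M.hamiltonianWith (fluxForm L φ₁ φ₂)

/-- `κ` is the adiabatic curvature `i Tr(P [∂₁P, ∂₂P])` at `φ = 0`, where `P(φ)` is the ground
state projection of the twist Hamiltonian (in particular the partial derivatives exist). -/
def Model.IsAdiabaticCurvature (M : Model L n) (κ : ℂ) : Prop :=
  ∃ D₁ D₂ : Op L n,
    HasDerivAt (fun φ : ℝ => groundProj (M.twist φ 0)) D₁ 0 ∧
    HasDerivAt (fun φ : ℝ => groundProj (M.twist 0 φ)) D₂ 0 ∧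
    κ = Complex.I * Matrix.trace (groundProj M.hamiltonian * (D₁ * D₂ - D₂ * D₁))

end HallTorus

end

/-!
The adiabatic curvature and the Kubo coefficient are two values of one bilinear form. For a
Hamiltonian `H` with ground state projection `P` and reduced resolvent `S`, put
`Ω(A, B) = i Tr(P (A S S B - B S S A))`, and let `D_ξ` be the current of a one-form `ξ`, the
derivative of `H_{φξ}` at `φ = 0`. First-order perturbation theory gives `P' = -(S D P + P D S)`,
hence `κ = Ω(D_ξ₁, D_ξ₂)` (`EigenFrame.isAdiabaticCurvature`). Since `i[H, V] = D_{dv}` for a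
potential `V = ∑ v(x) nₓ` (`Model.IsAdmissible.formCurrent_extDeriv`), and since the current through
the path `γ_d` is `-D_ζ` for the one-form `ζ` supported on the bonds crossed by `γ_d`
(`Model.pathCurrent_eq`), the Kubo coefficient is `χ = Ω(D_{dv}, D_ζ)`
(`EigenFrame.isKuboResponse_formCurv`). What remains is to compare
`Ω(dx₁ / L, dx₂ / L)` with `Ω(dv / Δv, ζ)`.

Two properties of `Ω` make this possible.

* Locality: `Ω` of two bond operators decays faster than any power of their distance, uniformly in
  the size of the torus (`exists_norm_curv_bond_le`). With a filter function `w` that has integral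
  one, vanishing first moment and a Fourier transform supported in the gap
  (`exists_spectral_filter`), `Ω(A, B)` is `i` times the integral of `w` against a function whose
  second derivative is `ω([A(t), B])` (`EigenFrame.exists_norm_curv_le`); a Lieb–Robinson bound
  (`norm_comm_evolve_le`) controls this commutator.
* Gauge invariance: `Ω(D_{dθ}, D_{dη}) = 0`, because potentials commute
  (`EigenFrame.formCurv_extDeriv_extDeriv`).

A cut is the closed one-form that counts the crossings of a straight line of the dual lattice.
Neighbouring parallel cuts differ by the differential of the indicator function of a line of sites.
By gauge invariance the response of a single charge to a cut does not depend on where the cut is,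
and may be computed with the cut at distance of order `L`; so by locality `Ω` of two crossing cuts
is independent of their positions up to `O(L^{-k})`
(`EigenFrame.HasDecay.norm_formCurv_cut_sub_le`). The form `dxᵢ / L` is the average of all cuts, and
`dv / Δv` is the average of the cuts in the strip `|x₁| ≤ ℓ`, up to a form supported at distance `r`
from the path; the path agrees with a full cut up to bonds at distance `r` from the strip. By
locality these discrepancies contribute `O(r^{-k})`.
-/

noncomputable section

namespace HallTorus

set_option linter.unusedSectionVars false

/-! ### A filter function with a spectral gap -/

open MeasureTheory Complex in
/-- A rapidly decaying function `w` of integral one and vanishing first moment whose Fourier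
transform vanishes at all frequencies `|ω| ≥ g`: the symmetrised inverse Fourier transform of a
smooth bump. -/
theorem exists_spectral_filter {g : ℝ} (hg : 0 < g) :
    ∃ w : ℝ → ℂ, Continuous w ∧ (∀ N : ℕ, Integrable fun t => (1 + |t|) ^ N * ‖w t‖) ∧
      (∫ t, w t = 1) ∧ (∫ t : ℝ, (t : ℂ) * w t = 0) ∧
      ∀ ω : ℝ, g ≤ |ω| → ∫ t, w t * cexp (I * ω * t) = 0 := by
  have hpi := Real.pi_pos
  -- The Fourier transform at `ξ` has frequency `2πξ`, so the bump lives on `|ξ| ≤ g / (2π)`.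
  let b : ContDiffBump (0 : ℝ) := ⟨g / (2 * Real.pi) / 2, g / (2 * Real.pi), by positivity,
    by have : 0 < g / (2 * Real.pi) := by positivity
       linarith⟩
  have hsm : ContDiff ℝ (⊤ : ℕ∞) (fun x => ((b x : ℝ) : ℂ)) :=
    Complex.ofRealCLM.contDiff.comp b.contDiff
  have hcs : HasCompactSupport (fun x => ((b x : ℝ) : ℂ)) :=
    b.hasCompactSupport.comp_left (g := fun x : ℝ => (x : ℂ)) (by simp)
  let f : SchwartzMap ℝ ℂ := hcs.toSchwartzMap hsm
  let w₀ : SchwartzMap ℝ ℂ := FourierTransformInv.fourierInv f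
  have hf : ∀ x, f x = ((b x : ℝ) : ℂ) := fun x => rfl
  have hw₀ : ∀ ξ : ℝ, ∫ t, w₀ t * cexp (-(2 * Real.pi * ξ) * I * t) = f ξ := by
    intro ξ
    have h1 : (FourierTransform.fourier w₀ : SchwartzMap ℝ ℂ) = f :=
      FourierTransform.fourier_fourierInv_eq f
    rw [← h1, SchwartzMap.fourier_coe, Real.fourier_eq']
    refine integral_congr_ae (Filter.Eventually.of_forall fun t => ?_)
    simp only [smul_eq_mul, RCLike.inner_apply, conj_trivial]
    rw [mul_comm]
    congr 2
    push_cast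
    ring
  have hint₀ : ∀ N : ℕ, Integrable fun t => (1 + |t|) ^ N * ‖w₀ t‖ := by
    intro N
    have h1 := (w₀.integrable_pow_mul volume N)
    have h2 := (w₀.integrable_pow_mul volume 0)
    refine ((h1.add h2).const_mul (2 ^ (N - 1))).mono' (by fun_prop)
      (Filter.Eventually.of_forall fun t => ?_)
    have h3 := add_pow_le (zero_le_one) (abs_nonneg t) N
    simp only [Pi.add_apply, Real.norm_eq_abs, pow_zero, one_mul]
    rw [abs_of_nonneg (by positivity)]
    rw [one_pow] at h3
    calc (1 + |t|) ^ N * ‖w₀ t‖ ≤ (2 ^ (N - 1) * (1 + |t| ^ N)) * ‖w₀ t‖ := by gcongr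
      _ = _ := by ring
  have hintw : Integrable w₀ := w₀.integrable
  have hintw' : Integrable (fun t => w₀ (-t)) := hintw.comp_neg
  -- An even function has vanishing first moment.
  let w : ℝ → ℂ := fun t => (w₀ t + w₀ (-t)) / 2
  have hwc : Continuous w := by
    have := w₀.continuous
    fun_prop
  have hint : ∀ N : ℕ, Integrable fun t => (1 + |t|) ^ N * ‖w t‖ := by
    intro N
    have h1 := hint₀ N
    have h2 := h1.comp_neg
    simp only [abs_neg] at h2
    refine (h1.add h2).mono' (by fun_prop) (Filter.Eventually.of_forall fun t => ?_)
    simp only [Pi.add_apply, Real.norm_eq_abs]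
    rw [abs_of_nonneg (by positivity), ← mul_add]
    gcongr
    simp only [w]
    rw [norm_div]
    have := norm_add_le (w₀ t) (w₀ (-t))
    have h4 := norm_nonneg (w₀ t + w₀ (-t))
    simp only [RCLike.norm_ofNat]
    linarith
  have hexp : ∀ a : ℝ, Integrable fun t => w₀ t * cexp (-(2 * Real.pi * a) * I * t) := by
    intro a
    refine hintw.norm.mono' (by have := w₀.continuous; fun_prop)
      (Filter.Eventually.of_forall fun t => ?_)
    rw [norm_mul, Complex.norm_exp]
    simp
  have hFw : ∀ ξ : ℝ, ∫ t, w t * cexp (-(2 * Real.pi * ξ) * I * t) = (f ξ + f (-ξ)) / 2 := by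
    intro ξ
    have h1 : ∫ t, w₀ (-t) * cexp (-(2 * Real.pi * ξ) * I * t) = f (-ξ) := by
      rw [← hw₀ (-ξ), ← integral_neg_eq_self]
      refine integral_congr_ae (Filter.Eventually.of_forall fun t => ?_)
      simp only [neg_neg]
      congr 2
      push_cast
      ring
    have h2 : Integrable fun t => w₀ (-t) * cexp (-(2 * Real.pi * ξ) * I * t) := by
      have := (hexp (-ξ)).comp_neg
      refine this.congr (Filter.Eventually.of_forall fun t => ?_)
      simp only
      congr 2
      push_cast
      ring
    rw [← hw₀ ξ, ← h1, ← integral_add (hexp ξ) h2, ← integral_div]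
    refine integral_congr_ae (Filter.Eventually.of_forall fun t => ?_)
    simp only [w]
    ring
  refine ⟨w, hwc, hint, ?_, ?_, ?_⟩
  · have h := hFw 0
    have hb : b 0 = 1 := b.one_of_mem_closedBall (by simp [b.rIn_pos.le])
    simpa [hf, hb] using h
  · -- the integrand is odd
    have h : ∫ t : ℝ, (t : ℂ) * w t = -∫ t : ℝ, (t : ℂ) * w t := by
      conv_lhs => rw [← integral_neg_eq_self]
      rw [← integral_neg]
      refine integral_congr_ae (Filter.Eventually.of_forall fun t => ?_)
      simp only [w, neg_neg]
      push_cast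
      ring
    linear_combination h / 2
  · intro ω hω
    have hz : ∀ ξ : ℝ, g ≤ |2 * Real.pi * ξ| → f ξ = 0 := by
      intro ξ hξ
      rw [hf, b.zero_of_le_dist, Complex.ofReal_zero]
      rw [dist_zero_right, Real.norm_eq_abs]
      rw [abs_mul, abs_of_pos (by positivity : 0 < 2 * Real.pi)] at hξ
      change g / (2 * Real.pi) ≤ |ξ|
      rw [div_le_iff₀ (by positivity)]
      linarith
    have hω' : |2 * Real.pi * (-ω / (2 * Real.pi))| = |ω| := by
      rw [mul_div_cancel₀ _ (by positivity), abs_neg]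
    have h := hFw (-ω / (2 * Real.pi))
    rw [hz _ (hω'.symm ▸ hω), hz _ (by rw [mul_neg, abs_neg, hω']; exact hω)] at h
    rw [add_zero, zero_div] at h
    rw [← h]
    refine integral_congr_ae (Filter.Eventually.of_forall fun t => ?_)
    simp only
    congr 2
    push_cast
    field_simp

theorem norm_le_sq_mul_of_second_deriv {G G₁ h : ℝ → ℂ} (hG : ∀ t, HasDerivAt G (G₁ t) t)
    (hG₁ : ∀ t, HasDerivAt G₁ (h t) t) (h0 : G 0 = 0) (h1 : G₁ 0 = 0) {B : ℝ → ℝ}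
    (hB : ∀ s t, |s| ≤ |t| → ‖h s‖ ≤ B t) (t : ℝ) : ‖G t‖ ≤ t ^ 2 * B t := by
  have habs : ∀ s t : ℝ, s ∈ Set.uIcc 0 t → |s| ≤ |t| := by
    intro s t hs
    simpa using Set.abs_sub_left_of_mem_uIcc hs
  have key : ∀ s, |s| ≤ |t| → ‖G₁ s‖ ≤ |t| * B t := by
    intro s hst
    have := (convex_uIcc (0 : ℝ) s).norm_image_sub_le_of_norm_hasDerivWithin_le
      (f := G₁) (f' := h) (C := B t) (fun x _ => (hG₁ x).hasDerivWithinAt)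
      (fun x hx => hB x t ((habs x s hx).trans hst)) Set.left_mem_uIcc Set.right_mem_uIcc
    rw [h1, sub_zero, sub_zero, Real.norm_eq_abs] at this
    have h0B : 0 ≤ B t := (norm_nonneg _).trans (hB t t le_rfl)
    calc _ ≤ _ := this
      _ ≤ B t * |t| := by gcongr
      _ = _ := mul_comm _ _
  have := (convex_uIcc (0 : ℝ) t).norm_image_sub_le_of_norm_hasDerivWithin_le
      (f := G) (f' := G₁) (C := |t| * B t) (fun x _ => (hG x).hasDerivWithinAt)
      (fun x hx => key x (habs x t hx)) Set.left_mem_uIcc Set.right_mem_uIcc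
  rw [h0, sub_zero, sub_zero, Real.norm_eq_abs] at this
  calc _ ≤ _ := this
    _ = |t| ^ 2 * B t := by ring
    _ = _ := by rw [sq_abs]

open MeasureTheory Complex in
/-- If a trigonometric sum `h` with frequencies `|ω_b| ≥ g` grows at most polynomially, with
prefactor `B`, then its second antiderivative at "time infinity", `∑ (p_b - q_b) / ω_b²`, is
bounded by a multiple of `B` which only depends on `g` and on the power. -/
theorem exists_norm_sum_div_sq_le {g : ℝ} (hg : 0 < g) (N : ℕ) :
    ∃ C : ℝ, 0 ≤ C ∧ ∀ (ι : Type) (s : Finset ι) (p q : ι → ℂ) (ω : ι → ℝ) (B : ℝ),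
      (∀ b ∈ s, g ≤ |ω b|) →
      (∀ t : ℝ, ‖∑ b ∈ s, (p b * cexp (-(I * ω b * t)) - q b * cexp (I * ω b * t))‖ ≤
        B * (1 + |t|) ^ N) →
      ‖∑ b ∈ s, (p b - q b) / (ω b : ℂ) ^ 2‖ ≤ C * B := by
  obtain ⟨w, hwc, hint, h1, h2, h3⟩ := exists_spectral_filter hg
  refine ⟨∫ t, (1 + |t|) ^ (N + 2) * ‖w t‖,
    integral_nonneg fun t => by positivity, ?_⟩
  intro ι s p q ω B hω hB
  have hω0 : ∀ b ∈ s, (ω b : ℂ) ≠ 0 := by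
    intro b hb h
    have h5 := hω b hb
    rw [Complex.ofReal_eq_zero] at h
    rw [h, abs_zero] at h5
    linarith
  have hB0 : 0 ≤ B := by simpa using (norm_nonneg _).trans (hB 0)
  -- `u b / ω_b²` is the second antiderivative of the `b`-th term of the sum that vanishes to second
  -- order at `0`; `u₁ b` and `u₂ b` are the derivatives of `u b`.
  let u : ι → ℝ → ℂ := fun b t => p b * (1 - I * ω b * t - cexp (-(I * ω b * t))) -
    q b * (1 + I * ω b * t - cexp (I * ω b * t))
  let u₁ : ι → ℝ → ℂ := fun b t =>
    p b * (0 - I * ω b * 1 - cexp (-(I * ω b * t)) * (-(I * ω b * 1))) -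
    q b * (0 + I * ω b * 1 - cexp (I * ω b * t) * (I * ω b * 1))
  let u₂ : ι → ℝ → ℂ := fun b t =>
    p b * (0 - cexp (-(I * ω b * t)) * (-(I * ω b * 1)) * (-(I * ω b * 1))) -
    q b * (0 - cexp (I * ω b * t) * (I * ω b * 1) * (I * ω b * 1))
  have hid : ∀ t : ℝ, HasDerivAt (fun t : ℝ => (t : ℂ)) 1 t := fun t =>
    Complex.ofRealCLM.hasDerivAt
  have hlin : ∀ b (t : ℝ), HasDerivAt (fun t : ℝ => I * ω b * (t : ℂ)) (I * ω b * 1) t :=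
    fun b t => (hid t).const_mul _
  have hu : ∀ b t, HasDerivAt (u b) (u₁ b t) t := by
    intro b t
    have hc := hasDerivAt_const t (1 : ℂ)
    exact (((hc.sub (hlin b t)).sub (hlin b t).neg.cexp).const_mul (p b)).sub
      (((hc.add (hlin b t)).sub (hlin b t).cexp).const_mul (q b))
  have hu₁ : ∀ b t, HasDerivAt (u₁ b) (u₂ b t) t := by
    intro b t
    have hc := hasDerivAt_const t ((0 : ℂ) - I * ω b * 1)
    have hc' := hasDerivAt_const t ((0 : ℂ) + I * ω b * 1)
    exact (((hc.sub ((hlin b t).neg.cexp.mul_const _))).const_mul (p b)).sub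
      (((hc'.sub ((hlin b t).cexp.mul_const _))).const_mul (q b))
  let G : ℝ → ℂ := fun t => ∑ b ∈ s, u b t / (ω b : ℂ) ^ 2
  have hGb : ∀ t, ‖G t‖ ≤ t ^ 2 * (B * (1 + |t|) ^ N) := by
    refine norm_le_sq_mul_of_second_deriv (G := G)
      (G₁ := fun t => ∑ b ∈ s, u₁ b t / (ω b : ℂ) ^ 2)
      (h := fun t => ∑ b ∈ s, u₂ b t / (ω b : ℂ) ^ 2)
      (fun t => HasDerivAt.fun_sum fun b _ => (hu b t).div_const _)
      (fun t => HasDerivAt.fun_sum fun b _ => (hu₁ b t).div_const _)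
      (Finset.sum_eq_zero fun b _ => by simp [u])
      (Finset.sum_eq_zero fun b _ => by simp [u₁])
      (B := fun t => B * (1 + |t|) ^ N) ?_
    intro x t hxt
    have : ∑ b ∈ s, u₂ b x / (ω b : ℂ) ^ 2 =
        ∑ b ∈ s, (p b * cexp (-(I * ω b * x)) - q b * cexp (I * ω b * x)) := by
      refine Finset.sum_congr rfl fun b hb => ?_
      have := hω0 b hb
      rw [div_eq_iff (pow_ne_zero 2 this)]
      simp only [u₂]
      ring_nf
      rw [Complex.I_sq]
      ring
    simp only [this]
    refine (hB x).trans ?_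
    gcongr
  have hwint : Integrable w := by
    have := hint 0
    simp only [pow_zero, one_mul] at this
    exact (integrable_norm_iff hwc.aestronglyMeasurable).1 this
  have htw : Integrable (fun t : ℝ => (t : ℂ) * w t) := by
    refine (hint 1).mono' (by fun_prop) (Filter.Eventually.of_forall fun t => ?_)
    rw [norm_mul, Complex.norm_real, Real.norm_eq_abs, pow_one]
    gcongr
    linarith
  have hew : ∀ a : ℝ, Integrable (fun t : ℝ => w t * cexp (I * a * t)) := by
    intro a
    refine hwint.norm.mono' (by fun_prop) (Filter.Eventually.of_forall fun t => ?_)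
    rw [norm_mul, Complex.norm_exp]
    simp
  -- The filter removes the linear and the oscillating part of `u b` and keeps the constant part.
  have hwu : ∀ b ∈ s, Integrable (fun t => w t * (u b t / (ω b : ℂ) ^ 2)) ∧
      ∫ t, w t * (u b t / (ω b : ℂ) ^ 2) = (p b - q b) / (ω b : ℂ) ^ 2 := by
    intro b hb
    have e : ∀ t : ℝ, w t * (u b t / (ω b : ℂ) ^ 2) =
        ((p b - q b) / (ω b : ℂ) ^ 2) * w t +
        (-(p b + q b) * I * ω b / (ω b : ℂ) ^ 2) * ((t : ℂ) * w t) +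
        (-p b / (ω b : ℂ) ^ 2) * (w t * cexp (I * ((-ω b : ℝ) : ℂ) * t)) +
        (q b / (ω b : ℂ) ^ 2) * (w t * cexp (I * ω b * t)) := by
      intro t
      simp only [u]
      rw [show I * ((-ω b : ℝ) : ℂ) * (t : ℂ) = -(I * ω b * t) by push_cast; ring]
      ring
    simp only [e]
    have i1 := hwint.const_mul ((p b - q b) / (ω b : ℂ) ^ 2)
    have i2 := htw.const_mul (-(p b + q b) * I * ω b / (ω b : ℂ) ^ 2)
    have i3 := (hew (-ω b)).const_mul (-p b / (ω b : ℂ) ^ 2)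
    have i4 := (hew (ω b)).const_mul (q b / (ω b : ℂ) ^ 2)
    refine ⟨((i1.add i2).add i3).add i4, ?_⟩
    rw [integral_add ((i1.fun_add i2).fun_add i3) i4, integral_add (i1.fun_add i2) i3,
      integral_add i1 i2,
      integral_const_mul, integral_const_mul, integral_const_mul, integral_const_mul, h1, h2,
      h3 _ (hω b hb), h3 (-ω b) (by rw [abs_neg]; exact hω b hb)]
    ring
  have hGw : ∫ t, w t * G t = ∑ b ∈ s, (p b - q b) / (ω b : ℂ) ^ 2 := by
    simp only [G, Finset.mul_sum]
    rw [integral_finsetSum _ (fun b hb => (hwu b hb).1)]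
    exact Finset.sum_congr rfl fun b hb => (hwu b hb).2
  rw [← hGw, ← integral_mul_const]
  refine norm_integral_le_of_norm_le ((hint (N + 2)).mul_const B)
    (Filter.Eventually.of_forall fun t => ?_)
  rw [norm_mul]
  have ht : t ^ 2 ≤ (1 + |t|) ^ 2 := by
    rw [← sq_abs]
    gcongr
    linarith
  calc ‖w t‖ * ‖G t‖ ≤ ‖w t‖ * (t ^ 2 * (B * (1 + |t|) ^ N)) := by gcongr; exact hGb t
    _ ≤ ‖w t‖ * ((1 + |t|) ^ 2 * (B * (1 + |t|) ^ N)) := by gcongr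
    _ = _ := by ring

/-! ### Diagonalisation and the ground state projection -/

variable {L n : ℕ} [NeZero L]

/-- An orthonormal eigenbasis of `H`: the columns of the unitary `U` are eigenvectors with
eigenvalues `e`, the lowest of which is `e o`. -/
structure EigenFrame (H : Op L n) where
  U : Op L n
  e : Finset (Mode L n) → ℝ
  o : Finset (Mode L n)
  U_mul_star : U * star U = 1
  star_mul_U : star U * U = 1
  diag : H = U * Matrix.diagonal (fun b => (e b : ℂ)) * star U
  le : ∀ b, e o ≤ e b
  ground : groundEnergy H = e o
  proj : groundProj H =
    U * Matrix.diagonal (fun b => if e b = e o then (1 : ℂ) else 0) * star U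

theorem nonempty_eigenFrame {H : Op L n} (hH : H.IsHermitian) : Nonempty (EigenFrame H) := by
  have hU := hH.eigenvectorUnitary.2
  have hspec := hH.spectrum_real_eq_range_eigenvalues
  obtain ⟨o, ho⟩ := Finite.exists_min hH.eigenvalues
  have hg : groundEnergy H = hH.eigenvalues o := by
    rw [groundEnergy, hspec]
    exact IsLeast.csInf_eq ⟨⟨o, rfl⟩, by rintro _ ⟨b, rfl⟩; exact ho b⟩
  refine ⟨⟨hH.eigenvectorUnitary, hH.eigenvalues, o, Matrix.mem_unitaryGroup_iff.1 hU,
    Matrix.mem_unitaryGroup_iff'.1 hU, ?_, ho, hg, ?_⟩⟩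
  · conv_lhs => rw [hH.spectral_theorem]
    rfl
  · rw [groundProj, hH.cfc_eq, Matrix.IsHermitian.cfc, Unitary.conjStarAlgAut_apply]
    congr 3
    ext b
    simp only [Function.comp_apply, hg]
    split_ifs <;> simp

theorem norm_entry_le {ι : Type*} [Fintype ι] [DecidableEq ι] (M : Matrix ι ι ℂ) (i j : ι) :
    ‖M i j‖ ≤ ‖M‖ := by
  have h := Matrix.l2_opNorm_mulVec M (EuclideanSpace.single j (1 : ℂ))
  rw [PiLp.norm_single, norm_one, mul_one] at h
  refine le_trans (le_trans (le_of_eq ?_) (PiLp.norm_apply_le _ i)) h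
  simp

namespace EigenFrame

variable {H : Op L n} (F : EigenFrame H)

/-- The matrix of `A` in the eigenbasis. -/
def coord (A : Op L n) : Op L n := star F.U * A * F.U

theorem coord_mul (A B : Op L n) : F.coord (A * B) = F.coord A * F.coord B := by
  simp only [coord]
  calc star F.U * (A * B) * F.U = star F.U * A * 1 * B * F.U := by noncomm_ring
    _ = _ := by rw [← F.U_mul_star]; noncomm_ring

theorem coord_sub (A B : Op L n) : F.coord (A - B) = F.coord A - F.coord B := by
  simp only [coord]; noncomm_ring

theorem coord_conj (D : Op L n) : F.coord (F.U * D * star F.U) = D := by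
  simp only [coord]
  calc star F.U * (F.U * D * star F.U) * F.U = (star F.U * F.U) * D * (star F.U * F.U) := by
        noncomm_ring
    _ = D := by rw [F.star_mul_U]; noncomm_ring

theorem conj_coord (A : Op L n) : F.U * F.coord A * star F.U = A := by
  simp only [coord]
  calc F.U * (star F.U * A * F.U) * star F.U = (F.U * star F.U) * A * (F.U * star F.U) := by
        noncomm_ring
    _ = A := by rw [F.U_mul_star]; noncomm_ring

theorem star_coord (A : Op L n) : star (F.coord A) = F.coord (star A) := by
  simp only [coord, star_mul, star_star, mul_assoc]

theorem trace_coord (A : Op L n) : Matrix.trace (F.coord A) = Matrix.trace A := by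
  rw [coord, Matrix.trace_mul_cycle, F.U_mul_star, one_mul]

theorem norm_U_le : ‖F.U‖ ≤ 1 := by
  have h := CStarRing.norm_star_mul_self (x := F.U)
  rw [F.star_mul_U] at h
  have h1 : ‖(1 : Op L n)‖ ≤ 1 := by
    rw [← Matrix.diagonal_one, Matrix.l2_opNorm_diagonal]
    exact (pi_norm_le_iff_of_nonneg zero_le_one).2 fun i => by simp
  nlinarith [norm_nonneg F.U]

theorem norm_coord_le (A : Op L n) : ‖F.coord A‖ ≤ ‖A‖ := by
  have h1 := F.norm_U_le
  calc ‖F.coord A‖ ≤ ‖star F.U‖ * ‖A‖ * ‖F.U‖ :=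
        (norm_mul_le _ _).trans (by gcongr; exact norm_mul_le _ _)
    _ ≤ 1 * ‖A‖ * 1 := by rw [norm_star]; gcongr
    _ = ‖A‖ := by ring

theorem coord_H : F.coord H = Matrix.diagonal (fun b => (F.e b : ℂ)) := by
  exact (congrArg F.coord F.diag).trans (F.coord_conj _)

theorem coord_proj :
    F.coord (groundProj H) = Matrix.diagonal (fun b => if F.e b = F.e F.o then (1 : ℂ) else 0) := by
  rw [F.proj]
  exact F.coord_conj _

theorem coord_injective {A B : Op L n} (h : F.coord A = F.coord B) : A = B := by
  rw [← F.conj_coord A, h, F.conj_coord]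

/-- The variational principle, tested on the ground state of `H`. -/
theorem groundEnergy_le (F : EigenFrame H) {K : Op L n} (G : EigenFrame K) :
    groundEnergy K ≤ groundEnergy H + ‖K - H‖ := by
  set W : Op L n := star F.U * G.U with hW
  have hWW : W * star W = 1 := by
    rw [hW, star_mul, star_star]
    calc star F.U * G.U * (star G.U * F.U) = star F.U * (G.U * star G.U) * F.U := by noncomm_ring
      _ = 1 := by rw [G.U_mul_star, mul_one, F.star_mul_U]
  have hK : F.coord K = W * Matrix.diagonal (fun b => (G.e b : ℂ)) * star W := by
    refine (congrArg F.coord G.diag).trans ?_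
    rw [coord, hW, star_mul, star_star]
    noncomm_ring
  have h1 : (F.coord K F.o F.o).re = ∑ b, Complex.normSq (W F.o b) * G.e b := by
    rw [hK, Matrix.mul_apply, Complex.re_sum]
    refine Finset.sum_congr rfl fun b _ => ?_
    rw [Matrix.mul_diagonal, Matrix.star_apply, mul_right_comm, Complex.star_def, Complex.mul_conj]
    rw [← Complex.ofReal_mul, Complex.ofReal_re]
  have h2 : ∑ b, Complex.normSq (W F.o b) = 1 := by
    have := congrArg (fun M : Op L n => (M F.o F.o).re) hWW
    simp only [Matrix.mul_apply, Complex.re_sum, Matrix.one_apply_eq, Complex.one_re] at this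
    rw [← this]
    refine Finset.sum_congr rfl fun b _ => ?_
    rw [Matrix.star_apply, Complex.star_def, Complex.mul_conj, Complex.ofReal_re]
  have h3 : groundEnergy K ≤ (F.coord K F.o F.o).re := by
    rw [h1, G.ground]
    calc G.e G.o = ∑ b, Complex.normSq (W F.o b) * G.e G.o := by
          rw [← Finset.sum_mul, h2, one_mul]
      _ ≤ _ := Finset.sum_le_sum fun b _ =>
          mul_le_mul_of_nonneg_left (G.le b) (Complex.normSq_nonneg _)
  have h4 : (F.coord K F.o F.o).re = groundEnergy H + (F.coord (K - H) F.o F.o).re := by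
    rw [F.coord_sub, Matrix.sub_apply, F.coord_H, Matrix.diagonal_apply_eq, Complex.sub_re,
      Complex.ofReal_re, F.ground]
    ring
  rw [h4] at h3
  refine h3.trans ?_
  gcongr
  exact ((Complex.re_le_norm _).trans (norm_entry_le _ _ _)).trans (F.norm_coord_le _)

theorem proj_mul_self (F : EigenFrame H) : groundProj H * groundProj H = groundProj H := by
  apply F.coord_injective
  rw [F.coord_mul, F.coord_proj, Matrix.diagonal_mul_diagonal]
  congr 1
  ext b
  split_ifs <;> simp

theorem star_proj (F : EigenFrame H) : star (groundProj H) = groundProj H := by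
  apply F.coord_injective
  rw [← F.star_coord, F.coord_proj, Matrix.star_eq_conjTranspose, Matrix.diagonal_conjTranspose]
  congr 1
  ext b
  simp only [Pi.star_apply]
  split_ifs <;> simp

theorem H_mul_proj (F : EigenFrame H) : H * groundProj H = (groundEnergy H : ℂ) • groundProj H := by
  apply F.coord_injective
  have : F.coord ((groundEnergy H : ℂ) • groundProj H) =
      (groundEnergy H : ℂ) • F.coord (groundProj H) := by
    simp [coord]
  rw [this, F.coord_mul, F.coord_proj, F.coord_H, Matrix.diagonal_mul_diagonal, F.ground,
    ← Matrix.diagonal_smul]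
  congr 1
  ext b
  simp only [Pi.smul_apply, smul_eq_mul]
  split_ifs with h <;> simp [h]

theorem proj_ne_zero (F : EigenFrame H) : groundProj H ≠ 0 := by
  intro h
  have h1 := F.coord_proj
  rw [h] at h1
  have := congrFun (congrFun h1 F.o) F.o
  simp [coord] at this

theorem norm_proj (F : EigenFrame H) : ‖groundProj H‖ = 1 := by
  have h := CStarRing.norm_star_mul_self (x := groundProj H)
  rw [F.star_proj, F.proj_mul_self] at h
  have h1 : ‖groundProj H‖ ≠ 0 := norm_ne_zero_iff.2 F.proj_ne_zero
  exact mul_right_cancel₀ h1 (by rw [one_mul]; exact h.symm)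

theorem isHermitian (F : EigenFrame H) : H.IsHermitian := by
  change star H = H
  apply F.coord_injective
  rw [← F.star_coord, F.coord_H, Matrix.star_eq_conjTranspose, Matrix.diagonal_conjTranspose]
  congr 1
  ext b
  simp

/-- A gap leaves a single basis vector with the lowest eigenvalue. -/
theorem gap_le {g : ℝ} (hg : HasGap H g) {b : Finset (Mode L n)} (hb : b ≠ F.o) :
    F.e F.o + g ≤ F.e b := by
  have hmem : ∀ b, F.e b ∈ spectrum ℝ H := by
    intro b
    rw [← spectrum.algebraMap_mem_iff ℂ, spectrum.mem_iff]
    intro hu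
    have hu' : IsUnit (F.coord (algebraMap ℂ (Op L n) (algebraMap ℝ ℂ (F.e b)) - H)) := by
      have hU : IsUnit F.U := ⟨⟨F.U, star F.U, F.U_mul_star, F.star_mul_U⟩, rfl⟩
      exact (hU.star.mul hu).mul hU
    rw [F.coord_sub, F.coord_H] at hu'
    have h1 : F.coord (algebraMap ℂ (Op L n) (algebraMap ℝ ℂ (F.e b))) =
        Matrix.diagonal (fun _ => (F.e b : ℂ)) := by
      rw [Algebra.algebraMap_eq_smul_one, coord]
      simp only [Algebra.mul_smul_comm, Algebra.smul_mul_assoc, mul_one, F.star_mul_U]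
      rw [← Matrix.diagonal_one, ← Matrix.diagonal_smul]
      congr 1
      ext
      simp
    rw [h1, Matrix.diagonal_sub, Matrix.isUnit_iff_isUnit_det, Matrix.det_diagonal] at hu'
    rw [Finset.prod_eq_zero (Finset.mem_univ b) (sub_self _)] at hu'
    exact not_isUnit_zero hu'
  refine (F.ground ▸ hg.2 (F.e b) (hmem b)) fun heq => hb ?_
  -- Two independent eigenvectors cannot lie on one line.
  let ψ : Finset (Mode L n) → (Finset (Mode L n) → ℂ) := fun c => F.U.mulVec (Pi.single c 1)
  have hψ : ∀ c, F.e c = F.e F.o → ψ c ∈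
      Module.End.eigenspace (Matrix.toLin' H) (groundEnergy H : ℂ) := by
    intro c hc
    rw [Module.End.mem_eigenspace_iff, Matrix.toLin'_apply, F.ground]
    simp only [ψ]
    rw [show H.mulVec (F.U.mulVec (Pi.single c 1)) =
      (F.U * Matrix.diagonal (fun b => (F.e b : ℂ)) * star F.U).mulVec (F.U.mulVec (Pi.single c 1))
      from congrArg (fun M : Op L n => M.mulVec (F.U.mulVec (Pi.single c 1))) F.diag]
    rw [Matrix.mulVec_mulVec, mul_assoc, F.star_mul_U, mul_one, ← Matrix.mulVec_mulVec,
      Matrix.diagonal_mulVec_single, mul_one, ← hc]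
    rw [← Matrix.mulVec_smul, ← Pi.single_smul]
    simp
  obtain ⟨v, hv, hline⟩ := finrank_eq_one_iff'.1 hg.1
  have hinv : ∀ x y : Finset (Mode L n) → ℂ, F.U.mulVec x = F.U.mulVec y → x = y := by
    intro x y hxy
    have := congrArg (star F.U).mulVec hxy
    simpa [Matrix.mulVec_mulVec, F.star_mul_U] using this
  obtain ⟨c, hc⟩ := hline ⟨ψ b, hψ b heq⟩
  obtain ⟨c', hc'⟩ := hline ⟨ψ F.o, hψ F.o rfl⟩
  have hc := congrArg Subtype.val hc
  have hc' := congrArg Subtype.val hc'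
  simp only [SetLike.val_smul] at hc hc'
  have h3 : F.U.mulVec (c' • Pi.single b 1) = F.U.mulVec (c • Pi.single F.o 1) := by
    rw [Matrix.mulVec_smul, Matrix.mulVec_smul]
    change c' • ψ b = c • ψ F.o
    rw [← hc, ← hc', smul_smul, smul_smul, mul_comm]
  have h4 := hinv _ _ h3
  by_contra hne
  have h5 := congrFun h4 b
  simp only [Pi.smul_apply, Pi.single_eq_same, smul_eq_mul, mul_one,
    Pi.single_eq_of_ne hne, mul_zero] at h5
  rw [h5, zero_smul] at hc'
  have h6 := hinv (Pi.single F.o 1) 0 (by rw [Matrix.mulVec_zero]; exact hc'.symm)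
  have := congrFun h6 F.o
  simp at this

end EigenFrame

namespace EigenFrame

variable {H : Op L n} (F : EigenFrame H)

/-! ### The reduced resolvent and first-order perturbation theory -/

/-- The reduced resolvent `(1 - P) (H - E₀)⁻¹ (1 - P)`. The convention `0⁻¹ = 0` takes care of the
eigenvectors of the lowest eigenvalue `E₀`. -/
def res : Op L n := F.U * Matrix.diagonal (fun b => ((F.e b - F.e F.o : ℝ) : ℂ)⁻¹) * star F.U

theorem coord_res :
    F.coord F.res = Matrix.diagonal (fun b => ((F.e b - F.e F.o : ℝ) : ℂ)⁻¹) :=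
  F.coord_conj _

theorem coord_add (A B : Op L n) : F.coord (A + B) = F.coord A + F.coord B := by
  simp only [coord]; noncomm_ring

theorem coord_smul (c : ℂ) (A : Op L n) : F.coord (c • A) = c • F.coord A := by
  simp [coord]

theorem coord_one : F.coord 1 = 1 := by
  rw [coord, mul_one, F.star_mul_U]

theorem res_mul_proj : F.res * groundProj H = 0 := by
  apply F.coord_injective
  rw [F.coord_mul, F.coord_res, F.coord_proj, Matrix.diagonal_mul_diagonal,
    show F.coord (0 : Op L n) = 0 by simp [coord], ← Matrix.diagonal_zero]
  congr 1
  ext b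
  split_ifs with h <;> simp [h]

theorem star_res : star F.res = F.res := by
  apply F.coord_injective
  rw [← F.star_coord, F.coord_res, Matrix.star_eq_conjTranspose, Matrix.diagonal_conjTranspose]
  congr 1
  ext b
  simp

theorem proj_mul_res : groundProj H * F.res = 0 := by
  have := congrArg star F.res_mul_proj
  rwa [star_mul, F.star_proj, F.star_res, star_zero] at this

theorem res_mul_H : F.res * H = (groundEnergy H : ℂ) • F.res + 1 - groundProj H := by
  apply F.coord_injective
  rw [F.coord_mul, F.coord_sub, F.coord_add, F.coord_smul, F.coord_one, F.coord_res, F.coord_proj,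
    F.coord_H, Matrix.diagonal_mul_diagonal, F.ground, ← Matrix.diagonal_smul,
    ← Matrix.diagonal_one, Matrix.diagonal_add, Matrix.diagonal_sub]
  congr 1
  ext b
  simp only [Pi.smul_apply, smul_eq_mul]
  split_ifs with h
  · simp [h]
  · have : ((F.e b - F.e F.o : ℝ) : ℂ) ≠ 0 := Complex.ofReal_ne_zero.2 (sub_ne_zero.2 h)
    field_simp
    push_cast
    ring

theorem H_mul_res : H * F.res = (groundEnergy H : ℂ) • F.res + 1 - groundProj H := by
  have := congrArg star F.res_mul_H
  have hH : star H = H := F.isHermitian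
  rwa [star_mul, star_sub, star_add, star_smul, F.star_proj, F.star_res, star_one, hH,
    Complex.star_def, Complex.conj_ofReal] at this

theorem coord_proj_eq_single {g : ℝ} (hg0 : 0 < g) (hg : HasGap H g) :
    F.coord (groundProj H) = Matrix.single F.o F.o 1 := by
  rw [F.coord_proj, ← Matrix.diagonal_single]
  congr 1
  ext b
  by_cases hb : b = F.o
  · simp [hb]
  · have := F.gap_le hg hb
    rw [if_neg (by linarith : ¬ F.e b = F.e F.o), Pi.single_eq_of_ne hb]

theorem groundExp_eq_coord {g : ℝ} (hg0 : 0 < g) (hg : HasGap H g) (A : Op L n) :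
    groundExp H A = F.coord A F.o F.o := by
  rw [groundExp, ← F.trace_coord, F.coord_mul, F.coord_proj_eq_single hg0 hg,
    Matrix.trace_single_mul, one_smul]

theorem norm_groundExp_le (F : EigenFrame H) {g : ℝ} (hg0 : 0 < g) (hg : HasGap H g) (A : Op L n) :
    ‖groundExp H A‖ ≤ ‖A‖ := by
  rw [F.groundExp_eq_coord hg0 hg]
  exact (norm_entry_le _ _ _).trans (F.norm_coord_le _)

theorem proj_mul_mul_proj (F : EigenFrame H) {g : ℝ} (hg0 : 0 < g) (hg : HasGap H g)
    (A : Op L n) : groundProj H * A * groundProj H = groundExp H A • groundProj H := by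
  apply F.coord_injective
  rw [F.coord_mul, F.coord_mul, F.coord_smul, F.coord_proj_eq_single hg0 hg,
    F.groundExp_eq_coord hg0 hg, Matrix.single_mul_mul_single]
  simp

open Asymptotics Topology in
/-- First-order perturbation theory for a non-degenerate gapped ground state. Let `p` and `E` be the
perturbed projection and ground state energy, and `X = K φ - K 0`. The reduced resolvent gives
`(1 - P) p = (E - E₀) S p - S X p`, which is `O(φ)`, and in second iteration `-S X P + O(φ²)`; since
`p` is idempotent, its remaining part `P p P` differs from `P` only by `O(φ²)`. -/
theorem hasDerivAt_groundProj {K : ℝ → Op L n} {D : Op L n} (hK : ∀ φ, (K φ).IsHermitian)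
    (F : EigenFrame (K 0)) {g : ℝ} (hg0 : 0 < g) (hg : HasGap (K 0) g) (hD : HasDerivAt K D 0) :
    HasDerivAt (fun φ => groundProj (K φ))
      (-(F.res * D * groundProj (K 0) + groundProj (K 0) * D * F.res)) 0 := by
  have fr : ∀ φ, EigenFrame (K φ) := fun φ => (nonempty_eigenFrame (hK φ)).some
  set P := groundProj (K 0) with hP
  set S := F.res
  set p : ℝ → Op L n := fun φ => groundProj (K φ) with hp
  set X : ℝ → Op L n := fun φ => K φ - K 0 with hX
  set q : ℝ → Op L n := fun φ => (1 - P) * p φ with hq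
  set q' : ℝ → Op L n := fun φ => p φ * (1 - P) with hq'
  set μ : ℝ → ℂ := fun φ => ((groundEnergy (K φ) - groundEnergy (K 0) : ℝ) : ℂ) with hμ
  have hPP : P * P = P := F.proj_mul_self
  have hsP : star P = P := F.star_proj
  have hsS : star S = S := F.star_res
  have hpp : ∀ φ, p φ * p φ = p φ := fun φ => (fr φ).proj_mul_self
  have hsp : ∀ φ, star (p φ) = p φ := fun φ => (fr φ).star_proj
  have hsX : ∀ φ, star (X φ) = X φ := fun φ => ((hK φ).sub (hK 0))
  have hp1 : ∀ φ, ‖p φ‖ = 1 := fun φ => (fr φ).norm_proj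
  have hpO : p =O[𝓝 0] fun _ => (1 : ℝ) :=
    IsBigO.of_bound 1 (Filter.Eventually.of_forall fun φ => by rw [hp1]; simp)
  have hXo : (fun φ => X φ - φ • D) =o[𝓝 0] fun φ : ℝ => φ := by
    simpa [hX] using hasDerivAt_iff_isLittleO_nhds_zero.1 hD
  have hXO : X =O[𝓝 0] fun φ : ℝ => φ := by
    have h1 : (fun φ : ℝ => φ • D) =O[𝓝 0] fun φ : ℝ => φ :=
      IsBigO.of_bound ‖D‖ (Filter.Eventually.of_forall fun φ => by rw [norm_smul, mul_comm])
    simpa using hXo.isBigO.add h1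
  have hμO : μ =O[𝓝 0] fun φ : ℝ => φ := by
    refine IsBigO.trans (IsBigO.of_bound 1 (Filter.Eventually.of_forall fun φ => ?_)) hXO
    have h1 := F.groundEnergy_le (fr φ)
    have h2 := (fr φ).groundEnergy_le F
    rw [norm_sub_rev] at h2
    rw [hμ, one_mul, Complex.norm_real, Real.norm_eq_abs, abs_le]
    simp only [hX]
    constructor <;> linarith
  have hqeq : ∀ φ, q φ = μ φ • (S * p φ) - S * X φ * p φ := by
    intro φ
    have h1 : K φ * p φ = (groundEnergy (K φ) : ℂ) • p φ := (fr φ).H_mul_proj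
    have h2 : S * K 0 = (groundEnergy (K 0) : ℂ) • S + 1 - P := F.res_mul_H
    have h3 : S * X φ * p φ = (groundEnergy (K φ) : ℂ) • (S * p φ) -
        ((groundEnergy (K 0) : ℂ) • S + 1 - P) * p φ := by
      rw [← h2, hX]
      simp only
      rw [mul_sub, sub_mul, mul_assoc S (K φ), h1, Matrix.mul_smul]
    rw [h3, hq, hμ]
    simp only [sub_mul, add_mul, one_mul, smul_mul_assoc, Complex.ofReal_sub, sub_smul]
    abel
  have hSc : ∀ A : Op L n, (fun _ : ℝ => A) =O[𝓝 (0 : ℝ)] fun _ => (1 : ℝ) := fun A =>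
    isBigO_const_const _ one_ne_zero _
  have hqO : q =O[𝓝 0] fun φ : ℝ => φ := by
    have h1 : (fun φ => μ φ • (S * p φ)) =O[𝓝 0] fun φ : ℝ => φ := by
      simpa using hμO.smul ((hSc S).mul hpO)
    have h2 : (fun φ => S * X φ * p φ) =O[𝓝 0] fun φ : ℝ => φ := by
      simpa using ((hSc S).mul hXO).mul hpO
    exact (h1.sub h2).congr_left fun φ => (hqeq φ).symm
  have hqs : ∀ φ, star (q φ) = q' φ := fun φ => by
    simp only [hq, hq', star_mul, star_sub, star_one, hsP, hsp]
  have star_O : ∀ {f : ℝ → Op L n} {h : ℝ → ℝ}, f =O[𝓝 0] h →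
      (fun φ => star (f φ)) =O[𝓝 0] h := fun hf =>
    (hf.norm_left.congr_left fun φ => (norm_star _).symm).of_norm_left
  have hq'O : q' =O[𝓝 0] fun φ : ℝ => φ := (star_O hqO).congr_left hqs
  set c : ℝ → ℂ := fun φ => groundExp (K 0) (p φ) with hc
  have hcP : ∀ φ, P * p φ * P = c φ • P := fun φ => F.proj_mul_mul_proj hg0 hg _
  have hdec : ∀ φ, p φ = c φ • P + (q φ + P * q' φ) := by
    intro φ
    rw [← hcP]
    simp only [hq, hq']
    noncomm_ring
  -- `P p (1 - P) p P` is both `c (1 - c) P` and of second order.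
  have hc2 : ∀ φ, (c φ * (c φ - 1)) • P = -(P * (q' φ * q φ) * P) := by
    intro φ
    have h1 : (c φ • P) * (c φ • P) = (c φ * c φ) • P := by
      rw [smul_mul_smul_comm, hPP]
    have h2 : q' φ * q φ = p φ - p φ * P * p φ := by
      simp only [hq, hq']
      calc p φ * (1 - P) * ((1 - P) * p φ) =
          p φ * p φ - p φ * P * p φ - p φ * P * p φ + p φ * (P * P) * p φ := by noncomm_ring
        _ = _ := by rw [hPP, hpp]; abel
    rw [mul_sub, mul_one, sub_smul, ← h1, ← hcP, h2]
    calc P * p φ * P * (P * p φ * P) - P * p φ * P =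
        P * p φ * (P * P) * p φ * P - P * p φ * P := by noncomm_ring
      _ = _ := by rw [hPP]; noncomm_ring
  have hsq : (fun φ : ℝ => φ * φ) =o[𝓝 0] fun φ : ℝ => φ := by
    have h1 : (fun φ : ℝ => φ) =o[𝓝 0] fun _ : ℝ => (1 : ℝ) :=
      (isLittleO_one_iff ℝ).2 Filter.tendsto_id
    simpa using (isBigO_refl (fun φ : ℝ => φ) (𝓝 0)).mul_isLittleO h1
  have hRO : (fun φ => q φ + P * q' φ) =O[𝓝 0] fun φ : ℝ => φ := by
    refine hqO.add ?_
    simpa using (hSc P).mul hq'O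
  have hPn : ‖P‖ = 1 := F.norm_proj
  -- Of the two roots of `c (c - 1) = 0`, continuity selects `c = 1`.
  have hchalf : ∀ᶠ φ in 𝓝 (0 : ℝ), 1 / 2 ≤ ‖c φ‖ := by
    have h1 : Filter.Tendsto (fun φ => q φ + P * q' φ) (𝓝 0) (𝓝 0) :=
      hRO.trans_tendsto Filter.tendsto_id
    have h2 := (tendsto_zero_iff_norm_tendsto_zero.1 h1).eventually
      (gt_mem_nhds (by norm_num : (0 : ℝ) < 1 / 2))
    filter_upwards [h2] with φ hφ
    have h3 := hp1 φ
    rw [hdec φ] at h3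
    have h4 := norm_add_le (c φ • P) (q φ + P * q' φ)
    rw [norm_smul, hPn, mul_one] at h4
    linarith
  have hcO : (fun φ => c φ - 1) =O[𝓝 0] fun φ : ℝ => φ * φ := by
    have h1 : (fun φ => (c φ * (c φ - 1)) • P) =O[𝓝 0] fun φ : ℝ => φ * φ := by
      have := (((hSc P).mul (hq'O.mul hqO)).mul (hSc P)).neg_left
      simp only [one_mul, mul_one] at this
      exact this.congr_left fun φ => (hc2 φ).symm
    refine IsBigO.trans (IsBigO.of_bound 2 ?_) h1
    filter_upwards [hchalf] with φ hφ
    rw [norm_smul, hPn, mul_one, norm_mul]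
    nlinarith [norm_nonneg (c φ - 1)]
  have hpP : (fun φ => p φ - P) =O[𝓝 0] fun φ : ℝ => φ := by
    have h1 : (fun φ => (c φ - 1) • P) =O[𝓝 0] fun φ : ℝ => φ := by
      simpa using (hcO.trans hsq.isBigO).smul (hSc P)
    refine (h1.add hRO).congr_left fun φ => ?_
    conv_rhs => rw [hdec φ]
    rw [sub_smul, one_smul]
    abel
  have hSP : S * P = 0 := F.res_mul_proj
  have hsec : (fun φ => q φ + S * X φ * P) =O[𝓝 0] fun φ : ℝ => φ * φ := by
    have h1 : (fun φ => μ φ • (S * q φ)) =O[𝓝 0] fun φ : ℝ => φ * φ := by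
      simpa using hμO.smul ((hSc S).mul hqO)
    have h2 : (fun φ => S * X φ * (p φ - P)) =O[𝓝 0] fun φ : ℝ => φ * φ := by
      simpa using ((hSc S).mul hXO).mul hpP
    refine (h1.sub h2).congr_left fun φ => ?_
    conv_rhs => rw [hqeq φ]
    have h3 : S * q φ = S * p φ := by
      simp only [hq]
      rw [← mul_assoc, mul_sub, hSP, mul_one, sub_zero]
    rw [h3]
    noncomm_ring
  have hsec' : (fun φ => q' φ + P * X φ * S) =O[𝓝 0] fun φ : ℝ => φ * φ := by
    refine (star_O hsec).congr_left fun φ => ?_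
    rw [star_add, hqs, star_mul, star_mul, hsP, hsS, hsX, mul_assoc]
  have hmain : (fun φ => p φ - P + (S * X φ * P + P * X φ * S)) =O[𝓝 0] fun φ : ℝ => φ * φ := by
    have h1 : (fun φ => (c φ - 1) • P) =O[𝓝 0] fun φ : ℝ => φ * φ := by
      simpa using hcO.smul (hSc P)
    have h2 : (fun φ => P * (q' φ + P * X φ * S)) =O[𝓝 0] fun φ : ℝ => φ * φ := by
      simpa using (hSc P).mul hsec'
    refine ((h1.add hsec).add h2).congr_left fun φ => ?_
    conv_rhs => rw [hdec φ]
    have h3 : P * (q' φ + P * X φ * S) = P * q' φ + P * X φ * S := by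
      rw [mul_add, ← mul_assoc P (P * X φ) S, ← mul_assoc P P (X φ), hPP]
    rw [h3, sub_smul, one_smul]
    abel
  rw [hasDerivAt_iff_isLittleO_nhds_zero]
  have h1 : (fun φ => S * (X φ - φ • D) * P) =o[𝓝 0] fun φ : ℝ => φ := by
    simpa using ((hSc S).mul_isLittleO hXo).mul_isBigO (hSc P)
  have h2 : (fun φ => P * (X φ - φ • D) * S) =o[𝓝 0] fun φ : ℝ => φ := by
    simpa using ((hSc P).mul_isLittleO hXo).mul_isBigO (hSc S)
  refine (((hmain.trans_isLittleO hsq).sub h1).sub h2).congr_left fun φ => ?_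
  simp only [hp, zero_add, mul_sub, sub_mul, smul_neg, smul_add, mul_smul_comm, smul_mul_assoc, hP]
  abel

/-! ### Time evolution and the Kubo formula -/

theorem coord_exp (z : ℂ) :
    F.coord (NormedSpace.exp (z • H)) = Matrix.diagonal (fun b => Complex.exp (z * F.e b)) := by
  let u : (Op L n)ˣ := ⟨F.U, star F.U, F.U_mul_star, F.star_mul_U⟩
  have h1 : z • H = (u : Op L n) * Matrix.diagonal (fun b => z * (F.e b : ℂ)) *
      ((u⁻¹ : (Op L n)ˣ) : Op L n) := by
    have h2 : Matrix.diagonal (fun b => z * (F.e b : ℂ)) =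
        z • Matrix.diagonal (fun b => (F.e b : ℂ)) := by
      rw [← Matrix.diagonal_smul]; rfl
    rw [h2, Matrix.mul_smul, Matrix.smul_mul]
    exact congrArg (z • ·) F.diag
  rw [h1, Matrix.exp_units_conj, Matrix.exp_diagonal]
  refine (F.coord_conj _).trans ?_
  congr 1
  ext b
  rw [Pi.coe_exp, Complex.exp_eq_exp_ℂ]

theorem coord_evolve (t : ℝ) (A : Op L n) (i j : Finset (Mode L n)) :
    F.coord (evolve H t A) i j =
      Complex.exp (Complex.I * t * (F.e i - F.e j)) * F.coord A i j := by
  rw [evolve, F.coord_mul, F.coord_mul, F.coord_exp, F.coord_exp, Matrix.mul_diagonal,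
    Matrix.diagonal_mul, mul_right_comm, ← Complex.exp_add]
  congr 2
  ring

theorem groundExp_commutator_evolve {g : ℝ} (hg0 : 0 < g) (hg : HasGap H g) (t : ℝ)
    (A B : Op L n) :
    groundExp H (evolve H t A * B - B * evolve H t A) =
      ∑ b ∈ Finset.univ.erase F.o,
        (F.coord A F.o b * F.coord B b F.o *
            Complex.exp (-(Complex.I * (F.e b - F.e F.o : ℝ) * t)) -
          F.coord B F.o b * F.coord A b F.o *
            Complex.exp (Complex.I * (F.e b - F.e F.o : ℝ) * t)) := by
  rw [F.groundExp_eq_coord hg0 hg, F.coord_sub, F.coord_mul, F.coord_mul, Matrix.sub_apply,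
    Matrix.mul_apply, Matrix.mul_apply, ← Finset.sum_sub_distrib,
    ← Finset.add_sum_erase _ _ (Finset.mem_univ F.o)]
  rw [show F.coord (evolve H t A) F.o F.o * F.coord B F.o F.o -
    F.coord B F.o F.o * F.coord (evolve H t A) F.o F.o = 0 by ring, zero_add]
  refine Finset.sum_congr rfl fun b _ => ?_
  rw [F.coord_evolve, F.coord_evolve]
  rw [show -(Complex.I * ((F.e b - F.e F.o : ℝ) : ℂ) * t) = Complex.I * t * (F.e F.o - F.e b) by
    push_cast; ring, show Complex.I * ((F.e b - F.e F.o : ℝ) : ℂ) * t =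
    Complex.I * t * (F.e b - F.e F.o) by push_cast; ring]
  ring

/-- The two-form `Ω(A, B) = i ω(A S² B - B S² A)` on operators, with `S` the reduced resolvent.
Both the adiabatic curvature and the Kubo coefficient are values of it. -/
def curv (A B : Op L n) : ℂ :=
  Complex.I * groundExp H (A * F.res * F.res * B - B * F.res * F.res * A)

theorem curv_eq_sum {g : ℝ} (hg0 : 0 < g) (hg : HasGap H g) (A B : Op L n) :
    F.curv A B = Complex.I * ∑ b ∈ Finset.univ.erase F.o,
      (F.coord A F.o b * F.coord B b F.o - F.coord B F.o b * F.coord A b F.o) /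
        ((F.e b - F.e F.o : ℝ) : ℂ) ^ 2 := by
  rw [curv, F.groundExp_eq_coord hg0 hg, F.coord_sub]
  simp only [F.coord_mul, F.coord_res, Matrix.sub_apply]
  rw [Matrix.mul_apply, Matrix.mul_apply, ← Finset.sum_sub_distrib,
    ← Finset.add_sum_erase _ _ (Finset.mem_univ F.o)]
  simp only [Matrix.mul_diagonal, sub_self, Complex.ofReal_zero, inv_zero, mul_zero, zero_mul,
    zero_add]
  congr 1
  refine Finset.sum_congr rfl fun b _ => ?_
  rw [div_eq_mul_inv, ← inv_pow]
  ring

open MeasureTheory Complex in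
/-- In the eigenbasis the Kubo integrand is a finite sum of exponentials, none of which is constant
because of the gap. -/
theorem isKuboResponse_zero {g : ℝ} (hg0 : 0 < g) (hg : HasGap H g) (J V : Op L n) :
    IsKuboResponse H J V 0 (-groundExp H (V * F.res * J + J * F.res * V)) := by
  set s := Finset.univ.erase F.o
  set ω : Finset (Mode L n) → ℝ := fun b => F.e b - F.e F.o with hω
  have hω0 : ∀ b ∈ s, (ω b : ℂ) ≠ 0 := fun b hb => by
    have := F.gap_le hg (Finset.ne_of_mem_erase hb)
    exact ofReal_ne_zero.2 (by simp only [hω]; linarith)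
  set a : Finset (Mode L n) → ℂ := fun b => F.coord V F.o b * F.coord J b F.o
  set a' : Finset (Mode L n) → ℂ := fun b => F.coord J F.o b * F.coord V b F.o
  have hval : -groundExp H (V * F.res * J + J * F.res * V) =
      I * ∑ b ∈ s, (a b * (-1 / (I * ω b)) - a' b * (-1 / (-(I * ω b)))) := by
    rw [F.groundExp_eq_coord hg0 hg, F.coord_add]
    simp only [F.coord_mul, F.coord_res, Matrix.add_apply]
    rw [Matrix.mul_apply, Matrix.mul_apply, ← Finset.sum_add_distrib,
      ← Finset.add_sum_erase _ _ (Finset.mem_univ F.o)]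
    simp only [Matrix.mul_diagonal, sub_self, Complex.ofReal_zero, inv_zero, mul_zero, zero_mul,
      zero_add]
    rw [Finset.mul_sum, ← Finset.sum_neg_distrib]
    refine Finset.sum_congr rfl fun b hb => ?_
    have h1 := hω0 b hb
    simp only [a, a']
    rw [show ((F.e b - F.e F.o : ℝ) : ℂ) = ω b from rfl]
    field_simp
    ring
  have hint : ∀ ε t : ℝ, kuboIntegrand H J V 0 ε t =
      ∑ b ∈ s, (a b * cexp ((I * ω b - ε) * t) - a' b * cexp ((-(I * ω b) - ε) * t)) := by
    intro ε t
    rw [kuboIntegrand, F.groundExp_commutator_evolve hg0 hg, Finset.sum_mul]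
    refine Finset.sum_congr rfl fun b _ => ?_
    rw [sub_mul, mul_assoc, ← Complex.exp_add, mul_assoc (_ * _), ← Complex.exp_add]
    simp only [a, a', hω]
    congr 3
    · push_cast
      ring
    · push_cast
      ring
  have hre : ∀ (ε : ℝ), 0 < ε → ∀ b, (I * ω b - ε).re < 0 ∧ (-(I * ω b) - ε).re < 0 := by
    intro ε hε b
    constructor <;> simp [hε]
  have hI : ∀ (ε : ℝ), 0 < ε → ∀ b, IntegrableOn
      (fun t : ℝ => a b * cexp ((I * ω b - ε) * t) - a' b * cexp ((-(I * ω b) - ε) * t))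
      (Set.Ioi 0) volume := fun ε hε b =>
    ((integrableOn_exp_mul_complex_Ioi (hre ε hε b).1 0).const_mul _).sub
      ((integrableOn_exp_mul_complex_Ioi (hre ε hε b).2 0).const_mul _)
  constructor
  · intro ε hε
    rw [show kuboIntegrand H J V 0 ε = _ from funext (hint ε)]
    exact integrable_finsetSum _ fun b _ => hI ε hε b
  · rw [hval]
    have hlim : Filter.Tendsto (fun ε : ℝ => I * ∑ b ∈ s,
        (a b * (-1 / (I * ω b - ε)) - a' b * (-1 / (-(I * ω b) - ε))))
        (nhdsWithin 0 (Set.Ioi 0))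
        (nhds (I * ∑ b ∈ s, (a b * (-1 / (I * ω b)) - a' b * (-1 / (-(I * ω b)))))) := by
      refine Filter.Tendsto.mono_left ?_ nhdsWithin_le_nhds
      have h0 : Filter.Tendsto (fun ε : ℝ => (ε : ℂ)) (nhds 0) (nhds 0) := by
        simpa using Complex.continuous_ofReal.tendsto 0
      refine Filter.Tendsto.const_mul _ (tendsto_finsetSum _ fun b hb => ?_)
      have h1 := hω0 b hb
      have hne : I * (ω b : ℂ) ≠ 0 := mul_ne_zero I_ne_zero h1
      refine Filter.Tendsto.sub (Filter.Tendsto.const_mul _ (Filter.Tendsto.div tendsto_const_nhds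
        ?_ hne)) (Filter.Tendsto.const_mul _ (Filter.Tendsto.div tendsto_const_nhds
        ?_ (neg_ne_zero.2 hne)))
      · simpa using (tendsto_const_nhds (x := I * (ω b : ℂ))).sub h0
      · simpa using (tendsto_const_nhds (x := -(I * (ω b : ℂ)))).sub h0
    refine hlim.congr' ?_
    filter_upwards [self_mem_nhdsWithin] with ε hε
    have hε : 0 < ε := hε
    simp only [hint]
    rw [integral_finsetSum _ fun b _ => hI ε hε b]
    congr 1
    refine Finset.sum_congr rfl fun b _ => ?_
    rw [integral_sub ((integrableOn_exp_mul_complex_Ioi (hre ε hε b).1 0).const_mul _)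
      ((integrableOn_exp_mul_complex_Ioi (hre ε hε b).2 0).const_mul _),
      integral_const_mul, integral_const_mul, integral_exp_mul_complex_Ioi (hre ε hε b).1,
      integral_exp_mul_complex_Ioi (hre ε hε b).2]
    simp

end EigenFrame

/-! ### Lieb–Robinson bounds -/

/-- The commutator `[A, B]`. -/
def comm (A B : Op L n) : Op L n := A * B - B * A

theorem evolve_eq (H : Op L n) (t : ℝ) (A : Op L n) :
    evolve H t A = NormedSpace.exp (t • (Complex.I • H)) * A *
      NormedSpace.exp (t • (-(Complex.I • H))) := by
  have h : (Complex.I * (t : ℂ)) • H = t • (Complex.I • H) := by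
    rw [mul_comm, mul_smul, Complex.coe_smul]
  rw [evolve, neg_smul, h, smul_neg]

theorem exp_smul_mul_exp_neg_smul (X : Op L n) (t : ℝ) :
    NormedSpace.exp (t • X) * NormedSpace.exp (t • (-X)) = 1 := by
  rw [smul_neg, ← Matrix.exp_add_of_commute (t • X) (-(t • X)) (Commute.refl (t • X)).neg_right,
    add_neg_cancel,
    NormedSpace.exp_zero]

theorem evolve_mul (H : Op L n) (t : ℝ) (A B : Op L n) :
    evolve H t (A * B) = evolve H t A * evolve H t B := by
  have h := exp_smul_mul_exp_neg_smul (-(Complex.I • H)) t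
  rw [neg_neg] at h
  simp only [evolve_eq]
  set W := NormedSpace.exp (t • (Complex.I • H))
  set W' := NormedSpace.exp (t • (-(Complex.I • H)))
  calc W * (A * B) * W' = W * A * 1 * B * W' := by noncomm_ring
    _ = _ := by rw [← h]; noncomm_ring

theorem evolve_sub (H : Op L n) (t : ℝ) (A B : Op L n) :
    evolve H t (A - B) = evolve H t A - evolve H t B := by
  simp only [evolve]; noncomm_ring

theorem evolve_smul (H : Op L n) (t : ℝ) (c : ℂ) (A : Op L n) :
    evolve H t (c • A) = c • evolve H t A := by
  simp only [evolve, mul_smul_comm, smul_mul_assoc]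

theorem evolve_sum {ι : Type*} (H : Op L n) (t : ℝ) (s : Finset ι) (A : ι → Op L n) :
    evolve H t (∑ i ∈ s, A i) = ∑ i ∈ s, evolve H t (A i) := by
  simp only [evolve, Finset.mul_sum, Finset.sum_mul]

theorem comm_smul_left (c : ℂ) (A B : Op L n) : comm (c • A) B = c • comm A B := by
  simp only [comm, smul_mul_assoc, mul_smul_comm, smul_sub]

theorem comm_sum_left {ι : Type*} (s : Finset ι) (A : ι → Op L n) (B : Op L n) :
    comm (∑ i ∈ s, A i) B = ∑ i ∈ s, comm (A i) B := by
  simp only [comm, Finset.sum_mul, Finset.mul_sum, Finset.sum_sub_distrib]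

theorem evolve_comm (H : Op L n) (t : ℝ) (A B : Op L n) :
    evolve H t (comm A B) = comm (evolve H t A) (evolve H t B) := by
  simp only [comm, evolve_sub, evolve_mul]

theorem evolve_zero (H A : Op L n) : evolve H 0 A = A := by
  simp [evolve]

theorem norm_evolve_le {H : Op L n} (hH : H.IsHermitian) (t : ℝ) (A : Op L n) :
    ‖evolve H t A‖ ≤ ‖A‖ := by
  have hn : ∀ X : Op L n, X * star X = 1 → ‖X‖ ≤ 1 := by
    intro X hX
    have h := CStarRing.norm_self_mul_star (x := X)
    rw [hX] at h
    have h1 : ‖(1 : Op L n)‖ ≤ 1 := by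
      rw [← Matrix.diagonal_one, Matrix.l2_opNorm_diagonal]
      exact (pi_norm_le_iff_of_nonneg zero_le_one).2 fun i => by simp
    nlinarith [norm_nonneg X]
  have hX : ∀ X : Op L n, star X = -X → ‖NormedSpace.exp (t • X)‖ ≤ 1 := by
    intro X hX
    refine hn _ ?_
    have : star (NormedSpace.exp (t • X)) = NormedSpace.exp (t • (-X)) := by
      rw [Matrix.star_eq_conjTranspose, ← Matrix.exp_conjTranspose, ← Matrix.star_eq_conjTranspose,
        star_smul, hX, star_trivial]
    rw [this, exp_smul_mul_exp_neg_smul]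
  have hs : star (Complex.I • H) = -(Complex.I • H) := by
    have : star H = H := hH
    rw [star_smul, this, Complex.star_def, Complex.conj_I, neg_smul]
  rw [evolve_eq]
  have h1 := hX _ hs
  have h2 := hX (-(Complex.I • H)) (by rw [star_neg, hs])
  calc _ ≤ ‖NormedSpace.exp (t • (Complex.I • H))‖ * ‖A‖ *
      ‖NormedSpace.exp (t • (-(Complex.I • H)))‖ :=
        (norm_mul_le _ _).trans (by gcongr; exact norm_mul_le _ _)
    _ ≤ 1 * ‖A‖ * 1 := by gcongr
    _ = ‖A‖ := by ring

theorem hasDerivAt_evolve (H A : Op L n) (t : ℝ) :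
    HasDerivAt (fun t => evolve H t A) (evolve H t (Complex.I • comm H A)) t := by
  have h1 := hasDerivAt_exp_smul_const (𝕂 := ℝ) (Complex.I • H) t
  have h2 := hasDerivAt_exp_smul_const' (𝕂 := ℝ) (-(Complex.I • H)) t
  have h3 := (h1.mul_const A).mul h2
  rw [show (fun t => evolve H t A) = fun t => NormedSpace.exp (t • (Complex.I • H)) * A *
      NormedSpace.exp (t • (-(Complex.I • H))) from funext fun t => evolve_eq H t A]
  refine h3.congr_deriv ?_
  rw [evolve_eq, comm]
  simp only [sub_eq_add_neg, mul_add, add_mul, smul_add, smul_neg, mul_smul_comm, smul_mul_assoc,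
    mul_assoc, neg_mul, mul_neg]

theorem norm_comm_le (A B : Op L n) : ‖comm A B‖ ≤ 2 * ‖A‖ * ‖B‖ := by
  have h := norm_sub_le (A * B) (B * A)
  have h1 := norm_mul_le A B
  have h2 := norm_mul_le B A
  simp only [comm]
  linarith

theorem norm_comm_comm_le (x y B : Op L n) :
    ‖comm (comm x y) B‖ ≤ 2 * ‖x‖ * ‖comm y B‖ + 2 * ‖y‖ * ‖comm x B‖ := by
  have e : comm (comm x y) B =
      x * comm y B + comm x B * y - (y * comm x B + comm y B * x) := by
    simp only [comm]; noncomm_ring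
  rw [e]
  have h := norm_sub_le (x * comm y B + comm x B * y) (y * comm x B + comm y B * x)
  have h0 := norm_add_le (x * comm y B) (comm x B * y)
  have h0' := norm_add_le (y * comm x B) (comm y B * x)
  have h1 := norm_mul_le x (comm y B)
  have h2 := norm_mul_le (comm x B) y
  have h3 := norm_mul_le y (comm x B)
  have h4 := norm_mul_le (comm y B) x
  linarith

/-- The Lieb–Robinson bound. The Hamiltonian is a combination of bounded terms `a i`, each of which
fails to commute with at most `ν` others; `d i` is a lower bound, up to the range `ρ`, for the
distance of `a i` to the observable `B`. The weighted commutators `2 ^ d i • [a i (t), B]` satisfy a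
closed linear differential inequality in the supremum norm, so that Grönwall's lemma applies. -/
theorem norm_comm_evolve_le_of_nonneg {ι : Type*} [Fintype ι] {H H₀ B : Op L n}
    (hH : H.IsHermitian) {a : ι → Op L n} {c : ι → ℂ} {M : ℝ} {ν ρ : ℕ} {N : ι → Finset ι}
    {d : ι → ℕ} (hsum : H = H₀ + ∑ i, c i • a i) (hH₀ : ∀ i, Commute H₀ (a i))
    (hc : ∀ i, ‖c i‖ ≤ 1) (ha : ∀ i, ‖a i‖ ≤ M) (hN : ∀ i j, j ∉ N i → Commute (a j) (a i))
    (hcard : ∀ i, (N i).card ≤ ν) (hd : ∀ i, ∀ j ∈ N i, d i ≤ d j + ρ)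
    (hB : ∀ i, ρ < d i → Commute (a i) B) (t : ℝ) (ht : 0 ≤ t) (i : ι) :
    ‖comm (evolve H t (a i)) B‖ ≤
      2 ^ ρ * (2 * M * ‖B‖) * Real.exp (ν * (2 * M * (1 + 2 ^ ρ)) * t) / 2 ^ d i := by
  have hM : 0 ≤ M := (norm_nonneg _).trans (ha i)
  let f : ℝ → ι → Op L n := fun s i => ((2 : ℝ) ^ d i) • comm (evolve H s (a i)) B
  let f' : ℝ → ι → Op L n := fun s i =>
    ((2 : ℝ) ^ d i) • comm (evolve H s (Complex.I • comm H (a i))) B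
  have hf : ∀ s, HasDerivAt f (f' s) s := by
    intro s
    refine hasDerivAt_pi.2 fun i => HasDerivAt.const_smul ((2 : ℝ) ^ d i) ?_
    exact ((hasDerivAt_evolve H (a i) s).mul_const B).sub
      ((hasDerivAt_evolve H (a i) s).const_mul B)
  have hfi : ∀ s i, ‖comm (evolve H s (a i)) B‖ = ‖f s i‖ / 2 ^ d i := by
    intro s i
    simp only [f]
    rw [norm_smul, Real.norm_of_nonneg (by positivity)]
    field_simp
  have hbound : ∀ s, ‖f' s‖ ≤ ν * (2 * M * (1 + 2 ^ ρ)) * ‖f s‖ + 0 := by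
    intro s
    rw [add_zero]
    refine (pi_norm_le_iff_of_nonneg (by positivity)).2 fun i => ?_
    have e1 : comm H (a i) = ∑ j ∈ N i, c j • comm (a j) (a i) := by
      have : comm H (a i) = ∑ j, c j • comm (a j) (a i) := by
        have h0 := (hH₀ i).eq
        simp only [comm, hsum, add_mul, mul_add, Finset.sum_mul, Finset.mul_sum, smul_sub,
          Finset.sum_sub_distrib, smul_mul_assoc, mul_smul_comm, h0]
        abel
      rw [this]
      refine (Finset.sum_subset (Finset.subset_univ _) fun j _ hj => ?_).symm
      rw [comm, (hN i j hj).eq, sub_self, smul_zero]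
    have e2 : comm (evolve H s (Complex.I • comm H (a i))) B = Complex.I • ∑ j ∈ N i,
        c j • comm (comm (evolve H s (a j)) (evolve H s (a i))) B := by
      rw [e1, evolve_smul, evolve_sum]
      simp only [evolve_smul, comm_smul_left, comm_sum_left, evolve_comm]
    simp only [f']
    rw [norm_smul, Real.norm_of_nonneg (by positivity), e2, norm_smul, Complex.norm_I, one_mul]
    have e3 : ∀ j ∈ N i, ‖c j • comm (comm (evolve H s (a j)) (evolve H s (a i))) B‖ ≤
        2 * M * (1 + 2 ^ ρ) * ‖f s‖ / 2 ^ d i := by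
      intro j hj
      rw [norm_smul]
      have h1 := norm_comm_comm_le (evolve H s (a j)) (evolve H s (a i)) B
      have h2 := (norm_evolve_le hH s (a j)).trans (ha j)
      have h3 := (norm_evolve_le hH s (a i)).trans (ha i)
      have h4 : ‖comm (evolve H s (a i)) B‖ ≤ ‖f s‖ / 2 ^ d i := by
        rw [hfi]; gcongr; exact norm_le_pi_norm (f s) i
      have h5 : ‖comm (evolve H s (a j)) B‖ ≤ 2 ^ ρ * ‖f s‖ / 2 ^ d i := by
        rw [hfi, div_le_div_iff₀ (by positivity) (by positivity)]
        have h6 : (2 : ℝ) ^ d i ≤ 2 ^ ρ * 2 ^ d j := by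
          rw [← pow_add, add_comm]
          exact pow_le_pow_right₀ one_le_two (hd i j hj)
        calc ‖f s j‖ * 2 ^ d i ≤ ‖f s‖ * (2 ^ ρ * 2 ^ d j) := by
              gcongr; exact norm_le_pi_norm (f s) j
          _ = _ := by ring
      calc ‖c j‖ * ‖comm (comm (evolve H s (a j)) (evolve H s (a i))) B‖
          ≤ 1 * (2 * M * (‖f s‖ / 2 ^ d i) + 2 * M * (2 ^ ρ * ‖f s‖ / 2 ^ d i)) := by
            gcongr
            · exact hc j
            · exact h1.trans (by gcongr)
        _ = _ := by ring
    calc (2 : ℝ) ^ d i * ‖∑ j ∈ N i, c j • comm (comm (evolve H s (a j)) (evolve H s (a i))) B‖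
        ≤ 2 ^ d i * ∑ j ∈ N i, 2 * M * (1 + 2 ^ ρ) * ‖f s‖ / 2 ^ d i := by
          gcongr
          exact norm_sum_le_of_le _ e3
      _ = (N i).card * (2 * M * (1 + 2 ^ ρ) * ‖f s‖) := by
          rw [Finset.sum_const, nsmul_eq_mul]
          field_simp
      _ ≤ ν * (2 * M * (1 + 2 ^ ρ) * ‖f s‖) := by
          gcongr
          exact hcard i
      _ = _ := by ring
  have h0 : ‖f 0‖ ≤ 2 ^ ρ * (2 * M * ‖B‖) := by
    refine (pi_norm_le_iff_of_nonneg (by positivity)).2 fun i => ?_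
    simp only [f]
    rw [norm_smul, Real.norm_of_nonneg (by positivity), evolve_zero]
    by_cases h : ρ < d i
    · rw [comm, (hB i h).eq, sub_self, norm_zero, mul_zero]
      positivity
    · have h1 := norm_comm_le (a i) B
      have h2 := ha i
      gcongr
      · exact one_le_two
      · omega
      · exact h1.trans (by gcongr)
  have hG := norm_le_gronwallBound_of_norm_deriv_right_le (f := f) (f' := f') (a := 0) (b := t)
    (fun s _ => (hf s).continuousAt.continuousWithinAt) (fun s _ => (hf s).hasDerivWithinAt) h0
    (fun s _ => hbound s) t ⟨ht, le_rfl⟩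
  rw [gronwallBound_ε0, sub_zero] at hG
  rw [hfi]
  gcongr
  exact (norm_le_pi_norm (f t) i).trans hG

theorem evolve_neg (H : Op L n) (t : ℝ) (A : Op L n) : evolve H (-t) A = evolve (-H) t A := by
  simp [evolve]

theorem norm_comm_evolve_le {ι : Type*} [Fintype ι] {H H₀ B : Op L n}
    (hH : H.IsHermitian) {a : ι → Op L n} {c : ι → ℂ} {M : ℝ} {ν ρ : ℕ} {N : ι → Finset ι}
    {d : ι → ℕ} (hsum : H = H₀ + ∑ i, c i • a i) (hH₀ : ∀ i, Commute H₀ (a i))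
    (hc : ∀ i, ‖c i‖ ≤ 1) (ha : ∀ i, ‖a i‖ ≤ M) (hN : ∀ i j, j ∉ N i → Commute (a j) (a i))
    (hcard : ∀ i, (N i).card ≤ ν) (hd : ∀ i, ∀ j ∈ N i, d i ≤ d j + ρ)
    (hB : ∀ i, ρ < d i → Commute (a i) B) (t : ℝ) (i : ι) :
    ‖comm (evolve H t (a i)) B‖ ≤
      2 ^ ρ * (2 * M * ‖B‖) * Real.exp (ν * (2 * M * (1 + 2 ^ ρ)) * |t|) / 2 ^ d i := by
  rcases le_total 0 t with ht | ht
  · rw [abs_of_nonneg ht]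
    exact norm_comm_evolve_le_of_nonneg hH hsum hH₀ hc ha hN hcard hd hB t ht i
  -- Evolution to negative times is evolution with `-H`.
  · rw [abs_of_nonpos ht, ← neg_neg t, evolve_neg, neg_neg]
    refine norm_comm_evolve_le_of_nonneg (H₀ := -H₀) (c := fun i => -c i) hH.neg ?_
      (fun i => (hH₀ i).neg_left) (fun i => by rw [norm_neg]; exact hc i) ha hN hcard hd hB
      (-t) (by linarith) i
    simp only [hsum, neg_add, neg_smul, Finset.sum_neg_distrib]

/-- An exponential light cone is dominated by any power of `(1 + t) / (1 + d)`. -/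
theorem exists_exp_div_two_pow_le {c : ℝ} (hc : 0 ≤ c) (N : ℕ) :
    ∃ K : ℝ, 1 ≤ K ∧ ∀ (t : ℝ) (d : ℕ) (x : ℝ), 0 ≤ t → x ≤ 1 → x ≤ Real.exp (c * t) / 2 ^ d →
      x ≤ K * ((1 + t) / (1 + d)) ^ N := by
  have hl : 0 < Real.log 2 := Real.log_pos one_lt_two
  set K₀ : ℝ := 1 + 2 * c / Real.log 2 with hK₀
  set K₁ : ℝ := Real.exp (Real.log 2 / 2) * N.factorial * (2 / Real.log 2) ^ N with hK₁
  have hK₀1 : 1 ≤ K₀ := by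
    have : 0 ≤ 2 * c / Real.log 2 := by positivity
    linarith
  have hK₁0 : 0 ≤ K₁ := by positivity
  refine ⟨K₀ ^ N + K₁, ?_, ?_⟩
  · have := one_le_pow₀ hK₀1 (n := N)
    linarith
  intro t d x ht hx1 hx2
  rw [add_mul]
  -- Near the light cone `(1 + t) / (1 + d)` is bounded below; away from it the exponential wins.
  rcases le_total (d * Real.log 2 / 2) (c * t) with h | h
  · have h1 : 1 ≤ K₀ ^ N * ((1 + t) / (1 + d)) ^ N := by
      rw [← mul_pow]
      refine one_le_pow₀ ?_
      rw [← mul_div_assoc, one_le_div (by positivity), hK₀]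
      have h2 : (d : ℝ) ≤ 2 * c / Real.log 2 * t := by
        rw [div_mul_eq_mul_div, le_div_iff₀ hl]
        linarith
      have h3 : 0 ≤ 2 * c / Real.log 2 := by positivity
      nlinarith
    have h2 : 0 ≤ K₁ * ((1 + t) / (1 + d)) ^ N := by positivity
    linarith
  · have h1 : x ≤ K₁ * ((1 + t) / (1 + d)) ^ N := by
      have e1 : (2 : ℝ) ^ d = Real.exp (d * Real.log 2) := by
        rw [Real.exp_nat_mul, Real.exp_log two_pos]
      rw [e1, ← Real.exp_sub] at hx2
      have h2 : x ≤ Real.exp (-(d * Real.log 2 / 2)) :=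
        hx2.trans (Real.exp_le_exp.2 (by linarith))
      have h3 := Real.pow_div_factorial_le_exp ((1 + d) * Real.log 2 / 2) (by positivity) N
      have h4 : Real.exp (-(d * Real.log 2 / 2)) =
          Real.exp (Real.log 2 / 2) / Real.exp ((1 + d) * Real.log 2 / 2) := by
        rw [← Real.exp_sub]
        congr 1
        ring
      have h5 : Real.exp (Real.log 2 / 2) / Real.exp ((1 + d) * Real.log 2 / 2) ≤
          Real.exp (Real.log 2 / 2) / (((1 + d) * Real.log 2 / 2) ^ N / N.factorial) := by
        gcongr
      have h6 : Real.exp (Real.log 2 / 2) / (((1 + d) * Real.log 2 / 2) ^ N / N.factorial) =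
          K₁ * (1 / (1 + d)) ^ N := by
        rw [hK₁, div_pow, div_pow, div_pow, mul_pow, one_pow]
        field_simp
      rw [h4] at h2
      refine (h2.trans (h5.trans h6.le)).trans ?_
      gcongr
      linarith
    have h2 : 0 ≤ K₀ ^ N * ((1 + t) / (1 + d)) ^ N := by positivity
    linarith

/-! ### Locality of the two-form `Ω` -/

/-- A light-cone bound on `[A(t), B]` makes `Ω(A, B)` small. -/
theorem EigenFrame.exists_norm_curv_le {g : ℝ} (hg : 0 < g) (N : ℕ) :
    ∃ C : ℝ, 0 ≤ C ∧ ∀ (L n : ℕ) [NeZero L] (H : Op L n) (F : EigenFrame H), HasGap H g →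
      ∀ (A B : Op L n) (K : ℝ), (∀ t, ‖comm (evolve H t A) B‖ ≤ K * (1 + |t|) ^ N) →
        ‖F.curv A B‖ ≤ C * K := by
  obtain ⟨C, hC0, hC⟩ := exists_norm_sum_div_sq_le hg N
  refine ⟨C, hC0, fun L n _ H F hgap A B K hK => ?_⟩
  rw [F.curv_eq_sum hg hgap, norm_mul, Complex.norm_I, one_mul]
  refine hC _ _ (fun b => F.coord A F.o b * F.coord B b F.o)
    (fun b => F.coord B F.o b * F.coord A b F.o) (fun b => F.e b - F.e F.o) K ?_ ?_
  · intro b hb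
    have := F.gap_le hgap (Finset.ne_of_mem_erase hb)
    rw [le_abs]
    left
    linarith
  · intro t
    rw [← F.groundExp_commutator_evolve hg hgap]
    exact (F.norm_groundExp_le hg hgap _).trans (hK t)

/-! ### Canonical anticommutation relations -/

/-- The fermionic sign picked up when the mode `i` is created in, or annihilated from, the
configuration `T`. -/
def fsign (i : Mode L n) (T : Finset (Mode L n)) : ℂ :=
  (-1) ^ (T.filter fun j => modeIndex j < modeIndex i).card

theorem modeIndex_injective : Function.Injective (modeIndex (L := L) (n := n)) := by
  rintro ⟨⟨x₁, x₂⟩, σ⟩ ⟨⟨y₁, y₂⟩, τ⟩ h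
  simp only [modeIndex] at h
  have h1 := Nat.div_add_mod ((x₁.val * L + x₂.val) * n + σ.val) n
  have hn : 0 < n := σ.pos
  have hL : 0 < L := NeZero.pos L
  have key : ∀ {N a b c d : ℕ}, 0 < N → b < N → d < N → a * N + b = c * N + d → a = c ∧ b = d := by
    intro N a b c d hN hb hd he
    have e1 : (a * N + b) / N = a := by
      rw [mul_comm, Nat.mul_add_div hN, Nat.div_eq_of_lt hb, add_zero]
    have e2 : (c * N + d) / N = c := by
      rw [mul_comm, Nat.mul_add_div hN, Nat.div_eq_of_lt hd, add_zero]
    have e3 : a = c := by rw [← e1, he, e2]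
    subst e3
    exact ⟨rfl, by omega⟩
  obtain ⟨h2, h3⟩ := key hn σ.isLt τ.isLt h
  obtain ⟨h4, h5⟩ := key hL (ZMod.val_lt _) (ZMod.val_lt _) h2
  rw [ZMod.val_injective L h4, ZMod.val_injective L h5, Fin.ext h3]

theorem annih_apply (i : Mode L n) (S T : Finset (Mode L n)) :
    annih i S T = if i ∈ T ∧ S = T.erase i then fsign i T else 0 := rfl

theorem fsign_erase_self (i : Mode L n) (T : Finset (Mode L n)) :
    fsign i (T.erase i) = fsign i T := by
  rw [fsign, fsign, Finset.filter_erase, Finset.erase_eq_of_notMem (by simp)]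

theorem star_fsign (i : Mode L n) (T : Finset (Mode L n)) : star (fsign i T) = fsign i T := by
  simp [fsign]

theorem fsign_mul_self (i : Mode L n) (T : Finset (Mode L n)) : fsign i T * fsign i T = 1 := by
  rw [fsign, ← mul_pow]; simp

theorem creat_apply (i : Mode L n) (S T : Finset (Mode L n)) :
    creat i S T = if i ∉ T ∧ S = insert i T then fsign i T else 0 := by
  rw [creat, Matrix.conjTranspose_apply, annih_apply]
  have hiff : (i ∈ S ∧ T = S.erase i) ↔ (i ∉ T ∧ S = insert i T) := by
    constructor
    · rintro ⟨h, rfl⟩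
      simp [Finset.insert_erase h]
    · rintro ⟨h, rfl⟩
      simp [Finset.erase_insert h]
  by_cases h : i ∉ T ∧ S = insert i T
  · rw [if_pos h, if_pos (hiff.2 h), star_fsign, (hiff.2 h).2, fsign_erase_self]
  · rw [if_neg h, if_neg (fun h' => h (hiff.1 h')), star_zero]

theorem mul_annih_apply (M : Op L n) (i : Mode L n) (S T : Finset (Mode L n)) :
    (M * annih i) S T = if i ∈ T then M S (T.erase i) * fsign i T else 0 := by
  rw [Matrix.mul_apply]
  simp only [annih_apply]
  split_ifs with h
  · rw [Finset.sum_eq_single (T.erase i)]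
    · simp [h]
    · intro U _ hU
      simp [hU]
    · simp
  · simp [h]

theorem mul_creat_apply (M : Op L n) (i : Mode L n) (S T : Finset (Mode L n)) :
    (M * creat i) S T = if i ∉ T then M S (insert i T) * fsign i T else 0 := by
  rw [Matrix.mul_apply]
  simp only [creat_apply]
  split_ifs with h
  · rw [Finset.sum_eq_single (insert i T)]
    · simp [h]
    · intro U _ hU
      simp [hU]
    · simp
  · simp [h]

theorem fsign_erase {i j : Mode L n} {T : Finset (Mode L n)} (hj : j ∈ T) :
    fsign i (T.erase j) = if modeIndex j < modeIndex i then -fsign i T else fsign i T := by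
  rw [fsign, fsign, Finset.filter_erase]
  split_ifs with h
  · have hmem : j ∈ T.filter fun k => modeIndex k < modeIndex i := by simp [hj, h]
    rw [← Finset.card_erase_add_one hmem, pow_succ]
    ring
  · rw [Finset.erase_eq_of_notMem (by simp [h])]

theorem fsign_insert {i j : Mode L n} {T : Finset (Mode L n)} (hj : j ∉ T) :
    fsign i (insert j T) = if modeIndex j < modeIndex i then -fsign i T else fsign i T := by
  have h := fsign_erase (i := i) (Finset.mem_insert_self j T)
  rw [Finset.erase_insert hj] at h
  rw [h]
  split_ifs <;> simp

theorem annih_mul_annih {i j : Mode L n} (hij : i ≠ j) :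
    annih i * annih j = -(annih j * annih i) := by
  have hne : modeIndex i ≠ modeIndex j := fun h => hij (modeIndex_injective h)
  ext S T
  rw [Matrix.neg_apply, mul_annih_apply, mul_annih_apply]
  simp only [annih_apply, Finset.mem_erase, ne_eq, hij, hij.symm, not_false_eq_true, true_and]
  rw [Finset.erase_right_comm (a := i)]
  by_cases hi : i ∈ T
  · by_cases hj : j ∈ T
    · simp only [hi, hj, if_true, true_and]
      split_ifs with hS
      · rw [fsign_erase hi, fsign_erase hj]
        rcases lt_or_gt_of_ne hne with h | h
        · rw [if_neg (by omega), if_pos h]; ring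
        · rw [if_pos h, if_neg (by omega)]; ring
      · simp
    · simp [hj]
  · simp [hi]

theorem annih_mul_creat {i j : Mode L n} (hij : i ≠ j) :
    annih i * creat j = -(creat j * annih i) := by
  have hne : modeIndex i ≠ modeIndex j := fun h => hij (modeIndex_injective h)
  ext S T
  rw [Matrix.neg_apply, mul_annih_apply, mul_creat_apply]
  simp only [annih_apply, creat_apply, Finset.mem_erase, Finset.mem_insert, ne_eq, hij, hij.symm,
    not_false_eq_true, true_and, false_or]
  rw [Finset.erase_insert_of_ne hij.symm]
  by_cases hi : i ∈ T
  · by_cases hj : j ∉ T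
    · simp only [hi, hj, if_true, true_and, not_false_eq_true]
      split_ifs with hS
      · rw [fsign_erase hi, fsign_insert hj]
        rcases lt_or_gt_of_ne hne with h | h
        · rw [if_neg (by omega), if_pos h]; ring
        · rw [if_pos h, if_neg (by omega)]; ring
      · simp
    · simp [hj]
  · simp [hi]

theorem star_annih (i : Mode L n) : star (annih i) = creat i := rfl

theorem star_creat (i : Mode L n) : star (creat i) = annih i := by
  rw [← star_annih, star_star]

theorem creat_mul_annih {i j : Mode L n} (hij : i ≠ j) :
    creat i * annih j = -(annih j * creat i) := by
  rw [annih_mul_creat hij.symm, neg_neg]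

theorem creat_mul_creat {i j : Mode L n} (hij : i ≠ j) :
    creat i * creat j = -(creat j * creat i) := by
  have := congrArg star (annih_mul_annih hij.symm)
  rwa [star_neg, star_mul, star_mul, star_annih, star_annih] at this

theorem creat_mul_annih_self (i : Mode L n) :
    creat i * annih i = Matrix.diagonal fun T => if i ∈ T then 1 else 0 := by
  ext S T
  rw [mul_annih_apply, creat_apply, fsign_erase_self]
  by_cases hi : i ∈ T
  · by_cases hS : S = T
    · subst hS
      simp [hi, Finset.insert_erase hi, fsign_mul_self]
    · rw [Matrix.diagonal_apply_ne _ hS]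
      simp [Finset.insert_erase hi, hS]
  · by_cases hS : S = T
    · subst hS; simp [hi]
    · rw [Matrix.diagonal_apply_ne _ hS]; simp [hi]

theorem norm_annih_le (i : Mode L n) : ‖annih i‖ ≤ 1 := by
  have h := CStarRing.norm_star_mul_self (x := annih i)
  rw [star_annih, creat_mul_annih_self, Matrix.l2_opNorm_diagonal] at h
  have h1 : ‖fun T : Finset (Mode L n) => if i ∈ T then (1 : ℂ) else 0‖ ≤ 1 :=
    (pi_norm_le_iff_of_nonneg zero_le_one).2 fun T => by split_ifs <;> simp
  nlinarith [norm_nonneg (annih i)]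

theorem norm_creat_le (i : Mode L n) : ‖creat i‖ ≤ 1 := by
  rw [← star_annih, norm_star]; exact norm_annih_le i

/-! ### Parity and commutation at a distance -/

/-- The fermion parity `(-1)^N`. -/
def parity (L n : ℕ) [NeZero L] : Op L n := Matrix.diagonal fun T => (-1) ^ T.card

theorem parity_mul_self : parity L n * parity L n = 1 := by
  rw [parity, Matrix.diagonal_mul_diagonal, ← Matrix.diagonal_one]
  congr 1
  ext T
  rw [← mul_pow]; simp

theorem parity_mul_annih (i : Mode L n) : parity L n * annih i = -(annih i * parity L n) := by
  ext S T
  rw [parity, Matrix.neg_apply, Matrix.diagonal_mul, Matrix.mul_diagonal, annih_apply]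
  split_ifs with h
  · rw [h.2, ← Finset.card_erase_add_one h.1, pow_succ]; ring
  · simp

theorem star_parity : star (parity L n) = parity L n := by
  rw [parity, Matrix.star_eq_conjTranspose, Matrix.diagonal_conjTranspose]
  congr 1
  ext T
  simp

theorem parity_mul_creat (i : Mode L n) : parity L n * creat i = -(creat i * parity L n) := by
  have h := congrArg star (parity_mul_annih i)
  rw [star_neg, star_mul, star_mul, star_annih, star_parity] at h
  rw [h, neg_neg]

theorem supportedOn_mono {X Y : Set (Site L)} (h : X ⊆ Y) : supportedOn n X ≤ supportedOn n Y :=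
  Algebra.adjoin_mono fun _ ⟨i, hi, hO⟩ => ⟨i, h hi, hO⟩

/-- Moving a creation or annihilation operator past an operator supported elsewhere conjugates the
latter by the parity. -/
theorem generator_mul {X : Set (Site L)} {O : Op L n} (hO : O ∈ supportedOn n X) {i : Mode L n}
    (hi : i.1 ∉ X) {c : Op L n} (hc : c = annih i ∨ c = creat i) :
    c * O = parity L n * O * parity L n * c := by
  have hpp := parity_mul_self (L := L) (n := n)
  induction hO using Algebra.adjoin_induction with
  | mem O hO =>
    obtain ⟨j, hj, hOj⟩ := hO
    have hij : i ≠ j := fun h => hi (h ▸ hj)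
    have h1 : c * O = -(O * c) := by
      rcases hc with rfl | rfl <;> rcases hOj with rfl | rfl
      · exact annih_mul_annih hij
      · exact annih_mul_creat hij
      · exact creat_mul_annih hij
      · exact creat_mul_creat hij
    have h2 : parity L n * O = -(O * parity L n) := by
      rcases hOj with rfl | rfl
      · exact parity_mul_annih j
      · exact parity_mul_creat j
    rw [h1, h2, neg_mul, mul_assoc O, hpp, mul_one, neg_mul]
  | algebraMap r =>
    rw [← Algebra.commutes r c, mul_assoc (parity L n), Algebra.commutes r (parity L n),
      ← mul_assoc, hpp, one_mul]
  | add x y _ _ hx hy => rw [mul_add, hx, hy]; noncomm_ring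
  | mul x y _ _ hx hy =>
    calc c * (x * y) = c * x * y := by rw [mul_assoc]
      _ = parity L n * x * parity L n * (c * y) := by rw [hx, mul_assoc]
      _ = parity L n * x * (parity L n * parity L n) * y * parity L n * c := by
          rw [hy]; noncomm_ring
      _ = _ := by rw [hpp]; noncomm_ring

/-- Operators of even parity supported on `X`. -/
def IsEvenOn (X : Set (Site L)) (O : Op L n) : Prop :=
  O ∈ supportedOn n X ∧ Commute (parity L n) O

namespace IsEvenOn

theorem commute_of_disjoint {X Y : Set (Site L)} (hXY : Disjoint X Y) {O O' : Op L n}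
    (hO : IsEvenOn X O) (hO' : O' ∈ supportedOn n Y) : Commute O O' := by
  have hle : supportedOn n Y ≤ Subalgebra.centralizer ℂ {O} := by
    refine Algebra.adjoin_le ?_
    rintro c ⟨i, hi, hc⟩
    rw [SetLike.mem_coe, Subalgebra.mem_centralizer_iff]
    rintro _ rfl
    rw [generator_mul hO.1 (fun h => Set.disjoint_left.1 hXY h hi) hc, hO.2.eq, mul_assoc,
      mul_assoc, ← mul_assoc (parity L n), parity_mul_self, one_mul]
  exact (Subalgebra.mem_centralizer_iff ℂ).1 (hle hO') O rfl

theorem mono {X Y : Set (Site L)} (h : X ⊆ Y) {O : Op L n} (hO : IsEvenOn X O) : IsEvenOn Y O :=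
  ⟨supportedOn_mono h hO.1, hO.2⟩

theorem smul {X : Set (Site L)} {O : Op L n} (hO : IsEvenOn X O) (c : ℂ) : IsEvenOn X (c • O) :=
  ⟨Subalgebra.smul_mem _ hO.1 c, hO.2.smul_right c⟩

theorem add {X : Set (Site L)} {O O' : Op L n} (hO : IsEvenOn X O) (hO' : IsEvenOn X O') :
    IsEvenOn X (O + O') :=
  ⟨Subalgebra.add_mem _ hO.1 hO'.1, hO.2.add_right hO'.2⟩

theorem sum {ι : Type*} {X : Set (Site L)} {s : Finset ι} {O : ι → Op L n}
    (hO : ∀ i ∈ s, IsEvenOn X (O i)) : IsEvenOn X (∑ i ∈ s, O i) :=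
  ⟨Subalgebra.sum_mem _ fun i hi => (hO i hi).1, Commute.sum_right _ _ _ fun i hi => (hO i hi).2⟩

theorem zero (X : Set (Site L)) : IsEvenOn X (0 : Op L n) :=
  ⟨Subalgebra.zero_mem _, Commute.zero_right _⟩

end IsEvenOn

theorem isEvenOn_creat_mul_annih {X : Set (Site L)} {i j : Mode L n} (hi : i.1 ∈ X)
    (hj : j.1 ∈ X) : IsEvenOn X (creat i * annih j) := by
  refine ⟨Subalgebra.mul_mem _ (Algebra.subset_adjoin ⟨i, hi, Or.inr rfl⟩)
    (Algebra.subset_adjoin ⟨j, hj, Or.inl rfl⟩), ?_⟩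
  rw [Commute, SemiconjBy, ← mul_assoc, parity_mul_creat, neg_mul, mul_assoc, parity_mul_annih,
    mul_neg, neg_neg, mul_assoc]

/-! ### Particle numbers -/

theorem number_eq_diagonal (x : Site L) :
    number n x = Matrix.diagonal fun T => ((T.filter fun i => i.1 = x).card : ℂ) := by
  simp only [number, creat_mul_annih_self]
  ext S T
  rw [Matrix.sum_apply]
  by_cases hS : S = T
  · subst hS
    simp only [Matrix.diagonal_apply_eq]
    rw [Finset.sum_boole]
    congr 1
    refine Finset.card_bij (fun σ _ => (x, σ)) ?_ ?_ ?_
    · intro σ hσ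
      simpa using hσ
    · intro σ _ τ _ h
      exact (Prod.ext_iff.1 h).2
    · rintro ⟨y, σ⟩ h
      simp only [Finset.mem_filter] at h
      exact ⟨σ, by simp [← h.2, h.1], by simp [h.2]⟩
  · simp [Matrix.diagonal_apply_ne _ hS]

theorem potential_eq_diagonal (v : Site L → ℝ) :
    potential n v = Matrix.diagonal fun T => ((∑ i ∈ T, v i.1 : ℝ) : ℂ) := by
  simp only [potential, number_eq_diagonal, ← Matrix.diagonal_smul]
  ext S T
  rw [Matrix.sum_apply]
  by_cases hS : S = T
  · subst hS
    simp only [Matrix.diagonal_apply_eq, Pi.smul_apply, smul_eq_mul]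
    rw [← Finset.sum_fiberwise (s := S) (g := fun i => i.1)]
    push_cast
    refine Finset.sum_congr rfl fun x _ => ?_
    rw [Finset.sum_congr rfl (g := fun _ => (v x : ℂ)) fun i hi => by
      rw [(Finset.mem_filter.1 hi).2], Finset.sum_const, nsmul_eq_mul, mul_comm]
  · simp [Matrix.diagonal_apply_ne _ hS]

/-- An operator which commutes with all local particle numbers is even. -/
theorem commute_parity_of_commute_number {B : Op L n} (hB : ∀ x, Commute B (number n x)) :
    Commute (parity L n) B := by
  rw [Commute, SemiconjBy]
  ext S T
  rw [parity, Matrix.diagonal_mul, Matrix.mul_diagonal]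
  by_cases h0 : B S T = 0
  · simp [h0]
  have hcard : S.card = T.card := by
    rw [Finset.card_eq_sum_card_fiberwise (f := fun i => i.1) (t := Finset.univ)
      (fun _ _ => Finset.mem_coe.2 (Finset.mem_univ _)),
      Finset.card_eq_sum_card_fiberwise (s := T) (f := fun i => i.1) (t := Finset.univ)
      (fun _ _ => Finset.mem_coe.2 (Finset.mem_univ _))]
    refine Finset.sum_congr rfl fun x _ => ?_
    have h1 := congrFun (congrFun (hB x).eq S) T
    rw [number_eq_diagonal, Matrix.mul_diagonal, Matrix.diagonal_mul, mul_comm] at h1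
    exact_mod_cast (mul_right_cancel₀ h0 h1).symm
  rw [hcard, mul_comm]

theorem comm_potential_creat_mul_annih (v : Site L → ℝ) (i j : Mode L n) :
    comm (potential n v) (creat i * annih j) =
      ((v i.1 - v j.1 : ℝ) : ℂ) • (creat i * annih j) := by
  ext S T
  rw [comm, Matrix.sub_apply, potential_eq_diagonal, Matrix.diagonal_mul, Matrix.mul_diagonal,
    Matrix.smul_apply, smul_eq_mul, mul_annih_apply, creat_apply]
  by_cases hj : j ∈ T
  · by_cases h : i ∉ T.erase j ∧ S = insert i (T.erase j)
    · rw [if_pos hj, if_pos h]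
      have h1 : ∑ k ∈ S, v k.1 = v i.1 + ∑ k ∈ T.erase j, v k.1 := by
        rw [h.2, Finset.sum_insert h.1]
      have h2 := Finset.add_sum_erase T (fun k => v k.1) hj
      rw [h1, ← h2]
      push_cast
      ring
    · rw [if_pos hj, if_neg h]; simp
  · rw [if_neg hj]; simp

theorem comm_potential_of_commute_number {B : Op L n} (hB : ∀ x, Commute B (number n x))
    (v : Site L → ℝ) : comm (potential n v) B = 0 := by
  have h : Commute B (potential n v) := Commute.sum_right _ _ _ fun x _ => (hB x).smul_right _
  rw [comm, h.eq, sub_self]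

theorem commute_potential (v v' : Site L → ℝ) :
    Commute (potential n v) (potential n v') := by
  rw [potential_eq_diagonal, potential_eq_diagonal]
  exact Matrix.commute_diagonal _ _

/-! ### Distances on the torus -/

/-- The distance of `a` to `0` on the cycle `ZMod L`. -/
def cycDist (a : ZMod L) : ℕ := a.valMinAbs.natAbs

/-- The `ℓ¹`-distance on the torus. -/
def siteDist (x y : Site L) : ℕ := cycDist (x.1 - y.1) + cycDist (x.2 - y.2)

theorem cycDist_add_le (a b : ZMod L) : cycDist (a + b) ≤ cycDist a + cycDist b :=
  (ZMod.natAbs_valMinAbs_add_le a b).trans (Int.natAbs_add_le _ _)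

theorem cycDist_neg (a : ZMod L) : cycDist (-a) = cycDist a := ZMod.natAbs_valMinAbs_neg a

theorem cycDist_zero : cycDist (0 : ZMod L) = 0 := by simp [cycDist]

theorem cycDist_one_le : cycDist (1 : ZMod L) ≤ 1 := by
  rw [cycDist, ZMod.valMinAbs_natAbs_eq_min]
  exact (min_le_left _ _).trans (by rw [ZMod.val_one_eq_one_mod]; exact Nat.mod_le _ _)

theorem siteDist_self (x : Site L) : siteDist x x = 0 := by simp [siteDist, cycDist_zero]

theorem siteDist_comm (x y : Site L) : siteDist x y = siteDist y x := by
  rw [siteDist, siteDist, ← cycDist_neg, ← cycDist_neg (x.2 - y.2), neg_sub, neg_sub]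

theorem siteDist_triangle (x y z : Site L) : siteDist x z ≤ siteDist x y + siteDist y z := by
  have h1 := cycDist_add_le (x.1 - y.1) (y.1 - z.1)
  have h2 := cycDist_add_le (x.2 - y.2) (y.2 - z.2)
  rw [sub_add_sub_cancel] at h1 h2
  simp only [siteDist]
  omega

theorem Adj.symm {x y : Site L} (h : Adj x y) : Adj y x := by
  rcases h with ⟨h1, h2⟩ | ⟨h1, h2⟩
  · exact Or.inl ⟨h1.symm, h2.symm⟩
  · exact Or.inr ⟨h1.symm, h2.symm⟩

theorem Adj.siteDist_le {x y : Site L} (h : Adj x y) : siteDist x y ≤ 1 := by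
  have h1 := cycDist_one_le (L := L)
  have h0 := cycDist_zero (L := L)
  have hn := cycDist_neg (1 : ZMod L)
  rcases h with ⟨h1, h2 | h2⟩ | ⟨h1, h2 | h2⟩ <;> simp [siteDist, h1, h2, h0, hn] <;> assumption

theorem card_cycDist_le (ρ : ℕ) (b : ZMod L) :
    (Finset.univ.filter fun a : ZMod L => cycDist (a - b) ≤ ρ).card ≤ 2 * ρ + 1 := by
  have h : (Finset.univ.filter fun a : ZMod L => cycDist (a - b) ≤ ρ).card ≤
      (Finset.Icc (-(ρ : ℤ)) ρ).card := by
    refine Finset.card_le_card_of_injOn (fun a => (a - b).valMinAbs) ?_ ?_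
    · intro a ha
      have ha : cycDist (a - b) ≤ ρ := (Finset.mem_filter.1 ha).2
      simp only [cycDist] at ha
      refine Finset.mem_coe.2 (Finset.mem_Icc.2 ⟨?_, ?_⟩) <;> simp only <;> omega
    · intro a _ a' _ h
      exact sub_left_injective (ZMod.injective_valMinAbs h)
  refine h.trans (le_of_eq ?_)
  rw [Int.card_Icc]
  omega

/-- The closed ball of radius `ρ`. -/
def ball (x : Site L) (ρ : ℕ) : Finset (Site L) := Finset.univ.filter fun y => siteDist y x ≤ ρ

theorem mem_ball {x y : Site L} {ρ : ℕ} : y ∈ ball x ρ ↔ siteDist y x ≤ ρ := by simp [ball]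

theorem card_ball_le (x : Site L) (ρ : ℕ) : (ball x ρ).card ≤ (2 * ρ + 1) ^ 2 := by
  have h : ball x ρ ⊆ (Finset.univ.filter fun a : ZMod L => cycDist (a - x.1) ≤ ρ) ×ˢ
      (Finset.univ.filter fun a : ZMod L => cycDist (a - x.2) ≤ ρ) := by
    intro y hy
    have := mem_ball.1 hy
    simp only [siteDist] at this
    rw [Finset.mem_product, Finset.mem_filter, Finset.mem_filter]
    exact ⟨⟨Finset.mem_univ _, by omega⟩, ⟨Finset.mem_univ _, by omega⟩⟩
  calc _ ≤ _ := Finset.card_le_card h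
    _ ≤ (2 * ρ + 1) * (2 * ρ + 1) := by
      rw [Finset.card_product]
      exact Nat.mul_le_mul (card_cycDist_le _ _) (card_cycDist_le _ _)
    _ = _ := by ring

theorem disjoint_ball {x y : Site L} {ρ ρ' : ℕ} (h : ρ + ρ' < siteDist x y) :
    Disjoint (ball x ρ : Set (Site L)) (ball y ρ') := by
  rw [Set.disjoint_left]
  intro z hz hz'
  have h1 := mem_ball.1 (Finset.mem_coe.1 hz)
  have h2 := mem_ball.1 (Finset.mem_coe.1 hz')
  have h3 := siteDist_triangle x z y
  rw [siteDist_comm x z] at h3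
  omega

theorem siteDist_le_of_torusDist_le {x y : Site L} {R : ℝ} (h : torusDist x y ≤ R) :
    siteDist x y ≤ 2 * ⌈R⌉₊ := by
  have hc : ∀ a b : ℤ, Real.sqrt ((a : ℝ) ^ 2 + (b : ℝ) ^ 2) ≤ R → a.natAbs ≤ ⌈R⌉₊ := by
    intro a b hab
    have h1 : |(a : ℝ)| ≤ R := by
      refine le_trans (Real.abs_le_sqrt ?_) hab
      nlinarith [sq_nonneg (b : ℝ)]
    have h2 : ((a.natAbs : ℕ) : ℝ) ≤ ⌈R⌉₊ := by
      rw [Nat.cast_natAbs, Int.cast_abs]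
      exact h1.trans (Nat.le_ceil R)
    exact_mod_cast h2
  have h1 := hc _ _ h
  have h2 := hc (x.2 - y.2).valMinAbs (x.1 - y.1).valMinAbs (by rw [add_comm]; exact h)
  simp only [siteDist, cycDist]
  omega

/-! ### The Hamiltonian as a sum of local terms -/

/-- The hopping term from the site `y` to the site `x`. -/
def Model.bond (M : Model L n) (x y : Site L) : Op L n :=
  ∑ σ : Fin n, ∑ σ' : Fin n, M.hop (x, σ) (y, σ') • (creat (x, σ) * annih (y, σ'))

open Classical in
/-- The part of the Hamiltonian attached to the site `x`: the hopping into `x`, and a fraction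
`1 / |X|` of each interaction term `B_X` with `x ∈ X`. -/
def Model.localTerm (M : Model L n) (x : Site L) : Op L n :=
  (∑ y, if Adj x y then M.bond x y else 0) +
    ∑ X : Finset (Site L), if x ∈ X then ((X.card : ℂ)⁻¹) • M.inter X else 0

theorem Model.hamiltonian_eq_sum (M : Model L n) :
    M.hamiltonian = M.inter ∅ + ∑ x, M.localTerm x := by
  classical
  have h1 : ∀ X : Finset (Site L), X ≠ ∅ →
      ∑ x, (if x ∈ X then ((X.card : ℂ)⁻¹) • M.inter X else 0) = M.inter X := by
    intro X hX
    rw [← Finset.sum_filter, Finset.sum_const, Finset.filter_mem_eq_inter, Finset.univ_inter,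
      ← Nat.cast_smul_eq_nsmul ℂ, smul_smul, mul_inv_cancel₀, one_smul]
    exact Nat.cast_ne_zero.2 (Finset.card_ne_zero.2 (Finset.nonempty_iff_ne_empty.2 hX))
  rw [Model.hamiltonian, Model.hamiltonianWith]
  simp only [Model.localTerm, Finset.sum_add_distrib]
  rw [Finset.sum_comm (f := fun x (X : Finset (Site L)) =>
    if x ∈ X then ((X.card : ℂ)⁻¹) • M.inter X else 0),
    ← Finset.add_sum_erase _ _ (Finset.mem_univ (∅ : Finset (Site L))),
    ← Finset.add_sum_erase (Finset.univ : Finset (Finset (Site L))) (fun X => ∑ x,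
      (if x ∈ X then ((X.card : ℂ)⁻¹) • M.inter X else 0)) (Finset.mem_univ ∅)]
  rw [Finset.sum_congr rfl fun X hX => h1 X (Finset.ne_of_mem_erase hX)]
  simp only [Finset.notMem_empty, if_false, Finset.sum_const_zero, zero_add]
  simp only [Model.bond, Pi.zero_apply, Complex.ofReal_zero, mul_zero, Complex.exp_zero, mul_one]
  abel

theorem Model.isEvenOn_bond (M : Model L n) {x y : Site L} (h : Adj x y) :
    IsEvenOn (ball x 1 : Set (Site L)) (M.bond x y) := by
  refine IsEvenOn.sum fun σ _ => IsEvenOn.sum fun σ' _ => (isEvenOn_creat_mul_annih ?_ ?_).smul _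
  · exact Finset.mem_coe.2 (mem_ball.2 (by rw [siteDist_self]; exact zero_le_one))
  · exact Finset.mem_coe.2 (mem_ball.2 h.symm.siteDist_le)

/-- A radius of balls containing the supports of the local terms, for interactions of range `R`. -/
def supportRadius (R : ℝ) : ℕ := 2 * ⌈R⌉₊ + 1

/-- A bound on the norms of the local terms. -/
def localBound (n : ℕ) (R m : ℝ) : ℝ :=
  9 * (n ^ 2 * m) + 2 ^ ((2 * supportRadius R + 1) ^ 2) * m

namespace Model.IsAdmissible

variable {M : Model L n} {R m g : ℝ}

theorem bound_nonneg (h : M.IsAdmissible R m g) : 0 ≤ m :=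
  (norm_nonneg _).trans (h.inter_bound ∅)

theorem norm_bond_le (h : M.IsAdmissible R m g) {x y : Site L} (hxy : Adj x y) :
    ‖M.bond x y‖ ≤ n ^ 2 * m := by
  have hm := h.bound_nonneg
  have h1 : ∀ σ σ' : Fin n, ‖M.hop (x, σ) (y, σ') • (creat (x, σ) * annih (y, σ'))‖ ≤ m := by
    intro σ σ'
    rw [norm_smul]
    calc _ ≤ m * (1 * 1) := by
          gcongr
          · exact h.hop_bound x y hxy σ σ'
          · exact (norm_mul_le _ _).trans
              (mul_le_mul (norm_creat_le _) (norm_annih_le _) (norm_nonneg _) zero_le_one)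
      _ = m := by ring
  refine (norm_sum_le_of_le _ fun σ _ => norm_sum_le_of_le _ fun σ' _ => h1 σ σ').trans ?_
  simp only [Finset.sum_const, Finset.card_univ, Fintype.card_fin, nsmul_eq_mul]
  exact le_of_eq (by ring)

theorem subset_ball (h : M.IsAdmissible R m g) {X : Finset (Site L)} (hX : M.inter X ≠ 0)
    {x : Site L} (hx : x ∈ X) : X ⊆ ball x (supportRadius R) := by
  intro y hy
  have := siteDist_le_of_torusDist_le (h.inter_range X hX y hy x hx)
  exact mem_ball.2 (by rw [supportRadius]; omega)

theorem isEvenOn_inter (h : M.IsAdmissible R m g) (X : Finset (Site L)) :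
    IsEvenOn (X : Set (Site L)) (M.inter X) :=
  ⟨h.inter_support X, commute_parity_of_commute_number (h.inter_number X)⟩

theorem isEvenOn_localTerm (h : M.IsAdmissible R m g) (x : Site L) :
    IsEvenOn (ball x (supportRadius R) : Set (Site L)) (M.localTerm x) := by
  classical
  refine (IsEvenOn.sum fun y _ => ?_).add (IsEvenOn.sum fun X _ => ?_)
  · split_ifs with hxy
    · refine (M.isEvenOn_bond hxy).mono fun z hz => ?_
      have := mem_ball.1 (Finset.mem_coe.1 hz)
      exact Finset.mem_coe.2 (mem_ball.2 (by rw [supportRadius]; omega))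
    · exact IsEvenOn.zero _
  · split_ifs with hx
    · by_cases hX : M.inter X = 0
      · rw [hX, smul_zero]
        exact IsEvenOn.zero _
      · exact ((h.isEvenOn_inter X).mono (Finset.coe_subset.2 (h.subset_ball hX hx))).smul _
    · exact IsEvenOn.zero _

theorem norm_localTerm_le (h : M.IsAdmissible R m g) (x : Site L) :
    ‖M.localTerm x‖ ≤ localBound n R m := by
  classical
  have hm := h.bound_nonneg
  refine (norm_add_le _ _).trans (add_le_add ?_ ?_)
  · rw [← Finset.sum_filter]
    refine (norm_sum_le_of_le _ fun y hy => h.norm_bond_le (Finset.mem_filter.1 hy).2).trans ?_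
    rw [Finset.sum_const, nsmul_eq_mul]
    have h1 : (Finset.univ.filter fun y => Adj x y).card ≤ 9 := by
      refine le_trans (Finset.card_le_card fun y hy => ?_) (card_ball_le x 1)
      exact mem_ball.2 (Finset.mem_filter.1 hy).2.symm.siteDist_le
    gcongr
    exact_mod_cast h1
  · have h1 : ∑ X : Finset (Site L), (if x ∈ X then ((X.card : ℂ)⁻¹) • M.inter X else 0) =
        ∑ X ∈ (ball x (supportRadius R)).powerset,
          if x ∈ X then ((X.card : ℂ)⁻¹) • M.inter X else 0 := by
      refine (Finset.sum_subset (Finset.subset_univ _) fun X _ hX => ?_).symm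
      split_ifs with hx
      · have h0 : M.inter X = 0 := by
          by_contra h0
          exact hX (Finset.mem_powerset.2 (h.subset_ball h0 hx))
        rw [h0, smul_zero]
      · rfl
    rw [h1]
    have h2 : ∀ X ∈ (ball x (supportRadius R)).powerset,
        ‖if x ∈ X then ((X.card : ℂ)⁻¹) • M.inter X else 0‖ ≤ m := by
      intro X _
      split_ifs with hx
      · rw [norm_smul]
        have h3 : ‖(X.card : ℂ)⁻¹‖ ≤ 1 := by
          rw [norm_inv, Complex.norm_natCast]
          exact inv_le_one_of_one_le₀ (by exact_mod_cast Finset.card_pos.2 ⟨x, hx⟩)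
        calc _ ≤ 1 * m := by
              gcongr
              exact h.inter_bound X
          _ = m := one_mul m
      · rw [norm_zero]; exact hm
    refine (norm_sum_le_of_le _ h2).trans ?_
    rw [Finset.sum_const, Finset.card_powerset, nsmul_eq_mul]
    gcongr
    push_cast
    exact pow_le_pow_right₀ one_le_two (card_ball_le _ _)

end Model.IsAdmissible

/-! ### Decay of `Ω` between distant bonds -/

/-- The number of local terms that can overlap with a given one. -/
def overlapBound (R : ℝ) : ℕ := (2 * (2 * supportRadius R) + 1) ^ 2 + 1

/-- The Lieb–Robinson bound for two bonds. The first bond joins the local terms of the Hamiltonian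
as an additional observable, of coefficient zero. -/
theorem Model.IsAdmissible.norm_comm_evolve_bond_le {M : Model L n} {R m g : ℝ}
    (hM : M.IsAdmissible R m g) (hH : M.hamiltonian.IsHermitian) {x y x' y' : Site L}
    (hxy : Adj x y) (hxy' : Adj x' y') (t : ℝ) :
    ‖comm (evolve M.hamiltonian t (M.bond x y)) (M.bond x' y')‖ ≤
      2 ^ (2 * supportRadius R) * (2 * localBound n R m * ‖M.bond x' y'‖) *
        Real.exp (overlapBound R *
          (2 * localBound n R m * (1 + 2 ^ (2 * supportRadius R))) * |t|) / 2 ^ siteDist x x' := by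
  have hm := hM.bound_nonneg
  have hbM : n ^ 2 * m ≤ localBound n R m := by
    rw [localBound]
    have h1 : 0 ≤ (n : ℝ) ^ 2 * m := by positivity
    have h2 : 0 ≤ 2 ^ ((2 * supportRadius R + 1) ^ 2) * m := by positivity
    linarith
  have hρ1 : 1 ≤ supportRadius R := by rw [supportRadius]; omega
  generalize hρ : supportRadius R = ρ₀ at *
  let ctr : Option (Site L) → Site L := fun i => i.elim x id
  let a : Option (Site L) → Op L n := fun i => i.elim (M.bond x y) M.localTerm
  have hball : ∀ {z y : Site L}, Adj z y →
      IsEvenOn (ball z ρ₀ : Set (Site L)) (M.bond z y) := fun h =>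
    (M.isEvenOn_bond h).mono fun w hw => Finset.mem_coe.2
      (mem_ball.2 ((mem_ball.1 (Finset.mem_coe.1 hw)).trans hρ1))
  have heven : ∀ i, IsEvenOn (ball (ctr i) ρ₀ : Set (Site L)) (a i) := by
    rintro (_ | z)
    · exact hball hxy
    · exact hρ ▸ hM.isEvenOn_localTerm z
  have h1 : M.hamiltonian = M.inter ∅ +
      ∑ i : Option (Site L), (i.elim 0 fun _ => 1 : ℂ) • a i := by
    rw [M.hamiltonian_eq_sum, Fintype.sum_option]
    simp [a]
  have h2 : ∀ i, Commute (M.inter ∅) (a i) := fun i =>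
    (hM.isEvenOn_inter ∅).commute_of_disjoint
      (by rw [Finset.coe_empty]; exact Set.empty_disjoint _) (heven i).1
  have h3 : ∀ i : Option (Site L), ‖(i.elim 0 fun _ => 1 : ℂ)‖ ≤ 1 := by
    rintro (_ | z) <;> simp
  have h4 : ∀ i, ‖a i‖ ≤ localBound n R m := by
    rintro (_ | z)
    · exact (hM.norm_bond_le hxy).trans hbM
    · exact hM.norm_localTerm_le z
  have h5 : ∀ i j, j ∉ (Finset.univ.filter fun j => siteDist (ctr j) (ctr i) ≤ 2 * ρ₀) →
      Commute (a j) (a i) := by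
    intro i j hj
    refine (heven j).commute_of_disjoint (disjoint_ball ?_) (heven i).1
    simp only [Finset.mem_filter, Finset.mem_univ, true_and, not_le] at hj
    omega
  have h6 : ∀ i, (Finset.univ.filter fun j => siteDist (ctr j) (ctr i) ≤ 2 * ρ₀).card ≤
      overlapBound R := by
    intro i
    have h1 : (Finset.univ.filter fun j => siteDist (ctr j) (ctr i) ≤ 2 * ρ₀) ⊆
        insert none ((ball (ctr i) (2 * ρ₀)).image some) := by
      rintro (_ | z) hz
      · simp
      · simp only [Finset.mem_filter] at hz
        exact Finset.mem_insert_of_mem (Finset.mem_image_of_mem _ (mem_ball.2 hz.2))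
    refine (Finset.card_le_card h1).trans ((Finset.card_insert_le _ _).trans ?_)
    rw [overlapBound, hρ]
    exact Nat.add_le_add_right (Finset.card_image_le.trans (card_ball_le _ _)) 1
  have h7 : ∀ i, ∀ j ∈ (Finset.univ.filter fun j => siteDist (ctr j) (ctr i) ≤ 2 * ρ₀),
      siteDist (ctr i) x' ≤ siteDist (ctr j) x' + 2 * ρ₀ := by
    intro i j hj
    have h1 := (Finset.mem_filter.1 hj).2
    have h2 := siteDist_triangle (ctr i) (ctr j) x'
    rw [siteDist_comm (ctr i) (ctr j)] at h2
    omega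
  have h8 : ∀ i, 2 * ρ₀ < siteDist (ctr i) x' → Commute (a i) (M.bond x' y') := fun i hi =>
    (heven i).commute_of_disjoint (disjoint_ball (by omega)) (hball hxy').1
  exact norm_comm_evolve_le hH h1 h2 h3 h4 h5 h6 h7 h8 t none

theorem exists_norm_comm_evolve_bond_le (n : ℕ) (R m : ℝ) (hm : 0 ≤ m) (N : ℕ) :
    ∃ K : ℝ, 0 ≤ K ∧ ∀ (g : ℝ) (L : ℕ) [NeZero L] (M : Model L n), M.IsAdmissible R m g →
      M.hamiltonian.IsHermitian → ∀ x y x' y' : Site L, Adj x y → Adj x' y' → ∀ t : ℝ,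
        ‖comm (evolve M.hamiltonian t (M.bond x y)) (M.bond x' y')‖ ≤
          K / (1 + siteDist x x') ^ N * (1 + |t|) ^ N := by
  have hM0 : 0 ≤ localBound n R m := by rw [localBound]; positivity
  obtain ⟨K, hK1, hK⟩ := exists_exp_div_two_pow_le (c := overlapBound R *
    (2 * localBound n R m * (1 + 2 ^ (2 * supportRadius R)))) (by positivity) N
  have hb : 0 ≤ (n : ℝ) ^ 2 * m := by positivity
  set Q : ℝ := 2 * (n ^ 2 * m) * (n ^ 2 * m) +
    2 ^ (2 * supportRadius R) * (2 * localBound n R m * (n ^ 2 * m)) + 1 with hQ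
  have hQ1 : 0 ≤ 2 * ((n : ℝ) ^ 2 * m) * (n ^ 2 * m) := by positivity
  have hQ2 : 0 ≤ 2 ^ (2 * supportRadius R) * (2 * localBound n R m * (n ^ 2 * m)) := by positivity
  have hQ0 : 0 < Q := by linarith
  refine ⟨K * Q, by positivity, fun g L _ M hM hH x y x' y' hxy hxy' t => ?_⟩
  have hB := hM.norm_bond_le hxy'
  have hA := (norm_evolve_le hH t (M.bond x y)).trans (hM.norm_bond_le hxy)
  have hLR := hM.norm_comm_evolve_bond_le hH hxy hxy' t
  have htriv := norm_comm_le (evolve M.hamiltonian t (M.bond x y)) (M.bond x' y')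
  generalize ‖comm (evolve M.hamiltonian t (M.bond x y)) (M.bond x' y')‖ = X at *
  generalize ‖evolve M.hamiltonian t (M.bond x y)‖ = A at *
  have hB0 := norm_nonneg (M.bond x' y')
  generalize ‖M.bond x' y'‖ = B at *
  have h3 : X / Q ≤ 1 := by
    rw [div_le_one hQ0]
    have h5 : 2 * A * B ≤ 2 * (n ^ 2 * m) * (n ^ 2 * m) := by gcongr
    linarith
  have h4 := hK |t| (siteDist x x') (X / Q) (abs_nonneg t) h3 ?_
  · rw [div_le_iff₀ hQ0] at h4
    refine h4.trans (le_of_eq ?_)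
    rw [div_pow]
    ring
  · rw [div_le_iff₀ hQ0]
    refine hLR.trans ?_
    rw [div_mul_eq_mul_div, mul_comm (Real.exp _) Q]
    gcongr
    have : 2 ^ (2 * supportRadius R) * (2 * localBound n R m * B) ≤
        2 ^ (2 * supportRadius R) * (2 * localBound n R m * (n ^ 2 * m)) := by gcongr
    linarith

/-- In a gapped ground state, `Ω` of two bonds decays faster than any power of their distance. -/
theorem exists_norm_curv_bond_le (n : ℕ) (R m : ℝ) (hm : 0 ≤ m) {g : ℝ} (hg : 0 < g) (N : ℕ) :
    ∃ K : ℝ, 0 ≤ K ∧ ∀ (L : ℕ) [NeZero L] (M : Model L n), M.IsAdmissible R m g →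
      ∀ (F : EigenFrame M.hamiltonian) (x y x' y' : Site L), Adj x y → Adj x' y' →
        ‖F.curv (M.bond x y) (M.bond x' y')‖ ≤ K / (1 + siteDist x x') ^ N := by
  obtain ⟨C, hC0, hC⟩ := EigenFrame.exists_norm_curv_le hg N
  obtain ⟨K, hK0, hK⟩ := exists_norm_comm_evolve_bond_le n R m hm N
  refine ⟨C * K, by positivity, fun L _ M hM F x y x' y' hxy hxy' => ?_⟩
  rw [mul_div_assoc]
  exact hC L n M.hamiltonian F hM.gap _ _ _ fun t =>
    hK g L M hM F.isHermitian x y x' y' hxy hxy' t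

/-! ### The algebra of the two-form `Ω` -/

namespace EigenFrame

variable {H : Op L n} (F : EigenFrame H)

theorem groundExp_sub (A B : Op L n) : groundExp H (A - B) = groundExp H A - groundExp H B := by
  rw [groundExp, mul_sub, Matrix.trace_sub]; rfl

theorem groundExp_add (A B : Op L n) : groundExp H (A + B) = groundExp H A + groundExp H B := by
  rw [groundExp, mul_add, Matrix.trace_add]; rfl

theorem groundExp_smul (c : ℂ) (A : Op L n) : groundExp H (c • A) = c * groundExp H A := by
  rw [groundExp, Matrix.mul_smul, Matrix.trace_smul]; rfl

theorem groundExp_eq_of_mul_proj {A B : Op L n}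
    (h : groundProj H * A * groundProj H = groundProj H * B * groundProj H)
    (F : EigenFrame H) : groundExp H A = groundExp H B := by
  have key : ∀ X : Op L n, groundExp H X = Matrix.trace (groundProj H * X * groundProj H) := by
    intro X
    rw [Matrix.trace_mul_comm, ← mul_assoc, F.proj_mul_self]
    rfl
  rw [key, key, h]

theorem curv_add_left (A A' B : Op L n) : F.curv (A + A') B = F.curv A B + F.curv A' B := by
  simp only [curv, ← mul_add, ← groundExp_add]
  congr 2
  noncomm_ring

theorem curv_smul_left (c : ℂ) (A B : Op L n) : F.curv (c • A) B = c * F.curv A B := by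
  simp only [curv, smul_mul_assoc, mul_smul_comm, ← smul_sub, groundExp_smul]
  ring

theorem curv_swap (A B : Op L n) : F.curv B A = -F.curv A B := by
  simp only [curv, groundExp_sub]
  ring

theorem curv_add_right (A B B' : Op L n) : F.curv A (B + B') = F.curv A B + F.curv A B' := by
  rw [F.curv_swap, F.curv_add_left, F.curv_swap A B, F.curv_swap A B']
  ring

theorem curv_smul_right (c : ℂ) (A B : Op L n) : F.curv A (c • B) = c * F.curv A B := by
  rw [F.curv_swap, F.curv_smul_left, F.curv_swap A B]
  ring

theorem proj_mul_H (F : EigenFrame H) : groundProj H * H = (groundEnergy H : ℂ) • groundProj H := by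
  have h := congrArg star F.H_mul_proj
  have hH : star H = H := F.isHermitian
  rwa [star_mul, star_smul, F.star_proj, hH, Complex.star_def, Complex.conj_ofReal] at h

theorem proj_mul_comm_mul_res (V : Op L n) :
    groundProj H * comm H V * F.res = -(groundProj H * V * (1 - groundProj H)) := by
  have h1 : groundProj H * comm H V * F.res =
      groundProj H * H * V * F.res - groundProj H * V * (H * F.res) := by
    simp only [comm]; noncomm_ring
  rw [h1, F.proj_mul_H, F.H_mul_res]
  simp only [smul_mul_assoc, mul_sub, mul_add, mul_smul_comm, mul_one]
  abel

theorem res_mul_comm_mul_proj (V : Op L n) :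
    F.res * comm H V * groundProj H = (1 - groundProj H) * V * groundProj H := by
  have h1 : F.res * comm H V * groundProj H =
      F.res * H * V * groundProj H - F.res * V * (H * groundProj H) := by
    simp only [comm]; noncomm_ring
  rw [h1, F.H_mul_proj, F.res_mul_H]
  simp only [smul_mul_assoc, sub_mul, add_mul, mul_smul_comm, one_mul]
  abel

theorem curv_comm_left (V B : Op L n) :
    F.curv (comm H V) B = -(Complex.I * groundExp H (V * F.res * B + B * F.res * V)) := by
  have hPS := F.proj_mul_res
  have hSP := F.res_mul_proj
  rw [curv, ← mul_neg]
  congr 1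
  rw [← neg_one_mul, ← groundExp_smul]
  refine groundExp_eq_of_mul_proj ?_ F
  calc groundProj H * (comm H V * F.res * F.res * B - B * F.res * F.res * comm H V) * groundProj H
      = (groundProj H * comm H V * F.res) * F.res * B * groundProj H -
        groundProj H * B * F.res * (F.res * comm H V * groundProj H) := by noncomm_ring
    _ = -(groundProj H * V * F.res * B * groundProj H) +
          groundProj H * V * (groundProj H * F.res) * B * groundProj H -
        (groundProj H * B * F.res * V * groundProj H -
          groundProj H * B * (F.res * groundProj H) * V * groundProj H) := by
        rw [F.proj_mul_comm_mul_res, F.res_mul_comm_mul_proj]; noncomm_ring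
    _ = _ := by
        rw [hPS, hSP, neg_one_smul]; noncomm_ring

/-- In terms of the first-order variations of the ground state projection, `Ω` is the adiabatic
curvature. -/
theorem curv_eq_trace (A B : Op L n) :
    F.curv A B = Complex.I * Matrix.trace (groundProj H *
      (-(F.res * A * groundProj H + groundProj H * A * F.res) *
          -(F.res * B * groundProj H + groundProj H * B * F.res) -
        -(F.res * B * groundProj H + groundProj H * B * F.res) *
          -(F.res * A * groundProj H + groundProj H * A * F.res))) := by
  have key : ∀ P S A B : Op L n, S * P = 0 → P * S = 0 → P * P = P →
      Matrix.trace (P * (-(S * A * P + P * A * S) * -(S * B * P + P * B * S))) =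
        Matrix.trace (P * (A * S * S * B)) := by
    intro P S A B hSP hPS hPP
    have e1 : P * (-(S * A * P + P * A * S) * -(S * B * P + P * B * S)) =
        (P * S) * A * P * (S * B * P + P * B * S) + (P * P) * A * S * S * B * P +
          P * P * A * (S * P) * B * S := by noncomm_ring
    rw [e1, hSP, hPS, hPP]
    simp only [zero_mul, mul_zero, zero_add, add_zero]
    rw [Matrix.trace_mul_comm, show P * (P * A * S * S * B) = P * P * (A * S * S * B) by
      noncomm_ring, hPP]
  have h := fun A B => key (groundProj H) F.res A B F.res_mul_proj F.proj_mul_res F.proj_mul_self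
  rw [mul_sub (groundProj H), Matrix.trace_sub, h, h, curv, groundExp, mul_sub, Matrix.trace_sub]

/-- Static responses between commuting observables cancel. -/
theorem curv_comm_comm {V W : Op L n} (h : Commute V W) : F.curv (comm H V) (comm H W) = 0 := by
  set P := groundProj H with hP
  have e1 : groundExp H (V * F.res * comm H W) = groundExp H (V * (1 - P) * W) := by
    refine groundExp_eq_of_mul_proj ?_ F
    calc P * (V * F.res * comm H W) * P = P * V * (F.res * comm H W * P) := by noncomm_ring
      _ = _ := by rw [F.res_mul_comm_mul_proj]; noncomm_ring
  have e2 : groundExp H (comm H W * F.res * V) = -groundExp H (W * (1 - P) * V) := by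
    rw [← neg_one_mul, ← groundExp_smul]
    refine groundExp_eq_of_mul_proj ?_ F
    calc P * (comm H W * F.res * V) * P = (P * comm H W * F.res) * V * P := by noncomm_ring
      _ = _ := by rw [F.proj_mul_comm_mul_res, neg_one_smul]; noncomm_ring
  have e3 : groundExp H (V * P * W) = groundExp H (W * P * V) := by
    simp only [groundExp]
    rw [← hP, show P * (V * P * W) = P * V * (P * W) by noncomm_ring, Matrix.trace_mul_comm,
      show P * W * (P * V) = P * (W * P * V) by noncomm_ring]
  rw [F.curv_comm_left, groundExp_add, e1, e2]
  simp only [mul_sub, sub_mul, mul_one, groundExp_sub, e3, h.eq]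
  ring

end EigenFrame

/-! ### Currents of one-forms -/

namespace Model

variable (M : Model L n)

open Classical in
/-- The derivative of `H_A` at `A = 0` in the direction of the one-form `ξ`. -/
def formCurrent (ξ : OneForm L) : Op L n :=
  ∑ x, ∑ y, if Adj x y then (Complex.I * ξ x y) • M.bond x y else 0

theorem formCurrent_add (ξ η : OneForm L) :
    M.formCurrent (ξ + η) = M.formCurrent ξ + M.formCurrent η := by
  classical
  simp only [formCurrent, ← Finset.sum_add_distrib]
  refine Finset.sum_congr rfl fun x _ => Finset.sum_congr rfl fun y _ => ?_
  split_ifs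
  · rw [← add_smul, Pi.add_apply, Pi.add_apply]
    push_cast
    rw [mul_add]
  · rw [add_zero]

theorem formCurrent_smul (c : ℝ) (ξ : OneForm L) :
    M.formCurrent (c • ξ) = (c : ℂ) • M.formCurrent ξ := by
  classical
  simp only [formCurrent, Finset.smul_sum]
  refine Finset.sum_congr rfl fun x _ => Finset.sum_congr rfl fun y _ => ?_
  split_ifs
  · rw [smul_smul, Pi.smul_apply, Pi.smul_apply, smul_eq_mul]
    push_cast
    congr 1
    ring
  · rw [smul_zero]

theorem formCurrent_congr {ξ η : OneForm L} (h : ∀ x y, Adj x y → ξ x y = η x y) :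
    M.formCurrent ξ = M.formCurrent η := by
  classical
  simp only [formCurrent]
  refine Finset.sum_congr rfl fun x _ => Finset.sum_congr rfl fun y _ => ?_
  split_ifs with hxy
  · rw [h x y hxy]
  · rfl

theorem hasDerivAt_hamiltonianWith (ξ : OneForm L) :
    HasDerivAt (fun φ : ℝ => M.hamiltonianWith (φ • ξ)) (M.formCurrent ξ) 0 := by
  classical
  have hexp : ∀ (a : ℂ) (b : ℝ) (A : Op L n),
      HasDerivAt (fun φ : ℝ => (a * Complex.exp (Complex.I * ((φ * b : ℝ) : ℂ))) • A)
        ((Complex.I * b) • (a • A)) 0 := by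
    intro a b A
    have h1 : HasDerivAt (fun φ : ℝ => Complex.I * ((φ * b : ℝ) : ℂ)) (Complex.I * (b : ℂ)) 0 := by
      have h2 : HasDerivAt (fun φ : ℝ => ((φ * b : ℝ) : ℂ)) ((1 * b : ℝ) : ℂ) 0 :=
        ((hasDerivAt_id (0 : ℝ)).mul_const b).ofReal_comp
      rw [one_mul] at h2
      exact h2.const_mul _
    have h3 := ((h1.cexp).const_mul a).smul_const A
    refine h3.congr_deriv ?_
    simp only [zero_mul, Complex.ofReal_zero, mul_zero, Complex.exp_zero, one_mul, smul_smul]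
    congr 1
    ring
  unfold hamiltonianWith formCurrent
  rw [← add_zero (∑ x, ∑ y, if Adj x y then (Complex.I * (ξ x y : ℂ)) • M.bond x y else 0)]
  refine HasDerivAt.add ?_ (hasDerivAt_const _ _)
  refine HasDerivAt.fun_sum fun x _ => HasDerivAt.fun_sum fun y _ => ?_
  split_ifs with hxy
  · simp only [bond, Finset.smul_sum]
    exact HasDerivAt.fun_sum fun σ _ => HasDerivAt.fun_sum fun σ' _ => hexp _ _ _
  · exact hasDerivAt_const _ _

theorem IsAdmissible.star_bond {M : Model L n} {R m g : ℝ} (h : M.IsAdmissible R m g)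
    {x y : Site L} (hxy : Adj x y) : star (M.bond x y) = M.bond y x := by
  simp only [bond, star_sum, star_smul, star_mul, star_creat, star_annih]
  rw [Finset.sum_comm]
  refine Finset.sum_congr rfl fun σ _ => Finset.sum_congr rfl fun σ' _ => ?_
  rw [h.hop_herm x y hxy, star_star]

theorem IsAdmissible.isHermitian_hamiltonianWith {M : Model L n} {R m g : ℝ}
    (h : M.IsAdmissible R m g) {A : OneForm L} (hA : ∀ x y, Adj x y → A y x = -A x y) :
    (M.hamiltonianWith A).IsHermitian := by
  classical
  have e : M.hamiltonianWith A = (∑ x, ∑ y, if Adj x y then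
      Complex.exp (Complex.I * (A x y : ℂ)) • M.bond x y else 0) + ∑ X, M.inter X := by
    simp only [hamiltonianWith, bond, Finset.smul_sum, smul_smul, mul_comm]
  rw [e]
  refine Matrix.IsHermitian.add ?_ ?_
  · change star _ = _
    rw [star_sum, Finset.sum_comm]
    simp only [star_sum]
    refine Finset.sum_congr rfl fun x _ => ?_
    refine Finset.sum_congr rfl fun y _ => ?_
    by_cases hxy : Adj x y
    · rw [if_pos hxy, if_pos hxy.symm, star_smul, h.star_bond hxy, Complex.star_def,
        ← Complex.exp_conj, map_mul, Complex.conj_I, Complex.conj_ofReal, hA x y hxy]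
      push_cast
      rw [neg_mul, mul_neg]
    · rw [if_neg hxy, if_neg fun h' => hxy h'.symm, star_zero]
  · change star _ = _
    rw [star_sum]
    exact Finset.sum_congr rfl fun X _ => h.inter_herm X

/-- Gauge covariance: an exact form generates the commutator with a potential. -/
theorem IsAdmissible.formCurrent_extDeriv {M : Model L n} {R m g : ℝ}
    (h : M.IsAdmissible R m g) (v : Site L → ℝ) :
    M.formCurrent (extDeriv v) = Complex.I • comm M.hamiltonian (potential n v) := by
  classical
  have h1 : ∀ x y, comm (M.bond x y) (potential n v) = ((extDeriv v x y : ℝ) : ℂ) • M.bond x y := by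
    intro x y
    simp only [bond, comm_sum_left, comm_smul_left, Finset.smul_sum]
    refine Finset.sum_congr rfl fun σ _ => Finset.sum_congr rfl fun σ' _ => ?_
    have h2 := comm_potential_creat_mul_annih v (x, σ) (y, σ')
    have h3 : comm (creat (x, σ) * annih (y, σ')) (potential n v) =
        -comm (potential n v) (creat (x, σ) * annih (y, σ')) := by
      simp only [comm, neg_sub]
    rw [h3, h2, smul_comm, extDeriv, ← neg_smul]
    congr 2
    push_cast
    ring
  have h4 : M.hamiltonian = (∑ x, ∑ y, if Adj x y then M.bond x y else 0) + ∑ X, M.inter X := by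
    simp only [hamiltonian, hamiltonianWith, bond, Pi.zero_apply, Complex.ofReal_zero, mul_zero,
      Complex.exp_zero, mul_one]
  have h5 : ∀ X, comm (M.inter X) (potential n v) = 0 := by
    intro X
    have := comm_potential_of_commute_number (h.inter_number X) v
    simp only [comm] at this ⊢
    rw [← neg_sub, this, neg_zero]
  have h6 : ∀ A B C : Op L n, comm (A + B) C = comm A C + comm B C := by
    intro A B C
    simp only [comm]; noncomm_ring
  rw [h4, h6, comm_sum_left, comm_sum_left, Finset.sum_congr rfl fun X _ => h5 X,
    Finset.sum_const_zero, add_zero, Finset.smul_sum, formCurrent]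
  refine Finset.sum_congr rfl fun x _ => ?_
  rw [comm_sum_left, Finset.smul_sum]
  refine Finset.sum_congr rfl fun y _ => ?_
  split_ifs with hxy
  · rw [h1, smul_smul]
  · simp [comm]

end Model

/-! ### The two-form on one-forms -/

open Classical in
/-- The sum of the absolute values of `ξ` over the edges at `x`. -/
def edgeNorm (ξ : OneForm L) (x : Site L) : ℝ := ∑ y, if Adj x y then |ξ x y| else 0

namespace EigenFrame

variable {M : Model L n} (F : EigenFrame M.hamiltonian)

/-- `Ω` evaluated on the currents of two one-forms. -/
def formCurv : OneForm L →ₗ[ℝ] OneForm L →ₗ[ℝ] ℂ :=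
  LinearMap.mk₂ ℝ (fun ξ η => F.curv (M.formCurrent ξ) (M.formCurrent η))
    (fun ξ ξ' η => by rw [M.formCurrent_add, F.curv_add_left])
    (fun c ξ η => by rw [M.formCurrent_smul, F.curv_smul_left]; simp)
    (fun ξ η η' => by rw [M.formCurrent_add, F.curv_add_right])
    (fun c ξ η => by rw [M.formCurrent_smul, F.curv_smul_right]; simp)

theorem formCurv_apply (ξ η : OneForm L) :
    F.formCurv ξ η = F.curv (M.formCurrent ξ) (M.formCurrent η) := rfl

theorem formCurv_swap (ξ η : OneForm L) : F.formCurv η ξ = -F.formCurv ξ η := F.curv_swap _ _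

theorem formCurv_congr_left {ξ ξ' : OneForm L} (h : ∀ x y, Adj x y → ξ x y = ξ' x y)
    (η : OneForm L) : F.formCurv ξ η = F.formCurv ξ' η := by
  rw [formCurv_apply, M.formCurrent_congr h, formCurv_apply]

theorem formCurv_congr_right {η η' : OneForm L} (h : ∀ x y, Adj x y → η x y = η' x y)
    (ξ : OneForm L) : F.formCurv ξ η = F.formCurv ξ η' := by
  rw [formCurv_apply, M.formCurrent_congr h, formCurv_apply]

theorem formCurv_extDeriv_extDeriv {R m g : ℝ} (h : M.IsAdmissible R m g) (θ η : Site L → ℝ) :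
    F.formCurv (extDeriv θ) (extDeriv η) = 0 := by
  rw [formCurv_apply, h.formCurrent_extDeriv, h.formCurrent_extDeriv, F.curv_smul_left,
    F.curv_smul_right, F.curv_comm_comm (commute_potential _ _), mul_zero, mul_zero]

theorem curv_sum_left {ι : Type*} (s : Finset ι) (A : ι → Op L n) (B : Op L n) :
    F.curv (∑ i ∈ s, A i) B = ∑ i ∈ s, F.curv (A i) B := by
  classical
  induction s using Finset.induction_on with
  | empty => simpa using F.curv_smul_left 0 0 B
  | insert i s hi ih => rw [Finset.sum_insert hi, Finset.sum_insert hi, F.curv_add_left, ih]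

theorem norm_formCurv_le {f : Site L → Site L → ℝ}
    (hf : ∀ x y x' y', Adj x y → Adj x' y' → ‖F.curv (M.bond x y) (M.bond x' y')‖ ≤ f x x')
    (ξ η : OneForm L) :
    ‖F.formCurv ξ η‖ ≤ ∑ x, ∑ x', edgeNorm ξ x * edgeNorm η x' * f x x' := by
  classical
  have hstep : ∀ (B : Op L n) (c : Site L → ℝ),
      (∀ x y, Adj x y → ‖F.curv (M.bond x y) B‖ ≤ c x) → ∀ ξ : OneForm L,
        ‖F.curv (M.formCurrent ξ) B‖ ≤ ∑ x, edgeNorm ξ x * c x := by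
    intro B c hc ξ
    rw [Model.formCurrent, F.curv_sum_left]
    refine norm_sum_le_of_le _ fun x _ => ?_
    rw [F.curv_sum_left, edgeNorm, Finset.sum_mul]
    refine norm_sum_le_of_le _ fun y _ => ?_
    split_ifs with hxy
    · rw [F.curv_smul_left, norm_mul, norm_mul, Complex.norm_I, one_mul, Complex.norm_real,
        Real.norm_eq_abs]
      gcongr
      exact hc x y hxy
    · have := F.curv_smul_left 0 0 B
      rw [zero_smul, zero_mul] at this
      rw [this, norm_zero, zero_mul]
  have h1 := hstep (M.formCurrent η) (fun x => ∑ x', edgeNorm η x' * f x x') ?_ ξ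
  · refine h1.trans (le_of_eq (Finset.sum_congr rfl fun x _ => ?_))
    rw [Finset.mul_sum]
    exact Finset.sum_congr rfl fun x' _ => by ring
  · intro x y hxy
    rw [← norm_neg, ← F.curv_swap]
    refine hstep (M.bond x y) (fun x' => f x x') (fun x' y' hxy' => ?_) η
    rw [← norm_neg, ← F.curv_swap]
    exact hf x y x' y' hxy hxy'

/-- The adiabatic curvature is the value of `Ω` on the two flux forms. -/
theorem isAdiabaticCurvature {R m g : ℝ} (hg : 0 < g) (h : M.IsAdmissible R m g)
    (ξ₁ ξ₂ : OneForm L) (hξ₁ : ∀ φ, M.twist φ 0 = M.hamiltonianWith (φ • ξ₁))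
    (hξ₂ : ∀ φ, M.twist 0 φ = M.hamiltonianWith (φ • ξ₂))
    (hanti₁ : ∀ x y, Adj x y → ξ₁ y x = -ξ₁ x y) (hanti₂ : ∀ x y, Adj x y → ξ₂ y x = -ξ₂ x y) :
    M.IsAdiabaticCurvature (F.formCurv ξ₁ ξ₂) := by
  have hderiv : ∀ ξ : OneForm L, (∀ x y, Adj x y → ξ y x = -ξ x y) →
      HasDerivAt (fun φ : ℝ => groundProj (M.hamiltonianWith (φ • ξ)))
        (-(F.res * M.formCurrent ξ * groundProj M.hamiltonian +
          groundProj M.hamiltonian * M.formCurrent ξ * F.res)) 0 := by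
    intro ξ hξ
    have hK : ∀ φ : ℝ, (M.hamiltonianWith (φ • ξ)).IsHermitian := fun φ =>
      h.isHermitian_hamiltonianWith fun x y hxy => by
        simp only [Pi.smul_apply, smul_eq_mul, hξ x y hxy, mul_neg]
    have h0 : M.hamiltonianWith ((0 : ℝ) • ξ) = M.hamiltonian := by
      rw [zero_smul]; rfl
    have hgen : ∀ (H' : Op L n), M.hamiltonianWith ((0 : ℝ) • ξ) = H' → ∀ F' : EigenFrame H',
        HasGap H' g → HasDerivAt (fun φ : ℝ => groundProj (M.hamiltonianWith (φ • ξ)))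
        (-(F'.res * M.formCurrent ξ * groundProj H' +
          groundProj H' * M.formCurrent ξ * F'.res)) 0 := by
      rintro H' rfl F' hgap
      exact hasDerivAt_groundProj hK F' hg hgap (M.hasDerivAt_hamiltonianWith ξ)
    exact hgen _ h0 F h.gap
  refine ⟨_, _, by simp only [hξ₁]; exact hderiv ξ₁ hanti₁,
    by simp only [hξ₂]; exact hderiv ξ₂ hanti₂, ?_⟩
  exact F.curv_eq_trace _ _

/-- The Kubo coefficient is the value of `Ω` on the form `dv` of the drive and the form `ζ` of the
measured current. -/
theorem isKuboResponse_formCurv {R m g : ℝ} (hg : 0 < g) (h : M.IsAdmissible R m g)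
    (v : Site L → ℝ) (ζ : OneForm L) :
    IsKuboResponse M.hamiltonian (-M.formCurrent ζ) (potential n v) 0
      (F.formCurv (extDeriv v) ζ) := by
  have h1 := F.isKuboResponse_zero hg h.gap (-M.formCurrent ζ) (potential n v)
  have h2 := F.curv_comm_left (potential n v) (-M.formCurrent ζ)
  have h3 : F.formCurv (extDeriv v) ζ =
      -groundExp M.hamiltonian (potential n v * F.res * -M.formCurrent ζ +
        -M.formCurrent ζ * F.res * potential n v) := by
    have h4 := F.curv_smul_right (-1) (comm M.hamiltonian (potential n v)) (M.formCurrent ζ)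
    rw [neg_one_smul, h2] at h4
    rw [formCurv_apply, h.formCurrent_extDeriv, F.curv_smul_left]
    have hI : Complex.I * Complex.I = -1 := Complex.I_mul_I
    linear_combination Complex.I * h4 + (groundExp M.hamiltonian
      (potential n v * F.res * -M.formCurrent ζ +
        -M.formCurrent ζ * F.res * potential n v)) * hI
  rw [h3]
  exact h1

end EigenFrame

/-! ### Coordinates and cut forms -/

theorem valMinAbs_intCast {i : ℤ} (h : 2 * |i| < L) : ((i : ℤ) : ZMod L).valMinAbs = i := by
  have h1 := abs_lt.1 (show |i * 2| < L by rw [abs_mul]; norm_num; linarith)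
  exact (ZMod.valMinAbs_spec _ _).2 ⟨rfl, h1.1, h1.2.le⟩

theorem intCast_ne_zero (hL : 8 ≤ L) {i : ℤ} (hi : i ≠ 0) (h : |i| ≤ 2) :
    ((i : ℤ) : ZMod L) ≠ 0 := by
  intro h0
  have h1 := valMinAbs_intCast (L := L) (i := i) (by have : (8 : ℤ) ≤ L := by exact_mod_cast hL
                                                     linarith)
  rw [h0, ZMod.valMinAbs_zero] at h1
  exact hi h1.symm

theorem one_ne_zero_of_le (hL : 8 ≤ L) : (1 : ZMod L) ≠ 0 := by
  simpa using intCast_ne_zero hL (i := 1) (by norm_num) (by norm_num)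

theorem two_ne_zero_of_le (hL : 8 ≤ L) : (1 + 1 : ZMod L) ≠ 0 := by
  simpa [one_add_one_eq_two] using intCast_ne_zero hL (i := 2) (by norm_num) (by norm_num)

/-- `p` is one of the two coordinates of the torus. -/
def IsCoord (p : Site L → ZMod L) : Prop := p = Prod.fst ∨ p = Prod.snd

theorem IsCoord.adj {p : Site L → ZMod L} (hp : IsCoord p) {x y : Site L} (h : Adj x y) :
    p y = p x ∨ p y = p x + 1 ∨ p x = p y + 1 := by
  rcases hp with rfl | rfl
  · rcases h with ⟨h1, _⟩ | ⟨_, h2⟩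
    · exact Or.inl h1.symm
    · exact Or.inr h2
  · rcases h with ⟨_, h2⟩ | ⟨h1, _⟩
    · exact Or.inr h2
    · exact Or.inl h1.symm

theorem IsCoord.cycDist_le {p : Site L → ZMod L} (hp : IsCoord p) (x y : Site L) :
    cycDist (p x - p y) ≤ siteDist x y := by
  rcases hp with rfl | rfl <;> simp only [siteDist] <;> omega

/-- The closed form which counts the signed crossings of the line between `p = a` and
`p = a + 1`. -/
def cut (p : Site L → ZMod L) (a : ZMod L) : OneForm L := fun x y =>
  if p x = a ∧ p y = a + 1 then 1 else if p y = a ∧ p x = a + 1 then -1 else 0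

theorem abs_cut_le (p : Site L → ZMod L) (a : ZMod L) (x y : Site L) : |cut p a x y| ≤ 1 := by
  rw [cut]; split_ifs <;> simp

theorem cut_eq_zero {p : Site L → ZMod L} {a : ZMod L} {x : Site L} (h : p x ≠ a)
    (h' : p x ≠ a + 1) (y : Site L) : cut p a x y = 0 := by
  simp [cut, h, h']

theorem cut_of_eq (hL : 8 ≤ L) {p : Site L → ZMod L} (a : ZMod L) {x y : Site L} (h : p y = p x) :
    cut p a x y = 0 := by
  have h1 := one_ne_zero_of_le hL
  have h2 : ¬ (p x = a ∧ p y = a + 1) := by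
    rintro ⟨h2, h3⟩
    rw [h, h2] at h3
    exact h1 (by linear_combination -h3)
  have h3 : ¬ (p y = a ∧ p x = a + 1) := by
    rintro ⟨h3, h4⟩
    rw [← h, h3] at h4
    exact h1 (by linear_combination -h4)
  rw [cut, if_neg h2, if_neg h3]

theorem cut_of_succ (hL : 8 ≤ L) {p : Site L → ZMod L} (a : ZMod L) {x y : Site L}
    (h : p y = p x + 1) : cut p a x y = if p x = a then 1 else 0 := by
  have h3 : ¬ (p y = a ∧ p x = a + 1) := by
    rintro ⟨h3, h4⟩
    rw [h, h4] at h3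
    exact two_ne_zero_of_le hL (by linear_combination h3)
  rw [cut, if_neg h3, h]
  simp

theorem cut_of_pred (hL : 8 ≤ L) {p : Site L → ZMod L} (a : ZMod L) {x y : Site L}
    (h : p x = p y + 1) : cut p a x y = -if p y = a then 1 else 0 := by
  have h3 : ¬ (p x = a ∧ p y = a + 1) := by
    rintro ⟨h3, h4⟩
    rw [h, h4] at h3
    exact two_ne_zero_of_le hL (by linear_combination h3)
  rw [cut, if_neg h3, h]
  by_cases h5 : p y = a <;> simp [h5]

/-- Neighbouring cut forms are cohomologous. -/
theorem cut_pred (hL : 8 ≤ L) {p : Site L → ZMod L} (hp : IsCoord p) (a : ZMod L) {x y : Site L}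
    (h : Adj x y) : cut p (a - 1) x y =
      (cut p a + extDeriv fun z => if p z = a then 1 else 0) x y := by
  rw [Pi.add_apply, Pi.add_apply, extDeriv]
  rcases hp.adj h with h1 | h1 | h1
  · rw [cut_of_eq hL _ h1, cut_of_eq hL _ h1, h1]; simp
  · rw [cut_of_succ hL _ h1, cut_of_succ hL _ h1, h1]
    simp only [eq_sub_iff_add_eq]
    ring
  · rw [cut_of_pred hL _ h1, cut_of_pred hL _ h1, h1]
    simp only [eq_sub_iff_add_eq]
    ring

/-! ### Summation over the torus -/

theorem edgeNorm_nonneg (ξ : OneForm L) (x : Site L) : 0 ≤ edgeNorm ξ x := by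
  classical
  rw [edgeNorm]
  exact Finset.sum_nonneg fun y _ => by split_ifs <;> simp

theorem edgeNorm_le {ξ : OneForm L} {x : Site L} {c : ℝ} (hc : 0 ≤ c)
    (h : ∀ y, Adj x y → |ξ x y| ≤ c) : edgeNorm ξ x ≤ 9 * c := by
  classical
  rw [edgeNorm, ← Finset.sum_filter]
  refine (Finset.sum_le_card_nsmul _ _ c fun y hy => h y (Finset.mem_filter.1 hy).2).trans ?_
  rw [nsmul_eq_mul]
  have h1 : (Finset.univ.filter fun y => Adj x y).card ≤ 9 := by
    refine le_trans (Finset.card_le_card fun y hy => ?_) (card_ball_le x 1)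
    exact mem_ball.2 (Finset.mem_filter.1 hy).2.symm.siteDist_le
  gcongr
  exact_mod_cast h1

theorem edgeNorm_eq_zero {ξ : OneForm L} {x : Site L} (h : ∀ y, Adj x y → ξ x y = 0) :
    edgeNorm ξ x = 0 := by
  classical
  rw [edgeNorm]
  exact Finset.sum_eq_zero fun y _ => by
    split_ifs with hy
    · rw [h y hy, abs_zero]
    · rfl

/-- A summable weight on the cycle. -/
def cycWeight (a : ZMod L) : ℝ := ((1 + cycDist a : ℝ) ^ 2)⁻¹

/-- A bound for the total weight of the cycle which does not depend on its length. -/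
def cycSum : ℝ := ∑' j : ℤ, ((1 + j.natAbs : ℝ) ^ 2)⁻¹

theorem summable_natAbs : Summable fun j : ℤ => ((1 + j.natAbs : ℝ) ^ 2)⁻¹ := by
  have h : Summable fun j : ℕ => ((1 + j : ℝ) ^ 2)⁻¹ := by
    have h1 := (summable_nat_add_iff 1).2 (Real.summable_nat_pow_inv.2 one_lt_two)
    refine h1.congr fun j => ?_
    push_cast
    rw [add_comm]
  refine Summable.of_nat_of_neg ?_ ?_ <;> simpa using h

theorem cycWeight_nonneg (a : ZMod L) : 0 ≤ cycWeight a := by rw [cycWeight]; positivity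

theorem cycSum_nonneg : 0 ≤ cycSum := tsum_nonneg fun j => by positivity

theorem sum_cycWeight_sub_le (b : ZMod L) : ∑ a, cycWeight (a - b) ≤ cycSum := by
  have hinj : Function.Injective fun a : ZMod L => (a - b).valMinAbs :=
    ZMod.injective_valMinAbs.comp sub_left_injective
  have h := summable_natAbs.sum_le_tsum (Finset.univ.map ⟨_, hinj⟩) fun j _ => by positivity
  rw [Finset.sum_map] at h
  exact h

theorem sum_cycWeight_sub_le' (b : ZMod L) : ∑ a, cycWeight (b - a) ≤ cycSum := by
  refine le_of_eq_of_le (Finset.sum_congr rfl fun a _ => ?_) (sum_cycWeight_sub_le b)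
  rw [cycWeight, cycWeight, ← cycDist_neg, neg_sub]

/-- A summable weight on the torus. -/
def siteWeight (x x' : Site L) : ℝ := cycWeight (x.1 - x'.1) * cycWeight (x.2 - x'.2)

theorem siteWeight_nonneg (x x' : Site L) : 0 ≤ siteWeight x x' :=
  mul_nonneg (cycWeight_nonneg _) (cycWeight_nonneg _)

theorem siteWeight_comm (x x' : Site L) : siteWeight x x' = siteWeight x' x := by
  simp only [siteWeight, cycWeight]
  rw [← cycDist_neg, neg_sub, ← cycDist_neg (x.2 - x'.2), neg_sub]

theorem sum_siteWeight_le (x : Site L) (s : Finset (Site L)) :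
    ∑ x' ∈ s, siteWeight x x' ≤ cycSum ^ 2 := by
  refine (Finset.sum_le_sum_of_subset_of_nonneg (Finset.subset_univ s)
    fun x' _ _ => siteWeight_nonneg x x').trans ?_
  simp only [siteWeight, Fintype.sum_prod_type, ← Finset.mul_sum, ← Finset.sum_mul]
  rw [sq]
  exact mul_le_mul (sum_cycWeight_sub_le' _) (sum_cycWeight_sub_le' _)
    (Finset.sum_nonneg fun _ _ => cycWeight_nonneg _) cycSum_nonneg

/-- A column and a row of the torus have a total weight of order one. -/
theorem sum_siteWeight_column_row_le (A B : Finset (ZMod L)) {s t : Finset (Site L)}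
    (hs : ∀ x ∈ s, x.1 ∈ A) (ht : ∀ x ∈ t, x.2 ∈ B) :
    ∑ x ∈ s, ∑ x' ∈ t, siteWeight x x' ≤ A.card * B.card * cycSum ^ 2 := by
  have hs' : s ⊆ A ×ˢ Finset.univ := fun x hx =>
    Finset.mem_product.2 ⟨hs x hx, Finset.mem_univ _⟩
  have ht' : t ⊆ Finset.univ ×ˢ B := fun x hx =>
    Finset.mem_product.2 ⟨Finset.mem_univ _, ht x hx⟩
  calc ∑ x ∈ s, ∑ x' ∈ t, siteWeight x x'
      ≤ ∑ x ∈ A ×ˢ Finset.univ, ∑ x' ∈ Finset.univ ×ˢ B, siteWeight x x' := by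
        refine (Finset.sum_le_sum fun x _ => Finset.sum_le_sum_of_subset_of_nonneg ht'
          fun x' _ _ => siteWeight_nonneg x x').trans ?_
        exact Finset.sum_le_sum_of_subset_of_nonneg hs' fun x _ _ =>
          Finset.sum_nonneg fun x' _ => siteWeight_nonneg x x'
    _ = (∑ a ∈ A, ∑ a', cycWeight (a - a')) * ∑ b' ∈ B, ∑ b, cycWeight (b - b') := by
        simp only [siteWeight, Finset.sum_product, ← Finset.mul_sum, ← Finset.sum_mul]
        rw [Finset.sum_comm (s := B)]
    _ ≤ (A.card * cycSum) * (B.card * cycSum) := by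
        refine mul_le_mul ?_ ?_ (Finset.sum_nonneg fun _ _ => Finset.sum_nonneg fun _ _ =>
          cycWeight_nonneg _) (mul_nonneg (Nat.cast_nonneg _) cycSum_nonneg)
        · rw [← nsmul_eq_mul]
          exact Finset.sum_le_card_nsmul _ _ _ fun a _ => sum_cycWeight_sub_le' a
        · rw [← nsmul_eq_mul]
          exact Finset.sum_le_card_nsmul _ _ _ fun b _ => sum_cycWeight_sub_le b
    _ = _ := by ring

theorem div_pow_le_mul_siteWeight {K : ℝ} (hK : 0 ≤ K) {ρ : ℝ} (hρ : 0 < ρ) {x x' : Site L}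
    (h : ρ ≤ 1 + siteDist x x') (k : ℕ) :
    K / (1 + siteDist x x') ^ (k + 4) ≤ K / ρ ^ k * siteWeight x x' := by
  have h1 : (siteDist x x' : ℝ) = cycDist (x.1 - x'.1) + cycDist (x.2 - x'.2) := by
    rw [siteDist]; push_cast; ring
  rw [siteWeight, cycWeight, cycWeight, ← mul_inv, ← mul_pow, ← div_eq_mul_inv, div_div]
  set a : ℝ := (cycDist (x.1 - x'.1) : ℝ)
  set b : ℝ := (cycDist (x.2 - x'.2) : ℝ)
  have ha : 0 ≤ a := Nat.cast_nonneg _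
  have hb : 0 ≤ b := Nat.cast_nonneg _
  refine div_le_div_of_nonneg_left hK (by positivity) ?_
  rw [pow_add]
  refine mul_le_mul (pow_le_pow_left₀ hρ.le h k) ?_ (by positivity) (by positivity)
  rw [show 4 = 2 * 2 from rfl, pow_mul]
  refine pow_le_pow_left₀ (by positivity) ?_ 2
  rw [h1]
  nlinarith

namespace EigenFrame

variable {M : Model L n} (F : EigenFrame M.hamiltonian)

/-- `Ω` decays with the power `N` of the distance of two bonds. -/
def HasDecay (K : ℝ) (N : ℕ) : Prop :=
  ∀ x y x' y', Adj x y → Adj x' y' →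
    ‖F.curv (M.bond x y) (M.bond x' y')‖ ≤ K / (1 + siteDist x x') ^ N

variable {F}

/-- The basic locality estimate for two one-forms supported at distance `ρ` of each other. Each site
has at most nine neighbours, whence `81 = 9²`; four powers of the decay are spent on the summable
weight. -/
theorem HasDecay.norm_formCurv_le {K : ℝ} {k : ℕ} (hF : F.HasDecay K (k + 4)) (hK : 0 ≤ K)
    {ρ : ℝ} (hρ : 0 < ρ) {ξ η : OneForm L} {s t : Finset (Site L)} {c c' S : ℝ} (hc : 0 ≤ c)
    (hc' : 0 ≤ c') (hξ : ∀ x y, Adj x y → |ξ x y| ≤ c) (hη : ∀ x y, Adj x y → |η x y| ≤ c')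
    (hs : ∀ x ∉ s, ∀ y, Adj x y → ξ x y = 0) (ht : ∀ x ∉ t, ∀ y, Adj x y → η x y = 0)
    (hdist : ∀ x ∈ s, ∀ x' ∈ t, ρ ≤ 1 + siteDist x x')
    (hS : ∑ x ∈ s, ∑ x' ∈ t, siteWeight x x' ≤ S) :
    ‖F.formCurv ξ η‖ ≤ 81 * c * c' * (K / ρ ^ k) * S := by
  refine (F.norm_formCurv_le (f := fun x x' => K / (1 + siteDist x x') ^ (k + 4)) hF ξ η).trans ?_
  have h1 : ∑ x, ∑ x', edgeNorm ξ x * edgeNorm η x' * (K / (1 + siteDist x x') ^ (k + 4)) =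
      ∑ x ∈ s, ∑ x' ∈ t, edgeNorm ξ x * edgeNorm η x' * (K / (1 + siteDist x x') ^ (k + 4)) := by
    rw [← Finset.sum_subset (Finset.subset_univ s) fun x _ hx => ?_]
    · refine Finset.sum_congr rfl fun x _ => ?_
      refine (Finset.sum_subset (Finset.subset_univ t) fun x' _ hx' => ?_).symm
      rw [edgeNorm_eq_zero (ht x' hx'), mul_zero, zero_mul]
    · rw [edgeNorm_eq_zero (hs x hx)]
      simp
  rw [h1]
  calc _ ≤ ∑ x ∈ s, ∑ x' ∈ t, (81 * c * c' * (K / ρ ^ k)) * siteWeight x x' := by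
        refine Finset.sum_le_sum fun x hx => Finset.sum_le_sum fun x' hx' => ?_
        have h2 := edgeNorm_le hc (hξ x)
        have h3 := edgeNorm_le hc' (hη x')
        have h4 := div_pow_le_mul_siteWeight hK hρ (hdist x hx x' hx') k
        calc _ ≤ (9 * c) * (9 * c') * (K / ρ ^ k * siteWeight x x') := by
              refine mul_le_mul (mul_le_mul h2 h3 (edgeNorm_nonneg _ _) (by positivity)) h4
                (by positivity) (by positivity)
          _ = _ := by ring
    _ = (81 * c * c' * (K / ρ ^ k)) * ∑ x ∈ s, ∑ x' ∈ t, siteWeight x x' := by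
        simp only [Finset.mul_sum]
    _ ≤ _ := by gcongr

/-! ### Moving the cuts -/

theorem eq_of_forall_sub_one {α : Type*} {f : ZMod L → α} (h : ∀ a, f (a - 1) = f a)
    (a b : ZMod L) : f a = f b := by
  have h1 : ∀ j : ℕ, f (a + j) = f a := by
    intro j
    induction j with
    | zero => simp
    | succ j ih =>
      rw [← ih, ← h (a + ((j + 1 : ℕ) : ZMod L))]
      congr 1
      push_cast
      ring
  have h2 := h1 (b - a).val
  rw [ZMod.natCast_zmod_val, add_sub_cancel] at h2
  exact h2.symm

theorem norm_sub_le_of_forall_sub_one {f : ZMod L → ℂ} {ε : ℝ}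
    (h : ∀ a, ‖f (a - 1) - f a‖ ≤ ε) (a b : ZMod L) : ‖f a - f b‖ ≤ L * ε := by
  have hε : 0 ≤ ε := (norm_nonneg _).trans (h 0)
  have h1 : ∀ j : ℕ, ‖f a - f (a + j)‖ ≤ j * ε := by
    intro j
    induction j with
    | zero => simp
    | succ j ih =>
      have h2 := h (a + ((j + 1 : ℕ) : ZMod L))
      rw [show a + ((j + 1 : ℕ) : ZMod L) - 1 = a + j by push_cast; ring] at h2
      have h3 := norm_sub_le_norm_sub_add_norm_sub (f a) (f (a + j))
        (f (a + ((j + 1 : ℕ) : ZMod L)))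
      push_cast at *
      linarith
  have h2 := h1 (b - a).val
  rw [ZMod.natCast_zmod_val, add_sub_cancel] at h2
  refine h2.trans ?_
  gcongr
  exact (ZMod.val_lt _).le

/-- A cut may be moved freely when it is paired with an exact form. -/
theorem formCurv_extDeriv_cut (hL : 8 ≤ L) {R m g : ℝ} (h : M.IsAdmissible R m g)
    {q : Site L → ZMod L} (hq : IsCoord q) (θ : Site L → ℝ) (b b' : ZMod L) :
    F.formCurv (extDeriv θ) (cut q b) = F.formCurv (extDeriv θ) (cut q b') := by
  refine eq_of_forall_sub_one (f := fun b => F.formCurv (extDeriv θ) (cut q b)) (fun a => ?_) b b'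
  rw [F.formCurv_congr_right (fun x y hxy => cut_pred hL hq a hxy), map_add,
    F.formCurv_extDeriv_extDeriv h, add_zero]

/-- A local charge does not respond to a flux: the cut can be moved to the other side of the
torus. -/
theorem HasDecay.norm_formCurv_single_cut_le (hL : 8 ≤ L) (hLe : Even L) {R m g : ℝ}
    (h : M.IsAdmissible R m g) {K : ℝ} {k : ℕ} (hF : F.HasDecay K (k + 4)) (hK : 0 ≤ K)
    {q : Site L → ZMod L} (hq : IsCoord q) (z : Site L) (b : ZMod L) :
    ‖F.formCurv (extDeriv (Pi.single z 1)) (cut q b)‖ ≤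
      81 * (K / (L / 4 : ℝ) ^ k) * (9 * cycSum ^ 2) := by
  obtain ⟨l, hl⟩ := hLe
  have hL0 : (0 : ℝ) < L := by exact_mod_cast (by omega : 0 < L)
  -- Move the cut to the antipode of `z`.
  rw [formCurv_extDeriv_cut hL h hq _ b (q z + (l : ZMod L))]
  have hcl : cycDist (l : ZMod L) = l := by
    rw [cycDist, ZMod.valMinAbs_natCast_of_le_half (by omega)]
    rfl
  have hmain := hF.norm_formCurv_le hK (ρ := (L / 4 : ℝ)) (by positivity)
    (ξ := extDeriv (Pi.single z 1)) (η := cut q (q z + (l : ZMod L))) (s := ball z 1)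
    (t := Finset.univ.filter fun x => q x = q z + l ∨ q x = q z + l + 1) (c := 1) (c' := 1)
    (S := 9 * cycSum ^ 2) zero_le_one zero_le_one ?_ (fun x y _ => abs_cut_le _ _ _ _) ?_ ?_ ?_ ?_
  · simpa using hmain
  · intro x y _
    rw [extDeriv, Pi.single_apply, Pi.single_apply]
    split_ifs <;> simp
  · intro x hx y hxy
    have h1 : x ≠ z := by
      rintro rfl
      exact hx (mem_ball.2 (by rw [siteDist_self]; exact zero_le_one))
    have h2 : y ≠ z := by
      rintro rfl
      exact hx (mem_ball.2 hxy.siteDist_le)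
    rw [extDeriv, Pi.single_eq_of_ne h1, Pi.single_eq_of_ne h2, sub_zero]
  · intro x hx y _
    simp only [Finset.mem_filter, Finset.mem_univ, true_and, not_or] at hx
    exact cut_eq_zero hx.1 hx.2 y
  · intro x hx x' hx'
    have h1 := mem_ball.1 hx
    have h2 := (Finset.mem_filter.1 hx').2
    have h3 := siteDist_triangle x' x z
    have h4 := hq.cycDist_le x' z
    have h5 : l ≤ cycDist (q x' - q z) + 1 := by
      rcases h2 with h2 | h2
      · rw [h2, add_sub_cancel_left, hcl]; omega
      · have h6 := cycDist_add_le (q x' - q z) (-1)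
        rw [h2, show q z + (l : ZMod L) + 1 - q z + -1 = (l : ZMod L) by ring, hcl,
          cycDist_neg] at h6
        have h7 := cycDist_one_le (L := L)
        rw [h2]
        omega
    rw [siteDist_comm x' x] at h3
    have h8 : l ≤ siteDist x x' + 2 := by omega
    have h9 : L ≤ 4 * (1 + siteDist x x') := by omega
    have h10 : (L : ℝ) ≤ 4 * (1 + siteDist x x') := by exact_mod_cast h9
    linarith
  · refine (Finset.sum_le_card_nsmul _ _ _ fun x _ => sum_siteWeight_le x _).trans ?_
    rw [nsmul_eq_mul]
    have h1 := card_ball_le z 1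
    gcongr
    exact_mod_cast h1

/-- Three powers of the decay pay for at most `L` steps of the cut, each of which moves at most `L²`
charges. -/
theorem HasDecay.norm_formCurv_cut_sub_left_le (hL : 8 ≤ L) (hLe : Even L) {R m g : ℝ}
    (h : M.IsAdmissible R m g) {K : ℝ} {k : ℕ} (hF : F.HasDecay K (k + 3 + 4)) (hK : 0 ≤ K)
    {p q : Site L → ZMod L} (hp : IsCoord p) (hq : IsCoord q) (a a' b : ZMod L) :
    ‖F.formCurv (cut p a) (cut q b) - F.formCurv (cut p a') (cut q b)‖ ≤
      81 * 4 ^ (k + 3) * 9 * cycSum ^ 2 * K / L ^ k := by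
  classical
  have hL0 : (0 : ℝ) < L := by exact_mod_cast (by omega : 0 < L)
  set ε : ℝ := 81 * (K / (L / 4 : ℝ) ^ (k + 3)) * (9 * cycSum ^ 2) with hε
  have hε0 : 0 ≤ ε := by
    have := cycSum_nonneg
    positivity
  have hstep : ∀ a, ‖F.formCurv (cut p (a - 1)) (cut q b) - F.formCurv (cut p a) (cut q b)‖ ≤
      L ^ 2 * ε := by
    intro a
    have h1 : (extDeriv fun z => if p z = a then (1 : ℝ) else 0) =
        ∑ z ∈ Finset.univ.filter (fun z => p z = a), extDeriv (Pi.single z (1 : ℝ)) := by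
      funext x y
      rw [Finset.sum_apply, Finset.sum_apply]
      simp only [extDeriv, Finset.sum_sub_distrib, Pi.single_apply]
      simp [Finset.sum_ite_eq]
    rw [F.formCurv_congr_left (fun x y hxy => cut_pred hL hp a hxy), map_add,
      LinearMap.add_apply, add_sub_cancel_left, h1, map_sum, LinearMap.sum_apply]
    refine (norm_sum_le_of_le _ fun z _ =>
      hF.norm_formCurv_single_cut_le hL hLe h hK hq z b).trans ?_
    rw [Finset.sum_const, nsmul_eq_mul]
    have h2 : (Finset.univ.filter (fun z => p z = a)).card ≤ L ^ 2 := by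
      refine (Finset.card_filter_le _ _).trans (le_of_eq ?_)
      rw [Finset.card_univ, Fintype.card_prod, ZMod.card, sq]
    gcongr
    exact_mod_cast h2
  refine (norm_sub_le_of_forall_sub_one (f := fun a => F.formCurv (cut p a) (cut q b))
    hstep a a').trans (le_of_eq ?_)
  rw [hε, div_pow, pow_add (L : ℝ)]
  field_simp

/-- `Ω` of two cuts hardly depends on their positions. -/
theorem HasDecay.norm_formCurv_cut_sub_le (hL : 8 ≤ L) (hLe : Even L) {R m g : ℝ}
    (h : M.IsAdmissible R m g) {K : ℝ} {k : ℕ} (hF : F.HasDecay K (k + 3 + 4)) (hK : 0 ≤ K)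
    {p q : Site L → ZMod L} (hp : IsCoord p) (hq : IsCoord q) (a a' b b' : ZMod L) :
    ‖F.formCurv (cut p a) (cut q b) - F.formCurv (cut p a') (cut q b')‖ ≤
      2 * (81 * 4 ^ (k + 3) * 9 * cycSum ^ 2 * K) / L ^ k := by
  have h1 := hF.norm_formCurv_cut_sub_left_le hL hLe h hK hp hq a a' b
  have h2 := hF.norm_formCurv_cut_sub_left_le hL hLe h hK hq hp b b' a'
  have h3 := norm_sub_le_norm_sub_add_norm_sub (F.formCurv (cut p a) (cut q b))
    (F.formCurv (cut p a') (cut q b)) (F.formCurv (cut p a') (cut q b'))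
  rw [F.formCurv_swap (cut p a') (cut q b), F.formCurv_swap (cut p a') (cut q b'), neg_sub_neg,
    norm_sub_rev] at h2
  rw [mul_div_assoc]
  linarith

end EigenFrame

/-! ### Uniform flux forms as averages of cuts -/

theorem valMinAbs_one (hL : 8 ≤ L) : (1 : ZMod L).valMinAbs = 1 := by
  have h := valMinAbs_intCast (L := L) (i := 1) (by
    have : (8 : ℤ) ≤ L := by exact_mod_cast hL
    simp only [abs_one]; linarith)
  simpa using h

theorem valMinAbs_neg_one (hL : 8 ≤ L) : (-1 : ZMod L).valMinAbs = -1 := by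
  have h := valMinAbs_intCast (L := L) (i := -1) (by
    have : (8 : ℤ) ≤ L := by exact_mod_cast hL
    simp only [abs_neg, abs_one]; linarith)
  simpa using h

/-- The form `dp` of a coordinate `p` is the sum of all cut forms. -/
theorem sum_cut (hL : 8 ≤ L) {p : Site L → ZMod L} (hp : IsCoord p) {x y : Site L}
    (h : Adj x y) : ∑ a, cut p a x y = ((p y - p x).valMinAbs : ℝ) := by
  rcases hp.adj h with h1 | h1 | h1
  · simp only [cut_of_eq hL _ h1, h1, Finset.sum_const_zero, sub_self, ZMod.valMinAbs_zero,
      Int.cast_zero]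
  · simp only [cut_of_succ hL _ h1, h1, add_sub_cancel_left, valMinAbs_one hL]
    simp
  · simp only [cut_of_pred hL _ h1, Finset.sum_neg_distrib]
    rw [h1, show p y - (p y + 1) = -1 by ring, valMinAbs_neg_one hL]
    simp

theorem sum_cut_swap (hL : 8 ≤ L) {p : Site L → ZMod L} (hp : IsCoord p) {x y : Site L}
    (h : Adj x y) : ((p x - p y).valMinAbs : ℝ) = -((p y - p x).valMinAbs : ℝ) := by
  rcases hp.adj h with h1 | h1 | h1
  · simp [h1]
  · rw [h1, show p x - (p x + 1) = -1 by ring, add_sub_cancel_left, valMinAbs_one hL,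
      valMinAbs_neg_one hL]
    simp
  · rw [h1, show p y - (p y + 1) = -1 by ring, add_sub_cancel_left, valMinAbs_one hL,
      valMinAbs_neg_one hL]
    simp

theorem norm_average_sub_le {ι : Type*} {s : Finset ι} {f : ι → ℂ} {c : ℂ} {ε r : ℝ}
    (hr : r = s.card) (hs : s.Nonempty) (h : ∀ i ∈ s, ‖f i - c‖ ≤ ε) :
    ‖(r⁻¹ : ℝ) • ∑ i ∈ s, f i - c‖ ≤ ε := by
  have hc : 0 < r := by rw [hr]; exact_mod_cast hs.card_pos
  have e : (r⁻¹ : ℝ) • ∑ i ∈ s, f i - c = (r⁻¹ : ℝ) • ∑ i ∈ s, (f i - c) := by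
    rw [Finset.sum_sub_distrib, smul_sub, Finset.sum_const, ← Nat.cast_smul_eq_nsmul ℝ, ← hr,
      smul_smul, inv_mul_cancel₀ hc.ne', one_smul]
  rw [e, norm_smul, Real.norm_of_nonneg (by positivity), inv_mul_le_iff₀ hc, hr, ← nsmul_eq_mul]
  exact (norm_sum_le _ _).trans (Finset.sum_le_card_nsmul _ _ _ h)

/-! ### Strips -/

theorem mem_strip {a b : ℕ} {x : Site L} :
    x ∈ strip L a b ↔ a ≤ cycDist x.1 ∧ cycDist x.1 ≤ b := by
  simp only [strip, Set.mem_ofPred_eq, cycDist, Int.abs_eq_natAbs]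
  omega

/-- The form `(2ℓ)⁻¹ dx₁` restricted to the strip `|x₁| ≤ ℓ`, as an average of cuts. -/
def stripForm (L ℓ : ℕ) : OneForm L :=
  ((2 * ℓ : ℝ)⁻¹) • ∑ a ∈ Finset.Ico (-(ℓ : ℤ)) ℓ, cut Prod.fst (a : ZMod L)

theorem sum_ite_intCast {s : Finset ℤ} (hs : ∀ a ∈ s, 2 * |a| < L) (z : ZMod L) (c : ℝ) :
    ∑ a ∈ s, (if z = (a : ZMod L) then c else 0) = if z.valMinAbs ∈ s then c else 0 := by
  rw [← Finset.sum_ite_eq' s z.valMinAbs (fun _ => c)]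
  refine Finset.sum_congr rfl fun a ha => ?_
  have h : z = (a : ZMod L) ↔ a = z.valMinAbs := by
    constructor
    · rintro rfl
      exact (valMinAbs_intCast (hs a ha)).symm
    · rintro rfl
      exact (ZMod.coe_valMinAbs z).symm
  simp only [h]

theorem valMinAbs_add_one {z : ZMod L} (h : 2 * (cycDist z + 1) < L) :
    (z + 1).valMinAbs = z.valMinAbs + 1 := by
  have h1 : z + 1 = ((z.valMinAbs + 1 : ℤ) : ZMod L) := by
    simp
  conv_lhs => rw [h1]
  refine valMinAbs_intCast ?_
  simp only [cycDist] at h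
  rw [Int.abs_eq_natAbs]
  omega

theorem stripForm_apply (ℓ : ℕ) (x y : Site L) :
    stripForm L ℓ x y =
      (2 * ℓ : ℝ)⁻¹ * ∑ a ∈ Finset.Ico (-(ℓ : ℤ)) ℓ, cut Prod.fst (a : ZMod L) x y := by
  rw [stripForm, Pi.smul_apply, Pi.smul_apply, Finset.sum_apply, Finset.sum_apply, smul_eq_mul]

theorem stripForm_of_le (hL : 8 ≤ L) {ℓ : ℕ} (hℓ : 2 * (ℓ + 2) < L) {x y : Site L}
    (h : Adj x y) (hx : cycDist x.1 ≤ ℓ) (hy : cycDist y.1 ≤ ℓ) :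
    stripForm L ℓ x y = (2 * ℓ : ℝ)⁻¹ * dx₁ L x y := by
  have hs : ∀ a ∈ Finset.Ico (-(ℓ : ℤ)) ℓ, 2 * |a| < L := by
    intro a ha
    rw [Finset.mem_Ico] at ha
    rw [Int.abs_eq_natAbs]
    omega
  rw [stripForm_apply, dx₁]
  congr 1
  rcases IsCoord.adj (p := Prod.fst) (Or.inl rfl) h with h1 | h1 | h1
  · simp only [cut_of_eq hL _ h1, h1, Finset.sum_const_zero, sub_self, ZMod.valMinAbs_zero,
      Int.cast_zero]
  · have h2 := valMinAbs_add_one (z := x.1) (by omega)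
    simp only [cut_of_succ hL _ h1]
    rw [sum_ite_intCast hs, if_pos, h1, add_sub_cancel_left, valMinAbs_one hL, Int.cast_one]
    rw [← h1] at h2
    simp only [cycDist] at hx hy
    rw [Finset.mem_Ico]
    omega
  · have h2 := valMinAbs_add_one (z := y.1) (by omega)
    simp only [cut_of_pred hL _ h1, Finset.sum_neg_distrib]
    rw [sum_ite_intCast hs, if_pos, h1, show y.1 - (y.1 + 1) = -1 by ring, valMinAbs_neg_one hL]
    · simp
    · rw [← h1] at h2
      simp only [cycDist] at hx hy
      rw [Finset.mem_Ico]
      omega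

theorem stripForm_of_ge {ℓ : ℕ} (hℓ : 2 * (ℓ + 2) < L) {x y : Site L}
    (hx : ℓ ≤ cycDist x.1) (hy : ℓ ≤ cycDist y.1) :
    stripForm L ℓ x y = 0 := by
  have key : ∀ (a : ℤ) (z : ZMod L), a ∈ Finset.Ico (-(ℓ : ℤ)) ℓ → ℓ ≤ cycDist (a : ZMod L) →
      ¬ ℓ ≤ cycDist ((a : ZMod L) + 1) := by
    intro a z ha h1 h2
    rw [Finset.mem_Ico] at ha
    have h3 := valMinAbs_intCast (L := L) (i := a) (by rw [Int.abs_eq_natAbs]; omega)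
    have h4 := valMinAbs_intCast (L := L) (i := a + 1) (by rw [Int.abs_eq_natAbs]; omega)
    push_cast at h4
    simp only [cycDist, h3, h4] at h1 h2
    omega
  rw [stripForm_apply, Finset.sum_eq_zero, mul_zero]
  intro a ha
  have h1 : ¬ (x.1 = (a : ZMod L) ∧ y.1 = (a : ZMod L) + 1) := by
    rintro ⟨h1, h2⟩
    exact key a 0 ha (h1 ▸ hx) (h2 ▸ hy)
  have h2 : ¬ (y.1 = (a : ZMod L) ∧ x.1 = (a : ZMod L) + 1) := by
    rintro ⟨h1, h2⟩
    exact key a 0 ha (h1 ▸ hy) (h2 ▸ hx)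
  rw [cut, if_neg h1, if_neg h2]

/-- Of the two ends of an edge that starts in `|x₁| < b`, either both lie in `|x₁| ≤ ℓ`, or both in
`ℓ ≤ |x₁| ≤ b`. -/
theorem strip_dichotomy {ℓ b : ℕ} {x y : Site L} (h : Adj x y) (hb : cycDist x.1 < b) :
    (x ∈ strip L 0 ℓ ∧ y ∈ strip L 0 ℓ) ∨ (x ∈ strip L ℓ b ∧ y ∈ strip L ℓ b) := by
  have h0 := h.siteDist_le
  have h1 : cycDist (x.1 - y.1) ≤ 1 := by simp only [siteDist] at h0; omega
  have h2 := cycDist_add_le (x.1 - y.1) y.1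
  have h3 := cycDist_add_le (y.1 - x.1) x.1
  rw [← cycDist_neg, neg_sub] at h1
  have h1' := h1
  rw [← cycDist_neg, neg_sub] at h1'
  rw [sub_add_cancel] at h2 h3
  simp only [mem_strip]
  omega

/-! ### The current through a dual path -/

/-- The form supported on the edge `{p, q}`, of value one on the orientation `(p, q)`. -/
def edgeForm (p q : Site L) : OneForm L := fun x y =>
  if x = p ∧ y = q then 1 else if x = q ∧ y = p then -1 else 0

theorem Model.formCurrent_edgeForm (M : Model L n) {p q : Site L} (h : Adj p q) (hpq : p ≠ q) :
    M.formCurrent (edgeForm p q) = Complex.I • (M.bond p q - M.bond q p) := by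
  classical
  have e : ∀ x y, (if Adj x y then (Complex.I * (edgeForm p q x y : ℂ)) • M.bond x y else 0) =
      (if x = p then if y = q then Complex.I • M.bond p q else 0 else 0) +
        (if x = q then if y = p then -(Complex.I • M.bond q p) else 0 else 0) := by
    intro x y
    rw [edgeForm]
    by_cases h1 : x = p ∧ y = q
    · obtain ⟨rfl, rfl⟩ := h1
      simp [h, hpq]
    · by_cases h2 : x = q ∧ y = p
      · obtain ⟨rfl, rfl⟩ := h2
        simp [h.symm, hpq, hpq.symm]
      · rw [if_neg h1, if_neg h2, ← ite_and, ← ite_and, if_neg h1, if_neg h2]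
        simp
  simp only [formCurrent, e, Finset.sum_add_distrib, Finset.sum_ite_irrel, Finset.sum_const_zero,
    Finset.sum_ite_eq', Finset.mem_univ, if_true]
  rw [smul_sub, sub_eq_add_neg]

/-- The form dual to the path `γ_d`: it is `1` on the bonds crossed by the path, oriented from right
to left. -/
def pathForm (L d : ℕ) : OneForm L :=
  ∑ a ∈ Finset.Ioc (-(d : ℤ)) d, edgeForm ((a : ZMod L), 0) ((a : ZMod L), 1)

theorem Model.pathCurrent_eq (hL : 8 ≤ L) (M : Model L n) (d : ℕ) :
    M.pathCurrent d = -M.formCurrent (pathForm L d) := by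
  have h0 : M.formCurrent 0 = 0 := by simpa using M.formCurrent_smul 0 0
  let Φ : OneForm L →+ Op L n := ⟨⟨M.formCurrent, h0⟩, M.formCurrent_add⟩
  have h1 : M.formCurrent (pathForm L d) = ∑ a ∈ Finset.Ioc (-(d : ℤ)) d,
      M.formCurrent (edgeForm ((a : ZMod L), 0) ((a : ZMod L), 1)) := map_sum Φ _ _
  rw [h1, pathCurrent, ← Finset.sum_neg_distrib]
  refine Finset.sum_congr rfl fun a _ => ?_
  have h10 := one_ne_zero_of_le hL
  rw [M.formCurrent_edgeForm (p := ((a : ZMod L), 0)) (q := ((a : ZMod L), 1))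
    (Or.inl ⟨rfl, Or.inl (by simp)⟩) (by simp [h10.symm]), edgeCurrent, ← neg_smul]
  congr 1
  simp only [Finset.sum_sub_distrib, bond]
  rw [Finset.sum_comm (f := fun (σ σ' : Fin n) =>
    M.hop (((a : ZMod L), 1), σ') (((a : ZMod L), 0), σ) •
      (creat (((a : ZMod L), 1), σ') * annih (((a : ZMod L), 0), σ)))]

theorem pathForm_apply (hL : 8 ≤ L) {d : ℕ} (hd : 2 * d < L) {x y : Site L} (h : Adj x y) :
    pathForm L d x y =
      if x.1.valMinAbs ∈ Finset.Ioc (-(d : ℤ)) d then cut Prod.snd 0 x y else 0 := by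
  have hs : ∀ a ∈ Finset.Ioc (-(d : ℤ)) d, 2 * |a| < L := by
    intro a ha
    rw [Finset.mem_Ioc] at ha
    rw [Int.abs_eq_natAbs]
    omega
  rw [← sum_ite_intCast hs, pathForm, Finset.sum_apply, Finset.sum_apply]
  refine Finset.sum_congr rfl fun a _ => ?_
  obtain ⟨x₁, x₂⟩ := x
  obtain ⟨y₁, y₂⟩ := y
  have h10 := one_ne_zero_of_le hL
  simp only [edgeForm, cut, Prod.mk.injEq, zero_add]
  rcases h with ⟨h1, _⟩ | ⟨h1, _⟩
  · simp only at h1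
    subst h1
    by_cases h2 : x₁ = (a : ZMod L) <;> simp [h2, and_comm]
  · simp only at h1
    subst h1
    have h2 : ¬ (x₂ = 0 ∧ x₂ = 1) := fun ⟨h3, h4⟩ => h10 (h4.symm.trans h3)
    have h3 : ¬ ((x₁ = (a : ZMod L) ∧ x₂ = 0) ∧ y₁ = (a : ZMod L) ∧ x₂ = 1) := fun h =>
      h2 ⟨h.1.2, h.2.2⟩
    have h4 : ¬ ((x₁ = (a : ZMod L) ∧ x₂ = 1) ∧ y₁ = (a : ZMod L) ∧ x₂ = 0) := fun h =>
      h2 ⟨h.2.2, h.1.2⟩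
    rw [if_neg h3, if_neg h4, if_neg h2, if_neg h2]
    simp

/-! ### The potential -/

theorem potential_drop {ℓ : ℕ} (hL : 8 ≤ L) (hℓ : 2 * (ℓ + 2) < L) {v : Site L → ℝ} {E : ℝ}
    (hv : ∀ x ∈ strip L 0 ℓ, ∀ y ∈ strip L 0 ℓ, Adj x y → extDeriv v x y = E * dx₁ L x y) :
    v ((ℓ : ZMod L), 0) - v (-(ℓ : ZMod L), 0) = 2 * ℓ * E := by
  have h1 : ∀ j : ℕ, j ≤ 2 * ℓ →
      v (-(ℓ : ZMod L) + j, 0) - v (-(ℓ : ZMod L), 0) = j * E := by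
    intro j hj
    induction j with
    | zero => simp
    | succ j ih =>
      have h2 := ih (by omega)
      have hmem : ∀ i : ℕ, i ≤ 2 * ℓ → ((-(ℓ : ZMod L) + i, 0) : Site L) ∈ strip L 0 ℓ := by
        intro i hi
        rw [mem_strip]
        have h3 := valMinAbs_intCast (L := L) (i := -(ℓ : ℤ) + i) (by
          rw [Int.abs_eq_natAbs]; omega)
        push_cast at h3
        simp only [cycDist, h3]
        omega
      have h3 := hv _ (hmem j (by omega)) _ (hmem (j + 1) hj)
        (Or.inr ⟨rfl, Or.inl (by push_cast; ring)⟩)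
      rw [extDeriv, dx₁] at h3
      simp only at h3
      rw [show -(ℓ : ZMod L) + ((j + 1 : ℕ) : ZMod L) - (-(ℓ : ZMod L) + j) = 1 by
        push_cast; ring, valMinAbs_one hL] at h3
      push_cast at h3 ⊢
      linarith
  have h2 := h1 (2 * ℓ) le_rfl
  rw [show -(ℓ : ZMod L) + ((2 * ℓ : ℕ) : ZMod L) = ℓ by push_cast; ring] at h2
  rw [h2]
  push_cast
  ring

/-! ### Comparison of the two response coefficients -/

/-- The constant in the estimate for the displacement of two crossing cuts. -/
def cutConst (K : ℝ) (k : ℕ) : ℝ := 2 * (81 * 4 ^ (k + 3) * 9 * cycSum ^ 2 * K)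

theorem cutConst_nonneg {K : ℝ} (hK : 0 ≤ K) (k : ℕ) : 0 ≤ cutConst K k := by
  rw [cutConst]; positivity

namespace EigenFrame

variable {M : Model L n} {F : EigenFrame M.hamiltonian}

variable (F) in
theorem formCurv_average_left {ι : Type*} (s : Finset ι) (c : ℝ) (ξ : ι → OneForm L)
    (η : OneForm L) :
    F.formCurv (c • ∑ i ∈ s, ξ i) η = c • ∑ i ∈ s, F.formCurv (ξ i) η := by
  rw [map_smul, map_sum, LinearMap.smul_apply, LinearMap.sum_apply]

/-- The uniform flux forms are averages of cuts, so that the adiabatic curvature is, up to a small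
error, the value of `Ω` on two crossing cuts. -/
theorem HasDecay.norm_formCurv_flux_sub_le (hL : 8 ≤ L) (hLe : Even L) {R m g : ℝ}
    (h : M.IsAdmissible R m g) {K : ℝ} {k : ℕ} (hF : F.HasDecay K (k + 3 + 4)) (hK : 0 ≤ K) :
    ‖F.formCurv ((L : ℝ)⁻¹ • dx₁ L) ((L : ℝ)⁻¹ • dx₂ L) -
      F.formCurv (cut Prod.fst 0) (cut Prod.snd 0)‖ ≤ cutConst K k / L ^ k := by
  have hcard : (L : ℝ) = (Finset.univ : Finset (ZMod L)).card := by
    rw [Finset.card_univ, ZMod.card]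
  have hsum : ∀ {p : Site L → ZMod L}, IsCoord p → ∀ x y, Adj x y →
      ((L : ℝ)⁻¹ • fun x y => ((p y - p x).valMinAbs : ℝ) : OneForm L) x y =
        ((L : ℝ)⁻¹ • ∑ a, cut p a : OneForm L) x y := by
    intro p hp x y hxy
    simp only [Pi.smul_apply, Finset.sum_apply, sum_cut hL hp hxy]
  have h1 : ∀ x y, Adj x y → ((L : ℝ)⁻¹ • dx₁ L) x y =
      ((L : ℝ)⁻¹ • ∑ a, cut Prod.fst a : OneForm L) x y := hsum (Or.inl rfl)
  have h2 : ∀ x y, Adj x y → ((L : ℝ)⁻¹ • dx₂ L) x y =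
      ((L : ℝ)⁻¹ • ∑ a, cut Prod.snd a : OneForm L) x y := hsum (Or.inr rfl)
  rw [F.formCurv_congr_left h1, F.formCurv_congr_right h2, F.formCurv_average_left]
  refine norm_average_sub_le hcard Finset.univ_nonempty fun a _ => ?_
  rw [map_smul, map_sum]
  exact norm_average_sub_le hcard Finset.univ_nonempty fun b _ =>
    hF.norm_formCurv_cut_sub_le hL hLe h hK (Or.inl rfl) (Or.inr rfl) a 0 b 0

theorem card_Ico_neg (ℓ : ℕ) : (2 * ℓ : ℝ) = (Finset.Ico (-(ℓ : ℤ)) ℓ).card := by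
  rw [Int.card_Ico, show ((ℓ : ℤ) - -ℓ).toNat = 2 * ℓ by omega]
  push_cast
  rfl

theorem HasDecay.norm_formCurv_strip_sub_le (hL : 8 ≤ L) (hLe : Even L) {R m g : ℝ}
    (h : M.IsAdmissible R m g) {K : ℝ} {k : ℕ} (hF : F.HasDecay K (k + 3 + 4)) (hK : 0 ≤ K)
    {ℓ : ℕ} (hℓ : 1 ≤ ℓ) :
    ‖F.formCurv (stripForm L ℓ) (cut Prod.snd 0) -
      F.formCurv (cut Prod.fst 0) (cut Prod.snd 0)‖ ≤ cutConst K k / L ^ k := by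
  rw [stripForm, F.formCurv_average_left]
  exact norm_average_sub_le (card_Ico_neg ℓ) (Finset.nonempty_Ico.2 (by omega)) fun a _ =>
    hF.norm_formCurv_cut_sub_le hL hLe h hK (Or.inl rfl) (Or.inr rfl) _ 0 0 0

/-- The infinite cut `x₂ = 1/2` may be replaced by the finite path `γ_d`, because the two differ
only at distance `r` from the strip. -/
theorem HasDecay.norm_formCurv_cut_sub_pathForm_le (hL : 8 ≤ L) {K : ℝ} {k : ℕ}
    (hF : F.HasDecay K (k + 4)) (hK : 0 ≤ K) {ℓ r : ℕ} (hℓ : 1 ≤ ℓ) (hr : 1 ≤ r)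
    (hℓr : 2 * (ℓ + 2 * r) < L) :
    ‖F.formCurv (stripForm L ℓ) (cut Prod.snd 0 - pathForm L (ℓ + r))‖ ≤
      81 * 1 * 1 * (K / r ^ k) * (2 * 2 * cycSum ^ 2) := by
  classical
  rw [stripForm, F.formCurv_average_left, ← sub_zero (_ • _)]
  refine norm_average_sub_le (card_Ico_neg ℓ) (Finset.nonempty_Ico.2 (by omega)) fun a ha => ?_
  rw [Finset.mem_Ico] at ha
  rw [sub_zero]
  have hpath : ∀ x y : Site L, Adj x y →
      (cut Prod.snd 0 - pathForm L (ℓ + r) : OneForm L) x y =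
      if x.1.valMinAbs ∈ Finset.Ioc (-((ℓ + r : ℕ) : ℤ)) (ℓ + r : ℕ) then 0
        else cut Prod.snd 0 x y := by
    intro x y hxy
    rw [Pi.sub_apply, Pi.sub_apply, pathForm_apply hL (by omega) hxy]
    split_ifs <;> simp
  have hcyc : ∀ x : Site L, x.1 ∈ ({(a : ZMod L), (a : ZMod L) + 1} : Finset (ZMod L)) →
      cycDist x.1 ≤ ℓ := by
    intro x hx
    have h1 := valMinAbs_intCast (L := L) (i := a) (by rw [Int.abs_eq_natAbs]; omega)
    have h2 := valMinAbs_intCast (L := L) (i := a + 1) (by rw [Int.abs_eq_natAbs]; omega)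
    push_cast at h2
    rw [Finset.mem_insert, Finset.mem_singleton] at hx
    rcases hx with hx | hx <;> rw [hx, cycDist] <;> omega
  refine hF.norm_formCurv_le hK (ρ := r) (by exact_mod_cast hr)
    (s := Finset.univ.filter fun x => x.1 ∈ ({(a : ZMod L), (a : ZMod L) + 1} : Finset (ZMod L)))
    (t := Finset.univ.filter fun x =>
      x.2 ∈ ({0, 1} : Finset (ZMod L)) ∧ ℓ + r ≤ cycDist x.1)
    zero_le_one zero_le_one (fun x y _ => abs_cut_le _ _ _ _) ?_ ?_ ?_ ?_ ?_
  · intro x y hxy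
    rw [hpath x y hxy]
    split_ifs
    · simp
    · exact abs_cut_le _ _ _ _
  · intro x hx y _
    simp only [Finset.mem_filter, Finset.mem_univ, true_and, Finset.mem_insert,
      Finset.mem_singleton, not_or] at hx
    exact cut_eq_zero hx.1 hx.2 y
  · intro x hx y hxy
    rw [hpath x y hxy]
    split_ifs with h1
    · rfl
    · have h2 : ℓ + r ≤ cycDist x.1 := by
        rw [Finset.mem_Ioc] at h1
        rw [cycDist]
        omega
      simp only [Finset.mem_filter, Finset.mem_univ, true_and, Finset.mem_insert,
        Finset.mem_singleton, h2, and_true, not_or] at hx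
      exact cut_eq_zero hx.1 (by rw [zero_add]; exact hx.2) y
  · intro x hx x' hx'
    have h1 := hcyc x (Finset.mem_filter.1 hx).2
    have h2 := (Finset.mem_filter.1 hx').2.2
    have h3 := cycDist_add_le (x'.1 - x.1) x.1
    rw [sub_add_cancel, ← cycDist_neg (x'.1 - x.1), neg_sub] at h3
    have h4 : r ≤ 1 + siteDist x x' := by rw [siteDist]; omega
    exact_mod_cast h4
  · refine (sum_siteWeight_column_row_le {(a : ZMod L), (a : ZMod L) + 1} {0, 1}
      (fun x hx => (Finset.mem_filter.1 hx).2) fun x hx => (Finset.mem_filter.1 hx).2.1).trans ?_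
    have h1 : (({(a : ZMod L), (a : ZMod L) + 1} : Finset (ZMod L)).card : ℝ) ≤ 2 := by
      exact_mod_cast Finset.card_le_two
    have h2 : ((({0, 1} : Finset (ZMod L)).card : ℕ) : ℝ) ≤ 2 := by
      exact_mod_cast Finset.card_le_two
    gcongr

/-- A form which vanishes for `|x₁| < ℓ + 2r` has little influence on the current through
`γ_{ℓ+r}`. -/
theorem HasDecay.norm_formCurv_pathForm_le (hL : 8 ≤ L) {K : ℝ} {k : ℕ}
    (hF : F.HasDecay K (k + 4)) (hK : 0 ≤ K) {ℓ r : ℕ} (hr : 1 ≤ r)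
    (hℓr : 2 * (ℓ + 2 * r) < L) {ν : OneForm L} {c : ℝ} (hc : 0 ≤ c)
    (hν : ∀ x y, Adj x y → |ν x y| ≤ c)
    (hν0 : ∀ x y, Adj x y → cycDist x.1 < ℓ + 2 * r → ν x y = 0) :
    ‖F.formCurv ν (pathForm L (ℓ + r))‖ ≤
      81 * c * 1 * (K / r ^ k) * (4 * (ℓ + r) * cycSum ^ 2) := by
  classical
  set I : Finset (ZMod L) :=
    (Finset.Ioc (-((ℓ + r : ℕ) : ℤ)) (ℓ + r : ℕ)).image fun a : ℤ => (a : ZMod L) with hI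
  have hmem : ∀ z : ZMod L, z.valMinAbs ∈ Finset.Ioc (-((ℓ + r : ℕ) : ℤ)) (ℓ + r : ℕ) → z ∈ I :=
    fun z hz => Finset.mem_image.2 ⟨_, hz, ZMod.coe_valMinAbs z⟩
  have hcyc : ∀ z ∈ I, cycDist z ≤ ℓ + r := by
    intro z hz
    obtain ⟨a, ha, rfl⟩ := Finset.mem_image.1 hz
    rw [Finset.mem_Ioc] at ha
    rw [cycDist, valMinAbs_intCast (by rw [Int.abs_eq_natAbs]; omega)]
    omega
  have hcard : ((I ×ˢ ({0, 1} : Finset (ZMod L))).card : ℝ) ≤ 4 * (ℓ + r) := by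
    have h1 : I.card ≤ 2 * (ℓ + r) := by
      refine Finset.card_image_le.trans (le_of_eq ?_)
      rw [Int.card_Ioc]
      omega
    have h2 : (I ×ˢ ({0, 1} : Finset (ZMod L))).card ≤ 2 * (ℓ + r) * 2 := by
      rw [Finset.card_product]
      exact Nat.mul_le_mul h1 Finset.card_le_two
    have h3 : ((I ×ˢ ({0, 1} : Finset (ZMod L))).card : ℝ) ≤ ((2 * (ℓ + r) * 2 : ℕ) : ℝ) := by
      exact_mod_cast h2
    push_cast at h3
    linarith
  refine hF.norm_formCurv_le hK (ρ := r) (by exact_mod_cast hr)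
    (s := Finset.univ.filter fun x => ℓ + 2 * r ≤ cycDist x.1) (t := I ×ˢ {0, 1})
    hc zero_le_one hν ?_ ?_ ?_ ?_ ?_
  · intro x y hxy
    rw [pathForm_apply hL (by omega) hxy]
    split_ifs
    · exact abs_cut_le _ _ _ _
    · simp
  · intro x hx y hxy
    simp only [Finset.mem_filter, Finset.mem_univ, true_and, not_le] at hx
    exact hν0 x y hxy hx
  · intro x hx y hxy
    rw [pathForm_apply hL (by omega) hxy]
    split_ifs with h1
    · simp only [Finset.mem_product, hmem _ h1, true_and, Finset.mem_insert,
        Finset.mem_singleton, not_or] at hx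
      exact cut_eq_zero hx.1 (by rw [zero_add]; exact hx.2) y
    · rfl
  · intro x hx x' hx'
    have h1 := (Finset.mem_filter.1 hx).2
    have h2 := hcyc x'.1 (Finset.mem_product.1 hx').1
    have h3 := cycDist_add_le (x.1 - x'.1) x'.1
    rw [sub_add_cancel] at h3
    have h4 : r ≤ 1 + siteDist x x' := by rw [siteDist]; omega
    exact_mod_cast h4
  · rw [Finset.sum_comm]
    refine (Finset.sum_le_card_nsmul _ _ (cycSum ^ 2) fun x' _ => ?_).trans ?_
    · simp only [siteWeight_comm _ x']
      exact sum_siteWeight_le x' _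
    · rw [nsmul_eq_mul]
      gcongr

end EigenFrame

/-- The normalized drive `dv / Δv` is the averaged cut `(2ℓ)⁻¹ dx₁` up to a form which vanishes for
`|x₁| < ℓ + 2r`. -/
theorem drive_sub_stripForm {ℓ r : ℕ} (hL : 8 ≤ L) (hℓ : 1 ≤ ℓ) (hr : 1 ≤ r)
    (hℓr : 2 * (ℓ + 2 * r) < L) {v : Site L → ℝ} {E C : ℝ} (hE : E ≠ 0)
    (hC : ∀ x y, Adj x y → |extDeriv v x y| ≤ C)
    (hv : ∀ x ∈ strip L 0 ℓ, ∀ y ∈ strip L 0 ℓ, Adj x y → extDeriv v x y = E * dx₁ L x y)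
    (hv0 : ∀ x ∈ strip L ℓ (ℓ + 2 * r), ∀ y ∈ strip L ℓ (ℓ + 2 * r), Adj x y →
      extDeriv v x y = 0) :
    (∀ x y, Adj x y → cycDist x.1 < ℓ + 2 * r →
      ((2 * ℓ * E)⁻¹ • extDeriv v - stripForm L ℓ) x y = 0) ∧
    ∀ x y, Adj x y → |((2 * ℓ * E)⁻¹ • extDeriv v - stripForm L ℓ) x y| ≤
      (2 * ℓ * |E|)⁻¹ * |C| := by
  have hnear : ∀ x y, Adj x y → cycDist x.1 < ℓ + 2 * r →
      ((2 * ℓ * E)⁻¹ • extDeriv v - stripForm L ℓ) x y = 0 := by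
    intro x y hxy hx
    rw [Pi.sub_apply, Pi.sub_apply, Pi.smul_apply, Pi.smul_apply, smul_eq_mul]
    rcases strip_dichotomy (ℓ := ℓ) hxy hx with ⟨h1, h2⟩ | ⟨h1, h2⟩
    · rw [hv x h1 y h2 hxy, stripForm_of_le hL (by omega) hxy (mem_strip.1 h1).2
        (mem_strip.1 h2).2]
      field_simp
      ring
    · rw [hv0 x h1 y h2 hxy, stripForm_of_ge (by omega) (mem_strip.1 h1).1 (mem_strip.1 h2).1]
      ring
  refine ⟨hnear, fun x y hxy => ?_⟩
  rcases lt_or_ge (cycDist x.1) (ℓ + 2 * r) with hx | hx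
  · rw [hnear x y hxy hx, abs_zero]
    positivity
  · have h0 := hxy.siteDist_le
    have h1 : cycDist (x.1 - y.1) ≤ 1 := by simp only [siteDist] at h0; omega
    have h2 := cycDist_add_le (x.1 - y.1) y.1
    rw [sub_add_cancel] at h2
    rw [Pi.sub_apply, Pi.sub_apply, Pi.smul_apply, Pi.smul_apply, smul_eq_mul,
      stripForm_of_ge (by omega) (by omega) (by omega), sub_zero, abs_mul, abs_inv, abs_mul,
      abs_of_nonneg (by positivity : (0 : ℝ) ≤ 2 * ℓ)]
    exact mul_le_mul_of_nonneg_left ((hC x y hxy).trans (le_abs_self C)) (by positivity)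

/-- The comparison of the curvature on the uniform flux forms with the normalized response of the
path current. -/
theorem EigenFrame.norm_formCurv_flux_sub_drive_le {M : Model L n}
    (F : EigenFrame M.hamiltonian) (hLe : Even L) {R m g : ℝ} (h : M.IsAdmissible R m g)
    {k : ℕ} {K₁ K₂ K₃ : ℝ} (h₁ : F.HasDecay K₁ (k + 3 + 4)) (h₂ : F.HasDecay K₂ (k + 4))
    (h₃ : F.HasDecay K₃ (k + 1 + 4)) (hK₁ : 0 ≤ K₁) (hK₂ : 0 ≤ K₂) (hK₃ : 0 ≤ K₃)
    {ℓ r : ℕ} (hℓ : 1 ≤ ℓ) (hr : 1 ≤ r) (hℓr : 2 * (ℓ + 2 * r) < L)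
    {v : Site L → ℝ} {E C : ℝ} (hE : E ≠ 0)
    (hC : ∀ x y, Adj x y → |extDeriv v x y| ≤ C)
    (hv : ∀ x ∈ strip L 0 ℓ, ∀ y ∈ strip L 0 ℓ, Adj x y → extDeriv v x y = E * dx₁ L x y)
    (hv0 : ∀ x ∈ strip L ℓ (ℓ + 2 * r), ∀ y ∈ strip L ℓ (ℓ + 2 * r), Adj x y →
      extDeriv v x y = 0) :
    ‖F.formCurv ((L : ℝ)⁻¹ • dx₁ L) ((L : ℝ)⁻¹ • dx₂ L) -
      F.formCurv (extDeriv v) (pathForm L (ℓ + r)) / ((2 * ℓ * E : ℝ) : ℂ)‖ ≤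
      (2 * cutConst K₁ k + 324 * K₂ * cycSum ^ 2 + 324 * (|C| / |E|) * K₃ * cycSum ^ 2) /
        r ^ k := by
  have hL : 8 ≤ L := by
    obtain ⟨l, hl⟩ := hLe
    omega
  have hr0 : (0 : ℝ) < r := by exact_mod_cast hr
  have hℓ0 : (0 : ℝ) < ℓ := by exact_mod_cast hℓ
  obtain ⟨hnear, hle⟩ := drive_sub_stripForm hL hℓ hr hℓr hE hC hv hv0
  set ν : OneForm L := (2 * ℓ * E)⁻¹ • extDeriv v - stripForm L ℓ with hνdef
  have b1 := h₁.norm_formCurv_flux_sub_le hL hLe h hK₁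
  have b2 := h₁.norm_formCurv_strip_sub_le hL hLe h hK₁ hℓ
  have b3 := h₂.norm_formCurv_cut_sub_pathForm_le hL hK₂ hℓ hr hℓr
  have b4 := h₃.norm_formCurv_pathForm_le hL hK₃ hr hℓr (by positivity) hle hnear
  have hLr : cutConst K₁ k / (L : ℝ) ^ k ≤ cutConst K₁ k / r ^ k := by
    have : (r : ℝ) ≤ L := by exact_mod_cast (by omega : r ≤ L)
    have := cutConst_nonneg hK₁ k
    gcongr
  have e3 : F.formCurv (extDeriv v) (pathForm L (ℓ + r)) / ((2 * ℓ * E : ℝ) : ℂ) =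
      F.formCurv (stripForm L ℓ) (pathForm L (ℓ + r)) + F.formCurv ν (pathForm L (ℓ + r)) := by
    rw [← LinearMap.add_apply, ← map_add, hνdef, add_sub_cancel, map_smul, LinearMap.smul_apply,
      Complex.real_smul, Complex.ofReal_inv, div_eq_inv_mul]
  rw [map_sub] at b3
  rw [e3]
  -- One of the `r + 1` powers of decay pays for the length of the path relative to the strip.
  have hbound : 81 * ((2 * ℓ * |E|)⁻¹ * |C|) * 1 * (K₃ / (r : ℝ) ^ (k + 1)) *
      (4 * (ℓ + r) * cycSum ^ 2) ≤ 324 * (|C| / |E|) * K₃ * cycSum ^ 2 / r ^ k := by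
    have hE' : 0 < |E| := abs_pos.2 hE
    have hlr : (ℓ + r : ℝ) ≤ 2 * (ℓ * r) := by
      have h1 : (1 : ℝ) ≤ ℓ := by exact_mod_cast hℓ
      have h2 : (1 : ℝ) ≤ r := by exact_mod_cast hr
      nlinarith
    have e1 : 81 * ((2 * ℓ * |E|)⁻¹ * |C|) * 1 * (K₃ / (r : ℝ) ^ (k + 1)) *
        (4 * (ℓ + r) * cycSum ^ 2) =
        324 * (|C| / |E|) * K₃ * cycSum ^ 2 / r ^ k * ((ℓ + r) / (2 * (ℓ * r))) := by
      field_simp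
      ring
    rw [e1]
    refine mul_le_of_le_one_right (by positivity) ((div_le_one (by positivity)).2 hlr)
  have hb3 : 81 * 1 * 1 * (K₂ / (r : ℝ) ^ k) * (2 * 2 * cycSum ^ 2) =
      324 * K₂ * cycSum ^ 2 / r ^ k := by ring
  rw [hb3] at b3
  have b4' := b4.trans hbound
  have b2' := b2.trans hLr
  have b1' := b1.trans hLr
  generalize F.formCurv ((L : ℝ)⁻¹ • dx₁ L) ((L : ℝ)⁻¹ • dx₂ L) = z₁ at *
  generalize F.formCurv (cut Prod.fst 0) (cut Prod.snd 0) = z₂ at *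
  generalize F.formCurv (stripForm L ℓ) (cut Prod.snd 0) = z₃ at *
  generalize F.formCurv (stripForm L ℓ) (pathForm L (ℓ + r)) = z₄ at *
  generalize F.formCurv ν (pathForm L (ℓ + r)) = z₅ at *
  have e4 : z₁ - (z₄ + z₅) = (z₁ - z₂) - (z₃ - z₂) + (z₃ - z₄) - z₅ := by ring
  rw [e4]
  refine (norm_sub_le _ _).trans ?_
  refine (add_le_add ((norm_add_le _ _).trans (add_le_add (norm_sub_le _ _) le_rfl))
    le_rfl).trans ?_
  rw [add_div, add_div, mul_div_assoc]
  linarith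

theorem fluxForm_zero_right (φ : ℝ) : fluxForm L φ 0 = φ • ((L : ℝ)⁻¹ • dx₁ L : OneForm L) := by
  funext x y
  simp only [fluxForm, Pi.smul_apply, smul_eq_mul]
  ring

theorem fluxForm_zero_left (φ : ℝ) : fluxForm L 0 φ = φ • ((L : ℝ)⁻¹ • dx₂ L : OneForm L) := by
  funext x y
  simp only [fluxForm, Pi.smul_apply, smul_eq_mul]
  ring

end HallTorus

end

theorem theorem4p3 (n : ℕ) (R m g : ℝ) (hg : 0 < g) (E C : ℝ) (hE : E ≠ 0) (k : ℕ) :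
    ∃ K : ℝ, ∀ (L : ℕ) [NeZero L], Even L →
      ∀ M : HallTorus.Model L n, M.IsAdmissible R m g →
      ∀ ℓ r : ℕ, 1 ≤ ℓ → 1 ≤ r → 2 * (ℓ + 2 * r) < L →
      ∀ v : HallTorus.Site L → ℝ,
        (∀ x y, HallTorus.Adj x y → |HallTorus.extDeriv v x y| ≤ C) →
        (∀ x ∈ HallTorus.strip L 0 ℓ, ∀ y ∈ HallTorus.strip L 0 ℓ, HallTorus.Adj x y →
          HallTorus.extDeriv v x y = E * HallTorus.dx₁ L x y) →
        (∀ x ∈ HallTorus.strip L ℓ (ℓ + 2 * r), ∀ y ∈ HallTorus.strip L ℓ (ℓ + 2 * r),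
          HallTorus.Adj x y → HallTorus.extDeriv v x y = 0) →
      ∃ κ χ : ℂ,
        M.IsAdiabaticCurvature κ ∧
        HallTorus.IsKuboResponse M.hamiltonian (M.pathCurrent (ℓ + r))
          (HallTorus.potential n v) 0 χ ∧
        ‖κ - χ / ((v ((ℓ : ZMod L), 0) - v (-(ℓ : ZMod L), 0) : ℝ) : ℂ)‖ ≤ K / (r : ℝ) ^ k := by
  open HallTorus in
  -- For negative `m` no Hamiltonian is admissible.
  rcases lt_or_ge m 0 with hm | hm
  · exact ⟨0, fun L _ _ M h => absurd h.bound_nonneg (not_le.2 hm)⟩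
  obtain ⟨K₁, hK₁, hd₁⟩ := exists_norm_curv_bond_le n R m hm hg (k + 3 + 4)
  obtain ⟨K₂, hK₂, hd₂⟩ := exists_norm_curv_bond_le n R m hm hg (k + 4)
  obtain ⟨K₃, hK₃, hd₃⟩ := exists_norm_curv_bond_le n R m hm hg (k + 1 + 4)
  refine ⟨2 * cutConst K₁ k + 324 * K₂ * cycSum ^ 2 + 324 * (|C| / |E|) * K₃ * cycSum ^ 2, ?_⟩
  intro L _ hLe M h ℓ r hℓ hr hℓr v hC hv hv0
  have hL : 8 ≤ L := by
    obtain ⟨l, hl⟩ := hLe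
    omega
  obtain ⟨F⟩ := nonempty_eigenFrame
    (h.isHermitian_hamiltonianWith (A := 0) fun x y _ => by simp : M.hamiltonian.IsHermitian)
  refine ⟨F.formCurv ((L : ℝ)⁻¹ • dx₁ L) ((L : ℝ)⁻¹ • dx₂ L),
    F.formCurv (extDeriv v) (pathForm L (ℓ + r)), ?_, ?_, ?_⟩
  · refine F.isAdiabaticCurvature hg h _ _ (fun φ => by rw [Model.twist, fluxForm_zero_right])
      (fun φ => by rw [Model.twist, fluxForm_zero_left]) (fun x y hxy => ?_) fun x y hxy => ?_
    · simp only [Pi.smul_apply, smul_eq_mul, dx₁]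
      rw [sum_cut_swap hL (p := Prod.fst) (Or.inl rfl) hxy, mul_neg]
    · simp only [Pi.smul_apply, smul_eq_mul, dx₂]
      rw [sum_cut_swap hL (p := Prod.snd) (Or.inr rfl) hxy, mul_neg]
  · rw [M.pathCurrent_eq hL]
    exact F.isKuboResponse_formCurv hg h v _
  · rw [potential_drop hL (by omega) hv]
    exact F.norm_formCurv_flux_sub_drive_le hLe h (hd₁ L M h F) (hd₂ L M h F) (hd₃ L M h F)
      hK₁ hK₂ hK₃ hℓ hr hℓr hE hC hv hv0
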